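/- Let $d,p\ge 1$ be integers and let $f:\mathbb R^d\to[0,\infty)$ be a measurable probability density. Write $G(t)=\{x\in\mathbb R^d: f(x)\ge t\}$, $B_r(x)$ for the open ball and $\|\cdot\|$ for the Euclidean norm. Let $l\le u<\sup f<\infty$ and assume that $G(t)$ is compact, nonempty and nonconvex for every $t\in[l,u]$. Moreover assume: (A) There are $\zeta>0$ with $G(u+\zeta)$ bounded, a bounded open set $U\supset\overline{G(l-\zeta)}\setminus\operatorname{int}G(u+\zeta)$ and constants $m>0$, $k$ such that $f\in\mathcal C^p(U)$, $\|\nabla f\|\ge m$ on $U$ and $\|\nabla f(x)-\nabla f(y)\|\le k\|x-y\|$ for all $x,y\in U$. (K) $K:\mathbb R^d\to\mathbb R$ is continuous with bounded support, has finite (total) variation on $\mathbb R^d$ and is a kernel of order at least $p$, that is, $\int K=1$ and $\int x^\alpha K(x)\,dx=0$ for all multi-indices with $1\le|\alpha|<p$. The bandwidths $h_n$ are positive for all large $n$ and, up to constant factors from above and below, of order $(\log n/n)^{1/(d+2p)}$. If $K$ takes negative values, assume in addition that $f$ is uniformly continuous on $\mathbb R^d$. Let $X_1,X_2,\dots$ be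 independent random vectors with density $f$, let $\mathcal X_n=\{X_1,\dots,X_n\}$ and $f_n(x)=\frac1{nh_n^d}\sum_{i=1}^nK\big(\frac{x-X_i}{h_n}\big)$. For $M>0$ put $D_n=M(\log n/n)^{p/(d+2p)}$ and $$\mathcal X_n^+(t)=\{X\in\mathcal X_n:f_n(X)\ge t+D_n\},\qquad \mathcal X_n^-(t)=\{X\in\mathcal X_n:f_n(X)<t-D_n\}.$$ For a set $A\subset\mathbb R^d$ and $r>0$ let $C_r(A)=\bigcap_{x:\,B_r(x)\cap A=\emptyset}B_r(x)^c$ be its $r$-convex hull, let $$\hat r_0(t)=\sup\{\gamma>0:\ C_\gamma(\mathcal X_n^+(t))\cap\mathcal X_n^-(t)=\emptyset\},$$ and, for $\nu\in(0,1)$, let $r_n(t)=\nu\,\hat r_0(t)$. Then there is $M_0>0$ such that for every $M\ge M_0$ and every fixed $\nu\in(0,1)$ there is a constant $C$ such that, almost surely, for all sufficiently large $n$, $$\sup_{t\in[l,u]}d_H\big(C_{r_n(t)}(\mathcal X_n^+(t)),G(t)\big)\le C\max\left\{\Big(\frac{\log n}{n}\Big)^{\frac p{d+2p}},\Big(\frac{\log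 n}{n}\Big)^{\frac2{d+1}}\right\}$$ and $$\sup_{t\in[l,u]}\mu\big(C_{r_n(t)}(\mathcal X_n^+(t))\,\triangle\,G(t)\big)\le C\max\left\{\Big(\frac{\log n}{n}\Big)^{\frac p{d+2p}},\Big(\frac{\log n}{n}\Big)^{\frac2{d+1}}\right\},$$ where $d_H$ is the Hausdorff distance and $\mu$ is Lebesgue measure. -/

import Mathlib

open MeasureTheory ProbabilityTheory Filter Asymptotics

noncomputable section

namespace LevelSetEstimation

/-- The Euclidean space of dimension `d`, with the Euclidean norm and Lebesgue measure. -/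
abbrev E (d : ℕ) : Type := EuclideanSpace ℝ (Fin d)

variable {d : ℕ}

/-- The level set `G(t) = {x : f x ≥ t}`. -/
def levelSet (f : E d → ℝ) (t : ℝ) : Set (E d) := {x | t ≤ f x}

/-- The `r`-convex hull: the intersection of the complements of all open balls of radius `r`
that do not meet `A`. -/
def rConvexHull (r : ℝ) (A : Set (E d)) : Set (E d) :=
  ⋂ x ∈ {x : E d | Metric.ball x r ∩ A = ∅}, (Metric.ball x r)ᶜ

/-- Smoothness of the density around the levels in `[l, u]`: `l ≤ u < sup f < ∞`, and, for some
`ζ > 0` such that `G(u + ζ)` is bounded and some bounded open set `U` containing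
`closure G(l - ζ) \ interior G(u + ζ)`, the function `f` is `C^p` on `U`, with a gradient that is
bounded below in norm by some `m > 0` and Lipschitz on `U`. -/
def AssumptionA (p : ℕ) (f : E d → ℝ) (l u : ℝ) : Prop :=
  l ≤ u ∧ BddAbove (Set.range f) ∧ u < ⨆ x, f x ∧
  ∃ (U : Set (E d)) (ζ m k : ℝ),
    0 < ζ ∧ Bornology.IsBounded (levelSet f (u + ζ)) ∧
    IsOpen U ∧ Bornology.IsBounded U ∧
    closure (levelSet f (l - ζ)) \ interior (levelSet f (u + ζ)) ⊆ U ∧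
    ContDiffOn ℝ p f U ∧
    0 < m ∧ (∀ x ∈ U, m ≤ ‖gradient f x‖) ∧
    ∀ x ∈ U, ∀ y ∈ U, ‖gradient f x - gradient f y‖ ≤ k * ‖x - y‖

/-- The divergence of a vector field. -/
def divergence (φ : E d → E d) (x : E d) : ℝ :=
  ∑ i, (fderiv ℝ φ x (EuclideanSpace.single i 1)) i

/-- Finite total variation on the whole space: the integrals of `K` against the divergences of the
compactly supported `C¹` vector fields of norm at most one are bounded. -/
def HasFiniteVariation (K : E d → ℝ) : Prop :=
  ∃ V : ℝ, ∀ φ : E d → E d, ContDiff ℝ 1 φ → HasCompactSupport φ → (∀ x, ‖φ x‖ ≤ 1) →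
    ∫ x, K x * divergence φ x ≤ V

/-- `K` integrates to one and its moments of total degree `1, …, p - 1` vanish. -/
def IsKernelOfOrderAtLeast (p : ℕ) (K : E d → ℝ) : Prop :=
  ∫ x, K x = 1 ∧
  ∀ α : Fin d → ℕ, 0 < ∑ i, α i → ∑ i, α i < p → ∫ x : E d, (∏ i, x i ^ α i) * K x = 0

/-- A continuous kernel of order at least `p`, with bounded support and finite variation, and a
bandwidth sequence `h` that is positive and of exact order `(log n / n)^(1/(d+2p))`. -/
def AssumptionK (p : ℕ) (K : E d → ℝ) (h : ℕ → ℝ) : Prop :=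
  Continuous K ∧ HasCompactSupport K ∧ IsKernelOfOrderAtLeast p K ∧ HasFiniteVariation K ∧
  (∀ᶠ n in atTop, 0 < h n) ∧
  h =Θ[atTop] fun n : ℕ => (Real.log n / n) ^ (1 / ((d : ℝ) + 2 * p))

/-- The kernel density estimator with bandwidth `h` from the first `n` points of `X`. -/
def kde (K : E d → ℝ) (h : ℝ) (n : ℕ) (X : ℕ → E d) (x : E d) : ℝ :=
  1 / (n * h ^ d) * ∑ i ∈ Finset.range n, K (h⁻¹ • (x - X i))

/-- The rate `(log n / n)^(p/(d+2p))`. -/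
def kdeRate (d p n : ℕ) : ℝ := (Real.log n / n) ^ ((p : ℝ) / (d + 2 * p))

/-- The sample points at which the estimator is at least `t + D`. -/
def samplePlus (K : E d → ℝ) (h D : ℝ) (n : ℕ) (X : ℕ → E d) (t : ℝ) : Set (E d) :=
  {x | ∃ i < n, x = X i ∧ t + D ≤ kde K h n X x}

/-- The sample points at which the estimator is less than `t - D`. -/
def sampleMinus (K : E d → ℝ) (h D : ℝ) (n : ℕ) (X : ℕ → E d) (t : ℝ) : Set (E d) :=
  {x | ∃ i < n, x = X i ∧ kde K h n X x < t - D}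

/-- The estimator of the shape parameter: the supremum of all `γ > 0` for which the `γ`-convex
hull of the plus sample contains no point of the minus sample.
If this set of `γ` were empty or unbounded, the value would be `0`; as the `0`-convex hull of any
set is the whole space, a level set estimator built from it would be at infinite Hausdorff
distance from every bounded set (for `d ≥ 1`). -/
def rHat (K : E d → ℝ) (h D : ℝ) (n : ℕ) (X : ℕ → E d) (t : ℝ) : ℝ :=
  sSup {γ : ℝ | 0 < γ ∧
    rConvexHull γ (samplePlus K h D n X t) ∩ sampleMinus K h D n X t = ∅}

/-- The level set estimator: the `ν r̂₀(t)`-convex hull of the plus sample. -/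
def levelSetEstimator (K : E d → ℝ) (h D ν : ℝ) (n : ℕ) (X : ℕ → E d) (t : ℝ) : Set (E d) :=
  rConvexHull (ν * rHat K h D n X t) (samplePlus K h D n X t)

/-- The convergence rate of the level set estimator. -/
def levelSetRate (d p n : ℕ) : ℝ :=
  max (kdeRate d p n) ((Real.log n / n) ^ ((2 : ℝ) / (d + 1)))

/-- `X 0, X 1, …` are independent random vectors, each with density `f` for Lebesgue measure. -/
def IsSampleFrom {Ω : Type*} [MeasurableSpace Ω] (P : Measure Ω) (X : ℕ → Ω → E d)
    (f : E d → ℝ) : Prop :=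
  (∀ i, Measurable (X i)) ∧ iIndepFun X P ∧
  ∀ i, P.map (X i) = volume.withDensity fun x => ENNReal.ofReal (f x)

end LevelSetEstimation

end

/-! The proof separates chance from geometry, with a resolution `s` of the order of `levelSetRate`
as the interface. `Resolves` says that the plus sample lies inside `G(t)`, that the minus sample
lies outside, and that each of them meets every box of thickness `s` and width `√s` that sits on its
side of the level with a density margin `s`.

Chance (`eventually_resolves`): at the sample points the estimator differs from `f` near the levels
by the order of `kdeRate`. The deviation from the mean is controlled by a Chernoff bound
conditionally on the evaluation point and a union bound over the `n` points, the bias by Taylor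
expansion and the vanishing moments. A box has volume of order `s ^ ((d + 1) / 2)`, so volume `log n
/ n` means thickness `(log n / n) ^ (2 / (d + 1))`; a union bound over a polynomial grid of boxes
and Borel–Cantelli show that none of them stays empty. The rate is the larger of the two orders.

Geometry: boxes have the parabolic shape that fits the curvature of balls and of the boundary. A
ball of radius bounded below around a point with `f ≥ t + C s` contains a box with `f ≥ t + s`,
hence a plus point, so the hull contains that point (`mem_rConvexHull_of_le`). Conversely, suppose
that the hull of radius `r` contains a point at distance more than a multiple of `s` from `G(t)`.
Then a whole box outside `G(t)` lies in the hull of the larger radius `r / ν'`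
(`exists_box_subset`). Indeed, a ball of that radius which reaches the box and misses the plus
sample must be almost tangent to the boundary, and a ball of radius `r` that protrudes slightly
behind it would have a plus point in a thin lens outside `G(t)`. The box contains a minus point, but
for `ν' = (1 + ν) / 2` the radius `r / ν'` is still below the supremum `r̂₀(t)`, so its hull avoids
the minus sample. This is where `ν < 1` enters.

The supremum is bounded below because level sets are `γ`-convex for small `γ`, and above because
nonconvexity puts a minus point into the hull of every large radius. The gradient bound turns
density errors into distances and into volumes of strips between levels. -/

namespace LevelSetEstimation

/-! ### Smooth zone, boxes, and the points that the hull must contain. -/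

variable {d : ℕ}

/-- A neighbourhood `Z` of the level sets with levels in `[l, u]`, on which `f` has a
Lipschitz gradient that does not vanish, in quantitative form. -/
structure SmoothZone (f : E d → ℝ) (l u ζ m k L δ : ℝ) (Z : Set (E d)) : Prop where
  le_u : l ≤ u
  ζ_pos : 0 < ζ
  m_pos : 0 < m
  k_pos : 0 < k
  δ_pos : 0 < δ
  low_pos : 0 < l - ζ
  isCompact : IsCompact Z
  isBounded : Bornology.IsBounded (levelSet f (l - ζ))
  mem_of_lt : ∀ x, l - ζ ≤ f x → f x < u + ζ → x ∈ Z
  m_le : ∀ a ∈ Z, m ≤ ‖gradient f a‖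
  le_L : ∀ a ∈ Z, ‖gradient f a‖ ≤ L
  taylor : ∀ a ∈ Z, ∀ z, ‖z - a‖ ≤ δ →
    |f z - f a - inner ℝ (gradient f a) (z - a)| ≤ k * ‖z - a‖ ^ 2
  gradient_lip : ∀ a ∈ Z, ∀ z ∈ Z, ‖gradient f z - gradient f a‖ ≤ k * ‖z - a‖
  -- Outside `Z`, where `f` need not be regular, this lower bound on a whole ball takes the place of
  -- the Taylor bound.
  deep : ∀ x, x ∉ Z → l - ζ ≤ f x → ∀ y, ‖y - x‖ ≤ δ → u + ζ / 2 ≤ f y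

/-- The points near `x` that are even closer to `x` in the direction `η`. -/
def box (x η : E d) (s : ℝ) : Set (E d) := {z | |inner ℝ (z - x) η| ≤ s ∧ ‖z - x‖ ≤ √s}

theorem mem_rConvexHull {r : ℝ} {A : Set (E d)} {x : E d} :
    x ∈ rConvexHull r A ↔ ∀ c, ‖x - c‖ < r → ∃ z ∈ A, ‖z - c‖ < r := by
  simp only [rConvexHull, Set.mem_iInter, Set.mem_ofPred_eq, Set.mem_compl_iff, Metric.mem_ball,
    dist_eq_norm]
  refine forall_congr' fun c => ?_
  rw [← not_imp_not, not_not, ← Ne.eq_def, ← Set.nonempty_iff_ne_empty]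
  refine imp_congr_right fun _ => ⟨fun ⟨z, h1, h2⟩ => ⟨z, h2, ?_⟩, fun ⟨z, h1, h2⟩ => ⟨z, ?_, h1⟩⟩
  · simpa [dist_eq_norm] using h1
  · simpa [dist_eq_norm] using h2

theorem rConvexHull_mono_set {r : ℝ} {A B : Set (E d)} (h : A ⊆ B) :
    rConvexHull r A ⊆ rConvexHull r B := fun x hx => by
  rw [mem_rConvexHull] at hx ⊢
  intro c hc
  obtain ⟨z, hz, h'⟩ := hx c hc
  exact ⟨z, h hz, h'⟩

/-- A ball of radius `γ` around a centre near `x` contains a ball of radius `r` that still contains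
`x`: the centre slides towards `x` by the factor `r / γ`. -/
theorem rConvexHull_mono_radius {r γ : ℝ} (hr : 0 < r) (h : r ≤ γ) {A : Set (E d)} :
    rConvexHull r A ⊆ rConvexHull γ A := fun x hx => by
  rw [mem_rConvexHull] at hx ⊢
  intro c hc
  have hγ : 0 < γ := hr.trans_le h
  obtain ⟨z, hz, h'⟩ := hx (x + (r / γ) • (c - x)) (by
    rw [sub_add_cancel_left, norm_neg, norm_smul, Real.norm_of_nonneg (by positivity),
      norm_sub_rev]
    calc r / γ * ‖x - c‖ < r / γ * γ := by gcongr
      _ = r := by field_simp)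
  refine ⟨z, hz, ?_⟩
  have e : z - c = (z - (x + (r / γ) • (c - x))) + (1 - r / γ) • (x - c) := by
    module
  have h1 : 0 ≤ 1 - r / γ := by
    rw [sub_nonneg, div_le_one hγ]; exact h
  calc ‖z - c‖ ≤ ‖z - (x + (r / γ) • (c - x))‖ + ‖(1 - r / γ) • (x - c)‖ := by
        rw [e]; exact norm_add_le _ _
    _ < r + (1 - r / γ) * γ := by
      rw [norm_smul, Real.norm_of_nonneg h1]
      have := mul_le_mul_of_nonneg_left hc.le h1
      linarith
    _ = γ := by field_simp; ring

/-- A vector is its norm times a unit vector. -/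
theorem exists_unit_smul {η : E d} (hη : ‖η‖ = 1) (w : E d) : ∃ u : E d, ‖u‖ = 1 ∧ w = ‖w‖ • u := by
  by_cases hw : w = 0
  · exact ⟨η, hη, by simp [hw]⟩
  · refine ⟨‖w‖⁻¹ • w, ?_, ?_⟩
    · rw [norm_smul, norm_inv, norm_norm, inv_mul_cancel₀ (norm_ne_zero_iff.2 hw)]
    · rw [smul_smul, mul_inv_cancel₀ (norm_ne_zero_iff.2 hw), one_smul]

/-- Decomposition of a unit vector `u` along a unit vector `g` and an orthogonal direction. -/
theorem exists_orthogonal_decomposition {u g : E d} (hu : ‖u‖ = 1) (hg : ‖g‖ = 1) :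
    ∃ (τ : E d) (β : ℝ), 0 ≤ β ∧ u = inner ℝ u g • g + β • τ ∧ inner ℝ τ g = 0 ∧ ‖τ‖ ≤ 1 ∧
      inner ℝ τ u = β ∧ inner ℝ u g ^ 2 + β ^ 2 = 1 := by
  set w := u - inner ℝ u g • g with hw
  have hwg : inner ℝ w g = 0 := by
    rw [hw, inner_sub_left, real_inner_smul_left, real_inner_self_eq_norm_sq, hg]; ring
  have hww : inner ℝ w u = ‖w‖ ^ 2 := by
    have : inner ℝ w w = inner ℝ w u - inner ℝ u g * inner ℝ w g := by
      conv_lhs => rw [hw, inner_sub_right, real_inner_smul_right]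
    rw [hwg, real_inner_self_eq_norm_sq] at this
    linarith
  have hsq : inner ℝ u g ^ 2 + ‖w‖ ^ 2 = 1 := by
    rw [← hww, hw, inner_sub_left, real_inner_smul_left, real_inner_self_eq_norm_sq, hu,
      real_inner_comm u g]; ring
  by_cases h0 : w = 0
  · refine ⟨0, 0, le_rfl, ?_, by simp, by simp, by simp, ?_⟩
    · rw [smul_zero, add_zero]; exact sub_eq_zero.1 h0
    · simpa [h0] using hsq
  · have hn : ‖w‖ ≠ 0 := norm_ne_zero_iff.2 h0
    refine ⟨‖w‖⁻¹ • w, ‖w‖, norm_nonneg _, ?_, ?_, ?_, ?_, hsq⟩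
    · rw [smul_smul, mul_inv_cancel₀ hn, one_smul, hw]; abel
    · rw [real_inner_smul_left, hwg, mul_zero]
    · rw [norm_smul, norm_inv, norm_norm, inv_mul_cancel₀ hn]
    · rw [real_inner_smul_left, hww]; field_simp

/-- For `w` in a box with normal `g`, the part along `g` costs at most `s` and the tangential part
at most `σ`. Weighted by the coordinates of `u`, this is the worst displacement of a box point
against `u`. -/
theorem inner_ge_of_decomposition {u g τ w : E d} {β s σ : ℝ} (hβ : 0 ≤ β)
    (hu : u = inner ℝ u g • g + β • τ) (hτ : ‖τ‖ ≤ 1) (h1 : |inner ℝ w g| ≤ s) (h2 : ‖w‖ ≤ σ) :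
    -(s * |inner ℝ u g|) - σ * β ≤ inner ℝ w u := by
  have e : inner ℝ w u = inner ℝ u g * inner ℝ w g + β * inner ℝ w τ := by
    conv_lhs => rw [hu]
    rw [inner_add_right, real_inner_smul_right, real_inner_smul_right]
  have h3 : |inner ℝ w τ| ≤ σ := (abs_real_inner_le_norm _ _).trans
    ((mul_le_mul h2 hτ (norm_nonneg _) ((norm_nonneg _).trans h2)).trans (mul_one _).le)
  have h4 : |inner ℝ u g * inner ℝ w g| ≤ s * |inner ℝ u g| := by
    rw [abs_mul, mul_comm s]; exact mul_le_mul_of_nonneg_left h1 (abs_nonneg _)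
  have h5 : |β * inner ℝ w τ| ≤ σ * β := by
    rw [abs_mul, abs_of_nonneg hβ, mul_comm σ]; exact mul_le_mul_of_nonneg_left h3 hβ
  rw [e]
  linarith [neg_abs_le (inner ℝ u g * inner ℝ w g), neg_abs_le (β * inner ℝ w τ)]

theorem one_le_abs_add {α β : ℝ} (hβ : 0 ≤ β) (h : α ^ 2 + β ^ 2 = 1) : 1 ≤ |α| + β := by
  have := sq_abs α
  nlinarith [abs_nonneg α, mul_nonneg (abs_nonneg α) hβ]

/-- The ball of centre `ρ u` and radius `r > ρ` contains a ball of radius `r₂ ≤ r / 2` that touches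
the origin in the direction `u`. -/
theorem norm_sub_smul_lt {v u : E d} {ρ r r₂ : ℝ} (hu : ‖u‖ = 1) (hρ : 0 ≤ ρ) (hr : ρ < r)
    (hr₂ : 2 * r₂ ≤ r) (h0 : 0 < r₂) (hv : ‖v‖ ^ 2 < 2 * r₂ * inner ℝ v u) : ‖v - ρ • u‖ < r := by
  have h1 : ‖v - r₂ • u‖ < r₂ := by
    have : ‖v - r₂ • u‖ ^ 2 < r₂ ^ 2 := by
      rw [norm_sub_sq_real, norm_smul, hu, real_inner_smul_right, Real.norm_of_nonneg h0.le]
      nlinarith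
    exact lt_of_pow_lt_pow_left₀ 2 h0.le this
  have h2 : v - ρ • u = (v - r₂ • u) + (r₂ - ρ) • u := by rw [sub_smul]; abel
  have h3 : ‖(r₂ - ρ) • u‖ = |r₂ - ρ| := by rw [norm_smul, hu, mul_one, Real.norm_eq_abs]
  have h4 := norm_add_le (v - r₂ • u) ((r₂ - ρ) • u)
  rw [← h2, h3] at h4
  rcases abs_cases (r₂ - ρ) with h | h <;> linarith

variable {f : E d → ℝ} {l u ζ m k L δ : ℝ} {Z : Set (E d)}

set_option maxHeartbeats 1000000 in
/-- Points at which `f` exceeds the level `t` clearly belong to the `r`-convex hull of every set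
that meets all boxes inside a level set of slightly higher level. -/
theorem SmoothZone.mem_rConvexHull_of_le [Nontrivial (E d)] (hz : SmoothZone f l u ζ m k L δ Z)
    {r₁ : ℝ} (hr₁ : 0 < r₁) :
    ∃ C > 0, ∃ s₀ > 0, ∀ s, 0 < s → s < s₀ → ∀ t ∈ Set.Icc l u, ∀ A : Set (E d),
      (∀ x η, ‖η‖ = 1 → box x η s ⊆ {z | t + s ≤ f z} → (A ∩ box x η s).Nonempty) →
      ∀ r, r₁ ≤ r → ∀ y, t + C * s ≤ f y → y ∈ rConvexHull r A := by
  have hL : 0 ≤ |L| := abs_nonneg L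
  have hζ := hz.ζ_pos
  have hδ := hz.δ_pos
  have hk := hz.k_pos
  set r₂ := r₁ / 2 with hr₂
  have hr₂0 : 0 < r₂ := by positivity
  -- Makes `2 r₂ (D - 1) s = 18 s`, which beats the bound `(4 σ)² = 16 s` on the squared
  -- displacement of the box points.
  set D := 1 + 9 / r₂ with hD
  have hD1 : 1 < D := by rw [hD]; have : 0 < 9 / r₂ := by positivity
                         linarith
  have hDr : (D - 1) * r₂ = 9 := by rw [hD]; field_simp; ring
  set ε := min (min (1 / D) (δ / 4)) (min (r₂ / 9) (min 1 (ζ / 4))) with hε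
  have hε0 : 0 < ε := by positivity
  -- One `s` is the margin of the box; the other terms bound the loss of `f` on the way, to first
  -- order over a height `(D + 1) s` along the gradient and to second order over a distance `4 √s`.
  refine ⟨1 + |L| * (D + 1) + 16 * k, by positivity, ε ^ 2, by positivity, ?_⟩
  intro s hs hsε t ht A hA r hr y hy
  set σ := √s with hσ
  have hσ0 : 0 < σ := Real.sqrt_pos.2 hs
  have hσs : σ ^ 2 = s := Real.sq_sqrt hs.le
  have hσε : σ < ε := (Real.sqrt_lt' hε0).2 hsε
  have hσD : σ < 1 / D := hσε.trans_le ((min_le_left _ _).trans (min_le_left _ _))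
  have hσδ : σ < δ / 4 := hσε.trans_le ((min_le_left _ _).trans (min_le_right _ _))
  have hσr : σ < r₂ / 9 := hσε.trans_le ((min_le_right _ _).trans (min_le_left _ _))
  have hσ1 : σ < 1 := hσε.trans_le ((min_le_right _ _).trans
    ((min_le_right _ _).trans (min_le_left _ _)))
  have hσζ : σ < ζ / 4 := hσε.trans_le ((min_le_right _ _).trans
    ((min_le_right _ _).trans (min_le_right _ _)))
  have hDσ : D * σ < 1 := by rwa [lt_div_iff₀ (by linarith), mul_comm] at hσD
  have hsσ : s < σ := by
    have := mul_lt_mul_of_pos_left hσ1 hσ0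
    rw [← hσs]; linarith
  have hDs : D * s ≤ σ := by
    have := mul_le_mul_of_nonneg_right hDσ.le hσ0.le
    rw [← hσs]; linarith
  rw [mem_rConvexHull]
  intro c hc
  obtain ⟨η₀, hη₀⟩ := exists_norm_eq (E d) (zero_le_one (α := ℝ))
  obtain ⟨e, he, hce⟩ := exists_unit_smul hη₀ (c - y)
  have hρ : ‖c - y‖ < r := by rwa [norm_sub_rev]
  -- a sample point `y + v` in the ball suffices
  suffices H : ∃ v, y + v ∈ A ∧ ‖v‖ ^ 2 < 2 * r₂ * inner ℝ v e by
    obtain ⟨v, hv, hv'⟩ := H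
    refine ⟨y + v, hv, ?_⟩
    have : y + v - c = v - ‖c - y‖ • e := by rw [← hce]; abel
    rw [this]
    exact norm_sub_smul_lt he (norm_nonneg _) hρ (by linarith) hr₂0 hv'
  by_cases hyZ : y ∈ Z
  · have hm := hz.m_le y hyZ
    have hgn : 0 < ‖gradient f y‖ := hz.m_pos.trans_le hm
    obtain ⟨g, hg, hgg⟩ := exists_unit_smul hη₀ (gradient f y)
    obtain ⟨τ, β, hβ, hdec, hτg, hτ, hτe, hαβ⟩ := exists_orthogonal_decomposition he hg
    set α := inner ℝ e g with hα
    obtain ⟨ε', hε', hε'α⟩ : ∃ ε' : ℝ, |ε'| = 1 ∧ ε' * α = |α| := by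
      rcases le_total 0 α with h | h
      · exact ⟨1, by simp, by rw [abs_of_nonneg h, one_mul]⟩
      · exact ⟨-1, by simp, by rw [abs_of_nonpos h]; ring⟩
    -- Centre of the box relative to `y`: the shift is `2 σ` tangentially but only `D s` along the
    -- gradient, both on the side of `e`. So `f` changes by `O(s)`, and yet the box falls inside the
    -- ball.
    set v₀ := (D * s * ε') • g + (2 * σ) • τ with hv₀
    have hv₀g : inner ℝ v₀ g = D * s * ε' := by
      rw [hv₀, inner_add_left, real_inner_smul_left, real_inner_smul_left, hτg,
        real_inner_self_eq_norm_sq, hg]; ring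
    have hv₀e : inner ℝ v₀ e = D * s * |α| + 2 * σ * β := by
      rw [hv₀, inner_add_left, real_inner_smul_left, real_inner_smul_left, hτe,
        real_inner_comm, ← hα, ← hε'α]; ring
    have hv₀n : ‖v₀‖ ≤ 3 * σ := by
      have h1 := norm_add_le ((D * s * ε') • g) ((2 * σ) • τ)
      rw [norm_smul, norm_smul, hg, Real.norm_eq_abs, Real.norm_eq_abs, abs_mul, hε',
        abs_of_nonneg (by positivity : 0 ≤ D * s), abs_of_nonneg (by positivity : 0 ≤ 2 * σ)] at h1
      have h2 : 2 * σ * ‖τ‖ ≤ 2 * σ := mul_le_of_le_one_right (by positivity) hτ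
      linarith
    have key : ∀ w : E d, |inner ℝ w g| ≤ s → ‖w‖ ≤ σ →
        ‖v₀ + w‖ ≤ 4 * σ ∧ t + s ≤ f (y + (v₀ + w)) ∧
          ‖v₀ + w‖ ^ 2 < 2 * r₂ * inner ℝ (v₀ + w) e := by
      intro w hw1 hw2
      have hn : ‖v₀ + w‖ ≤ 4 * σ := (norm_add_le _ _).trans (by linarith)
      have hn2 : ‖v₀ + w‖ ^ 2 ≤ 16 * s := by
        have := pow_le_pow_left₀ (norm_nonneg _) hn 2
        rw [mul_pow, hσs] at this
        linarith
      refine ⟨hn, ?_, ?_⟩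
      · have hT := hz.taylor y hyZ (y + (v₀ + w)) (by rw [add_sub_cancel_left]; linarith)
        rw [add_sub_cancel_left] at hT
        have hin : -(|L| * (D + 1) * s) ≤ inner ℝ (gradient f y) (v₀ + w) := by
          rw [hgg, real_inner_smul_left, inner_add_right, real_inner_comm, hv₀g,
            real_inner_comm]
          have h1 : |D * s * ε' + inner ℝ w g| ≤ (D + 1) * s := by
            refine (abs_add_le _ _).trans ?_
            rw [abs_mul, hε', abs_of_nonneg (by positivity : 0 ≤ D * s)]; linarith
          have h2 : |‖gradient f y‖ * (D * s * ε' + inner ℝ w g)| ≤ |L| * ((D + 1) * s) := by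
            rw [abs_mul, abs_norm]
            exact mul_le_mul ((hz.le_L y hyZ).trans (le_abs_self L)) h1 (abs_nonneg _) hL
          have := neg_abs_le (‖gradient f y‖ * (D * s * ε' + inner ℝ w g))
          linarith
        have := (abs_le.1 hT).1
        have h4 : k * ‖v₀ + w‖ ^ 2 ≤ k * (16 * s) := mul_le_mul_of_nonneg_left hn2 hk.le
        linarith
      · have hwe := inner_ge_of_decomposition hβ hdec hτ hw1 hw2
        rw [inner_add_left, hv₀e]
        rw [← hα] at hwe
        have h1 : (D - 1) * s ≤ (D - 1) * s * |α| + σ * β := by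
          have ha : 1 ≤ |α| + β := one_le_abs_add hβ hαβ
          have hb : (D - 1) * s ≤ σ := by linarith
          have hc : (D - 1) * s * β ≤ σ * β := mul_le_mul_of_nonneg_right hb hβ
          have hd : 0 ≤ (D - 1) * s := mul_nonneg (by linarith) hs.le
          have he := mul_le_mul_of_nonneg_left ha hd
          linarith
        have h2 : 2 * r₂ * ((D - 1) * s) = 18 * s := by linear_combination (2 * s) * hDr
        have h3 : 2 * r₂ * ((D - 1) * s) ≤ 2 * r₂ * (D * s * |α| + 2 * σ * β + inner ℝ w e) :=
          mul_le_mul_of_nonneg_left (by linarith) (by linarith)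
        linarith
    obtain ⟨z, hzA, hz1, hz2⟩ := hA (y + v₀) g hg (by
      intro z ⟨h1, h2⟩
      have := (key (z - (y + v₀)) h1 h2).2.1
      have e1 : y + (v₀ + (z - (y + v₀))) = z := by abel
      rwa [e1] at this)
    refine ⟨v₀ + (z - (y + v₀)), ?_, (key _ hz1 hz2).2.2⟩
    have e1 : y + (v₀ + (z - (y + v₀))) = z := by abel
    rwa [e1]
  -- Deep inside, the whole `δ`-ball is above the level, so the box can be placed straight towards
  -- the centre of the ball.
  · have hCs : 0 ≤ (1 + |L| * (D + 1) + 16 * k) * s := by positivity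
    have hfy : l - ζ ≤ f y := by linarith [ht.1]
    have key : ∀ w : E d, ‖w‖ ≤ σ → t + s ≤ f (y + ((2 * σ) • e + w)) ∧
        ‖(2 * σ) • e + w‖ ^ 2 < 2 * r₂ * inner ℝ ((2 * σ) • e + w) e := by
      intro w hw
      have hn : ‖(2 * σ) • e + w‖ ≤ 3 * σ := by
        refine (norm_add_le _ _).trans ?_
        rw [norm_smul, he, Real.norm_of_nonneg (by positivity)]; linarith
      have hin : σ ≤ inner ℝ ((2 * σ) • e + w) e := by
        rw [inner_add_left, real_inner_smul_left, real_inner_self_eq_norm_sq, he]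
        have := (abs_real_inner_le_norm w e)
        rw [he, mul_one] at this
        linarith [neg_abs_le (inner ℝ w e)]
      refine ⟨?_, ?_⟩
      · have := hz.deep y hyZ hfy (y + ((2 * σ) • e + w)) (by rw [add_sub_cancel_left]; linarith)
        linarith [ht.2]
      · have h1 : ‖(2 * σ) • e + w‖ ^ 2 ≤ 9 * σ ^ 2 := by
          nlinarith [norm_nonneg ((2 * σ) • e + w)]
        have h2 : 2 * r₂ * σ ≤ 2 * r₂ * inner ℝ ((2 * σ) • e + w) e :=
          mul_le_mul_of_nonneg_left hin (by linarith)
        have h3 := mul_lt_mul_of_pos_left hσr hσ0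
        have h4 := mul_pos hr₂0 hσ0
        linarith
    obtain ⟨z, hzA, hz1, hz2⟩ := hA (y + (2 * σ) • e) e he (by
      intro z ⟨h1, h2⟩
      have := (key (z - (y + (2 * σ) • e)) h2).1
      have e1 : y + ((2 * σ) • e + (z - (y + (2 * σ) • e))) = z := by abel
      rwa [e1] at this)
    refine ⟨(2 * σ) • e + (z - (y + (2 * σ) • e)), ?_, (key _ hz2).2⟩
    have e1 : y + ((2 * σ) • e + (z - (y + (2 * σ) • e))) = z := by abel
    rwa [e1]

end LevelSetEstimation

/-! ### Balls that miss the sample are almost tangent to the boundary. -/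

namespace LevelSetEstimation

variable {d : ℕ}

/-- The hypothesis `h` is the expanded inequality `γ² ≤ ‖v - ρ e‖²` for a point `v` of a box outside
the ball. Apart from `-2 ρ σ β` its right side is `O(γ σ²)`, so `ρ` is close to `γ` and then `β =
O(σ)`. The bound on `D` makes `α ≤ 0` possible only with `|α| ≤ 16 / 75`, which `β ≤ 1 / 2` and `α²
+ β² = 1` exclude. -/
theorem tilt_bounds {r₁ γ ρ α β σ D : ℝ} (hr₁ : 0 < r₁) (hγ : r₁ ≤ γ) (hρ : 0 ≤ ρ) (hργ : ρ < γ)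
    (hβ : 0 ≤ β) (hαβ : α ^ 2 + β ^ 2 = 1) (hσ : 0 < σ) (hD : 50 / r₁ ≤ D - 1)
    (h : γ ^ 2 - ρ ^ 2 ≤ 16 * σ ^ 2 + 2 * ρ * (D * σ ^ 2 * α + σ ^ 2 * |α| - σ * β))
    (h1 : σ ^ 2 ≤ r₁ ^ 2 / 128) (h2 : σ ^ 2 * (16 * (D + 1)) ≤ r₁)
    (h3 : (16 / r₁ + 2 * (D + 1)) * σ ≤ 1 / 2) :
    3 / 4 * γ ≤ ρ ∧ 0 < α ∧ β ≤ (16 / r₁ + 2 * (D + 1)) * σ := by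
  have hα1 : |α| ≤ 1 := by
    rw [abs_le_one_iff_mul_self_le_one]; nlinarith
  have hα1' : α ≤ 1 := (le_abs_self α).trans hα1
  have hγ0 : 0 < γ := hr₁.trans_le hγ
  have hD0 : 0 < D - 1 := lt_of_lt_of_le (by positivity) hD
  have hs0 : 0 < σ ^ 2 := by positivity
  have e1 : D * σ ^ 2 * α + σ ^ 2 * |α| ≤ (D + 1) * σ ^ 2 := by
    have : D * σ ^ 2 * α ≤ D * σ ^ 2 * 1 := mul_le_mul_of_nonneg_left hα1' (by nlinarith)
    have : σ ^ 2 * |α| ≤ σ ^ 2 * 1 := mul_le_mul_of_nonneg_left hα1 hs0.le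
    linarith
  have e2 : γ ^ 2 - ρ ^ 2 + 2 * ρ * (σ * β) ≤ 16 * σ ^ 2 + 2 * γ * ((D + 1) * σ ^ 2) := by
    have : 2 * ρ * (D * σ ^ 2 * α + σ ^ 2 * |α|) ≤ 2 * ρ * ((D + 1) * σ ^ 2) :=
      mul_le_mul_of_nonneg_left e1 (by linarith)
    have h4 : 0 ≤ (D + 1) * σ ^ 2 := mul_nonneg (by linarith) hs0.le
    have : 2 * ρ * ((D + 1) * σ ^ 2) ≤ 2 * γ * ((D + 1) * σ ^ 2) :=
      mul_le_mul_of_nonneg_right (by linarith) h4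
    linarith
  have hγr : r₁ ^ 2 ≤ γ ^ 2 := pow_le_pow_left₀ hr₁.le hγ 2
  have hγr' : r₁ * γ ≤ γ ^ 2 := by nlinarith
  have hA : 3 / 4 * γ ≤ ρ := by
    have a1 : 2 * γ * ((D + 1) * σ ^ 2) ≤ γ ^ 2 / 8 := by
      have := mul_le_mul_of_nonneg_left h2 hγ0.le
      linarith
    have a2 : 0 ≤ 2 * ρ * (σ * β) := by positivity
    have a3 : (3 / 4 * γ) ^ 2 ≤ ρ ^ 2 := by nlinarith
    exact le_of_sq_le_sq a3 hρ
  have hB : β ≤ (16 / r₁ + 2 * (D + 1)) * σ := by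
    by_contra! hcon
    have a0 : γ ^ 2 - ρ ^ 2 ≥ 0 := by nlinarith
    have a1 : γ * (σ * β) ≤ 16 * σ ^ 2 + 2 * γ * ((D + 1) * σ ^ 2) := by
      have : γ * (σ * β) ≤ 2 * ρ * (σ * β) :=
        mul_le_mul_of_nonneg_right (by linarith) (by positivity)
      linarith
    have a2 : γ * β ≤ 16 * σ + 2 * γ * ((D + 1) * σ) := by
      have : σ * (γ * β) ≤ σ * (16 * σ + 2 * γ * ((D + 1) * σ)) := by linarith
      exact le_of_mul_le_mul_left this hσ
    have a3 := mul_lt_mul_of_pos_left hcon hγ0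
    have a4 : 16 ≤ γ * (16 / r₁) := by
      rw [mul_div_assoc', le_div_iff₀ hr₁]; linarith
    have a5 := mul_le_mul_of_nonneg_right a4 hσ.le
    linarith
  refine ⟨hA, ?_, hB⟩
  by_contra! hα
  rw [abs_of_nonpos hα] at h
  have a0 : γ ^ 2 - ρ ^ 2 ≥ 0 := by nlinarith
  have a1 : 0 ≤ ρ * (σ * β) := by positivity
  have a2 : σ ^ 2 * (2 * ρ * ((D - 1) * -α)) ≤ σ ^ 2 * 16 := by linarith
  have a3 := le_of_mul_le_mul_left a2 hs0
  have a4 : 50 ≤ r₁ * (D - 1) := by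
    rw [div_le_iff₀ hr₁] at hD; linarith
  have a5 : 75 * -α ≤ 16 := by
    have b1 : 3 / 4 * r₁ ≤ ρ := by linarith
    have b2 : 3 / 4 * 50 ≤ ρ * (D - 1) := by
      have := mul_le_mul_of_nonneg_right b1 hD0.le
      linarith
    have b3 := mul_le_mul_of_nonneg_right b2 (neg_nonneg.2 hα)
    linarith
  have a6 : β ≤ 1 / 2 := hB.trans h3
  nlinarith

variable {f : E d → ℝ} {l u ζ m k L δ : ℝ} {Z : Set (E d)}

set_option maxHeartbeats 1000000 in
/-- A ball near a boundary point that misses the sample is almost tangent to the boundary. -/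
theorem SmoothZone.tilt (hz : SmoothZone f l u ζ m k L δ Z) {r₁ : ℝ} (hr₁ : 0 < r₁) :
    ∃ K > 0, ∃ σ₀ > 0, ∀ σ, 0 < σ → σ < σ₀ → ∀ s, 0 < s → s ≤ σ ^ 2 → ∀ t, ∀ A : Set (E d),
      (∀ x η, ‖η‖ = 1 → box x η s ⊆ {z | t + s ≤ f z} → (A ∩ box x η s).Nonempty) →
      ∀ a ∈ Z, f a = t → ∀ η, ‖η‖ = 1 → gradient f a = -(‖gradient f a‖ • η) →
      ∀ w, |inner ℝ w η| ≤ s → ‖w‖ ≤ √s → ∀ γ, r₁ ≤ γ → ∀ ρ, 0 ≤ ρ → ρ < γ → ∀ e, ‖e‖ = 1 →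
      (∀ z ∈ A, γ ≤ ‖z - (a + σ ^ 2 • η + w + ρ • e)‖) →
      3 / 4 * γ ≤ ρ ∧ 3 / 4 ≤ inner ℝ e η ∧ ‖e - η‖ ≤ K * σ := by
  have hδ := hz.δ_pos
  have hk := hz.k_pos
  have hm := hz.m_pos
  -- The term with `m` lets the first-order gain beat `k (6 σ)² + s`; the term with `r₁` is what
  -- `tilt_bounds` asks for.
  set D := 4 + (36 * k + 1) / m + 50 / r₁ with hD
  have hD1 : 4 < D := by
    have : 0 < (36 * k + 1) / m := by positivity
    have : 0 < 50 / r₁ := by positivity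
    linarith
  have hDm : 36 * k + 1 ≤ m * (D - 3) := by
    have h1 : (36 * k + 1) / m ≤ D - 3 := by
      have : 0 < 50 / r₁ := by positivity
      linarith
    rw [div_le_iff₀ hm] at h1; linarith
  have hDr : 50 / r₁ ≤ D - 1 := by
    have : 0 < (36 * k + 1) / m := by positivity
    linarith
  set K₁ := 16 / r₁ + 2 * (D + 1) with hK₁
  have hK₁0 : 0 < K₁ := by positivity
  clear_value D
  refine ⟨2 * K₁, by positivity, min (min (1 / D) (min 1 (δ / 6)))
    (min (1 / (8 * K₁)) (min (r₁ ^ 2 / 128) (r₁ / (16 * (D + 1))))), by positivity, ?_⟩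
  intro σ hσ hσ₀ s hs hsσ t A hA a haZ hat η hη hgrad w hw1 hw2 γ hγ ρ hρ hργ e he hmiss
  simp only [lt_min_iff] at hσ₀
  obtain ⟨⟨hσD, hσ1, hσδ⟩, hσK, hσr, hσr'⟩ := hσ₀
  have hsqσ : σ ^ 2 ≤ σ := by
    have := mul_le_mul_of_nonneg_left hσ1.le hσ.le
    linarith
  have hDσ : D * σ < 1 := by rwa [lt_div_iff₀ (by linarith), mul_comm] at hσD
  have hDs : D * σ ^ 2 ≤ σ := by
    have := mul_le_mul_of_nonneg_right hDσ.le hσ.le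
    linarith
  have hKσ : K₁ * σ ≤ 1 / 8 := by
    rw [lt_div_iff₀ (by positivity)] at hσK; linarith
  have hrσ : σ ^ 2 * (16 * (D + 1)) ≤ r₁ := by
    rw [lt_div_iff₀ (by positivity)] at hσr'
    exact (mul_le_mul_of_nonneg_right hsqσ (by linarith)).trans hσr'.le
  have hsσ' : √s ≤ σ := by rw [Real.sqrt_le_left hσ.le]; exact hsσ
  obtain ⟨τ, β, hβ, hdec, hτg, hτ, hτe, hαβ⟩ := exists_orthogonal_decomposition he hη
  set α := inner ℝ e η with hα
  -- The box is pushed inwards by `D σ²`, far enough for density at least `t + s`, and sideways by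
  -- `2 σ` towards the tangential part of `e`. A clearly tilted ball would contain it together with
  -- its sample point.
  set v₀ := (-(D * σ ^ 2)) • η + (2 * σ) • τ with hv₀
  have hv₀g : inner ℝ v₀ η = -(D * σ ^ 2) := by
    rw [hv₀, inner_add_left, real_inner_smul_left, real_inner_smul_left, hτg,
      real_inner_self_eq_norm_sq, hη]; ring
  have hv₀e : inner ℝ v₀ e = -(D * σ ^ 2 * α) + 2 * σ * β := by
    rw [hv₀, inner_add_left, real_inner_smul_left, real_inner_smul_left, hτe,
      real_inner_comm, ← hα]; ring
  have hv₀n : ‖v₀‖ ≤ 3 * σ := by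
    have h1 := norm_add_le ((-(D * σ ^ 2)) • η) ((2 * σ) • τ)
    rw [norm_smul, norm_smul, hη, norm_neg, Real.norm_of_nonneg (by positivity : 0 ≤ D * σ ^ 2),
      Real.norm_of_nonneg (by positivity : 0 ≤ 2 * σ)] at h1
    have h2 : 2 * σ * ‖τ‖ ≤ 2 * σ := mul_le_of_le_one_right (by positivity) hτ
    linarith
  have hstep : ∀ w' : E d, |inner ℝ w' η| ≤ s → ‖w'‖ ≤ σ →
      t + s ≤ f (a + (σ ^ 2 • η + w + (v₀ + w'))) := by
    intro w' hw1' hw2'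
    set V := σ ^ 2 • η + w + (v₀ + w') with hV
    have hn : ‖V‖ ≤ 6 * σ := by
      have h1 := norm_add_le (σ ^ 2 • η + w) (v₀ + w')
      have h2 := norm_add_le (σ ^ 2 • η) w
      have h3 := norm_add_le v₀ w'
      rw [norm_smul, hη, Real.norm_of_nonneg (by positivity), mul_one] at h2
      linarith
    have hin : inner ℝ V η ≤ (3 - D) * σ ^ 2 := by
      rw [hV, inner_add_left, inner_add_left, inner_add_left, hv₀g, real_inner_smul_left,
        real_inner_self_eq_norm_sq, hη]
      have := (abs_le.1 hw1).2
      have := (abs_le.1 hw1').2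
      linarith
    have hT := (abs_le.1 (hz.taylor a haZ (a + V) (by rw [add_sub_cancel_left]; linarith))).1
    rw [add_sub_cancel_left, hat, hgrad, inner_neg_left, real_inner_smul_left,
      real_inner_comm] at hT
    have h1 : m * ((D - 3) * σ ^ 2) ≤ ‖gradient f a‖ * -inner ℝ V η :=
      mul_le_mul (hz.m_le a haZ) (by linarith) (mul_nonneg (by linarith) (by positivity))
        (norm_nonneg _)
    have h2 : k * ‖V‖ ^ 2 ≤ k * (6 * σ) ^ 2 :=
      mul_le_mul_of_nonneg_left (pow_le_pow_left₀ (norm_nonneg _) hn 2) hk.le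
    have h3 := mul_le_mul_of_nonneg_right hDm (by positivity : 0 ≤ σ ^ 2)
    linarith
  obtain ⟨z, hzA, hz1, hz2⟩ := hA (a + σ ^ 2 • η + w + v₀) η hη (by
    intro z ⟨h1, h2⟩
    have := hstep (z - (a + σ ^ 2 • η + w + v₀)) h1 (h2.trans hsσ')
    have e1 : a + (σ ^ 2 • η + w + (v₀ + (z - (a + σ ^ 2 • η + w + v₀)))) = z := by abel
    rwa [e1] at this)
  set w' := z - (a + σ ^ 2 • η + w + v₀) with hw'
  have hmz := hmiss z hzA
  have e2 : z - (a + σ ^ 2 • η + w + ρ • e) = (v₀ + w') - ρ • e := by rw [hw']; abel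
  have hn : ‖v₀ + w'‖ ≤ 4 * σ := (norm_add_le _ _).trans (by linarith)
  have hn2 := pow_le_pow_left₀ (norm_nonneg _) hn 2
  have hsq := pow_le_pow_left₀ (by linarith) hmz 2
  rw [e2, norm_sub_sq_real, norm_smul, he, Real.norm_of_nonneg hρ, real_inner_smul_right,
    inner_add_left, hv₀e] at hsq
  have hwe := inner_ge_of_decomposition hβ hdec hτ (hz1.trans hsσ) (hz2.trans hsσ')
  rw [← hα] at hwe
  have hwe' := mul_le_mul_of_nonneg_left hwe (by linarith : 0 ≤ 2 * ρ)
  obtain ⟨h1, h2, h3⟩ := tilt_bounds hr₁ hγ hρ hργ hβ hαβ hσ hDr (by linarith)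
    (hsqσ.trans hσr.le) hrσ (by linarith)
  have hβ8 : β ≤ 1 / 8 := h3.trans hKσ
  have hα1 : α ≤ 1 := by
    have := abs_real_inner_le_norm e η
    rw [he, hη, mul_one] at this
    exact (le_abs_self _).trans this
  have hα' : 1 - α ≤ β ^ 2 := by nlinarith only [hαβ, h2, hα1]
  have hβ2 : β ^ 2 ≤ (1 / 8) ^ 2 := pow_le_pow_left₀ hβ hβ8 2
  refine ⟨h1, by linarith, ?_⟩
  have h4 : ‖e - η‖ ^ 2 ≤ (2 * β) ^ 2 := by
    rw [norm_sub_sq_real, he, hη, ← hα]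
    nlinarith only [hα']
  have := le_of_sq_le_sq h4 (by positivity)
  linarith

end LevelSetEstimation

/-! ### Lenses, the outer normal at the nearest point, and `γ`-convexity of level sets. -/

namespace LevelSetEstimation

variable {d : ℕ}

/-- Here `q = ⟨Y, e⟩` and `y = ‖Y‖²` for a point `Y` outside the ball of radius `γ` that touches the
origin, but inside a ball of radius `r = ν γ` with the same axis that protrudes by `c` behind the
origin. The smaller ball is more curved, so such points stay within `O(√c)` of the origin, with a
constant that explodes as `ν → 1`. -/
theorem lens_bounds {r γ ν y q c R : ℝ} (hγ : 0 < γ) (hν0 : 0 < ν) (hν1 : ν < 1) (hr : r = ν * γ)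
    (hrR : r ≤ R) (hc : 0 < c) (hcr : c ≤ r / 2) (hy : 0 ≤ y) (h1 : 2 * γ * q ≤ y)
    (h2 : y < 2 * (r - c) * q + 2 * r * c) : y ≤ 2 * R / (1 - ν) * c ∧ -(2 * c) ≤ q := by
  have hr0 : 0 < r := by rw [hr]; positivity
  have h1ν : 0 < 1 - ν := by linarith
  constructor
  · suffices y ≤ 2 * r / (1 - ν) * c by
      refine this.trans ?_
      gcongr
    rw [div_mul_eq_mul_div, le_div_iff₀ h1ν]
    rcases le_total 0 q with hq | hq
    · have a1 : 0 ≤ c * q := mul_nonneg hc.le hq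
      have a2 : γ * (1 - ν) * q ≤ r * c := by rw [hr] at h2 ⊢; linarith
      have a3 := mul_le_mul_of_nonneg_left a2 hν0.le
      have a4 : (1 - ν) * y ≤ (1 - ν) * (2 * r * q + 2 * r * c) :=
        mul_le_mul_of_nonneg_left (by linarith) h1ν.le
      have a5 : r * (1 - ν) * q = ν * (γ * (1 - ν) * q) := by rw [hr]; ring
      linarith
    · have a1 : 2 * (r - c) * q ≤ 0 := mul_nonpos_of_nonneg_of_nonpos (by linarith) hq
      have a2 : 0 ≤ ν * y := mul_nonneg hν0.le hy
      linarith
  · by_contra! hq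
    have a1 : 2 * (r - c) * q ≤ 2 * (r - c) * -(2 * c) :=
      mul_le_mul_of_nonneg_left hq.le (by linarith)
    have a2 : c * c ≤ c * (r / 2) := mul_le_mul_of_nonneg_left hcr hc.le
    linarith

variable {f : E d → ℝ} {l u ζ m k L δ : ℝ} {Z : Set (E d)}

theorem SmoothZone.lt_level (hz : SmoothZone f l u ζ m k L δ Z) {a η V : E d} (ha : a ∈ Z)
    (hgrad : gradient f a = -(‖gradient f a‖ • η)) (hV : ‖V‖ ≤ δ) (hV0 : 0 ≤ inner ℝ V η) :
    f (a + V) ≤ f a - m * inner ℝ V η + k * ‖V‖ ^ 2 := by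
  have hT := (abs_le.1 (hz.taylor a ha (a + V) (by rwa [add_sub_cancel_left]))).2
  rw [add_sub_cancel_left, hgrad, inner_neg_left, real_inner_smul_left, real_inner_comm] at hT
  have := mul_le_mul_of_nonneg_right (hz.m_le a ha) hV0
  linarith

theorem SmoothZone.abs_sub_le (hz : SmoothZone f l u ζ m k L δ Z) {a z : E d} (ha : a ∈ Z)
    (h : ‖z - a‖ ≤ δ) : |f z - f a| ≤ (|L| + k * δ) * ‖z - a‖ := by
  have hT := abs_le.1 (hz.taylor a ha z h)
  have h1 : |inner ℝ (gradient f a) (z - a)| ≤ |L| * ‖z - a‖ :=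
    (abs_real_inner_le_norm _ _).trans (mul_le_mul_of_nonneg_right
      ((hz.le_L a ha).trans (le_abs_self L)) (norm_nonneg _))
  have h2 : k * ‖z - a‖ ^ 2 ≤ k * δ * ‖z - a‖ := by
    rw [sq, mul_assoc]
    exact mul_le_mul_of_nonneg_left (mul_le_mul_of_nonneg_right h (norm_nonneg _)) hz.k_pos.le
  have h3 := abs_le.1 h1
  rw [abs_le]
  constructor <;> linarith [hT.1, hT.2, h3.1, h3.2]

/-- A point outside a level set lies on the outer normal at its nearest point. -/
theorem SmoothZone.exists_nearest (hz : SmoothZone f l u ζ m k L δ Z) {t : ℝ}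
    (ht : t ∈ Set.Icc l u) (hcomp : IsCompact (levelSet f t)) (hne : (levelSet f t).Nonempty)
    {x : E d} (hx : x ∉ levelSet f t) :
    ∃ a ∈ Z, ∃ η : E d, f a = t ∧ ‖η‖ = 1 ∧ gradient f a = -(‖gradient f a‖ • η) ∧
      ∃ p : ℝ, 0 < p ∧ x = a + p • η ∧ ∀ z ∈ levelSet f t, p ≤ ‖z - x‖ := by
  have hδ := hz.δ_pos
  have hk := hz.k_pos
  obtain ⟨a, ha, hmin⟩ := hcomp.exists_infDist_eq_dist hne x
  have hnear : ∀ z ∈ levelSet f t, ‖x - a‖ ≤ ‖z - x‖ := fun z hzG => by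
    rw [← dist_eq_norm, ← hmin, ← dist_eq_norm, dist_comm]
    exact Metric.infDist_le_dist_of_mem hzG
  have hxa : x ≠ a := fun h => hx (h ▸ ha)
  have hp : 0 < ‖x - a‖ := norm_pos_iff.2 (sub_ne_zero.2 hxa)
  have hfa : t ≤ f a := ha
  have hlow : l - ζ ≤ f a := by linarith [ht.1, hz.ζ_pos]
  set e := ‖x - a‖⁻¹ • (x - a) with he
  have hen : ‖e‖ = 1 := by
    rw [he, norm_smul, norm_inv, norm_norm, inv_mul_cancel₀ hp.ne']
  have hxe : x - a = ‖x - a‖ • e := by rw [he, smul_smul, mul_inv_cancel₀ hp.ne', one_smul]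
  clear_value e
  -- By minimality the open segment from `a` to `x` avoids the level set. This rules out `a ∉ Z` as
  -- well as `f a > t`, since either would leave room to move towards `x`.
  have hmove : ∀ ε : ℝ, 0 < ε → ε < ‖x - a‖ → ¬ t ≤ f (a + ε • e) := by
    intro ε hε hε1 hcon
    have h1 := hnear _ hcon
    have h2 : a + ε • e - x = (ε - ‖x - a‖) • e := by
      rw [sub_smul, ← hxe]; abel
    rw [h2, norm_smul, hen, mul_one, Real.norm_eq_abs, abs_of_neg (by linarith)] at h1
    linarith
  have haZ : a ∈ Z := by
    by_contra haZ
    refine hmove (min δ (‖x - a‖ / 2)) (by positivity)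
      ((min_le_right _ _).trans_lt (by linarith)) ?_
    have := hz.deep a haZ hlow (a + (min δ (‖x - a‖ / 2)) • e) (by
      rw [add_sub_cancel_left, norm_smul, hen, mul_one, Real.norm_of_nonneg (by positivity)]
      exact min_le_left _ _)
    linarith [ht.2, hz.ζ_pos]
  have hfat : f a = t := by
    by_contra hne'
    have hlt : t < f a := lt_of_le_of_ne hfa (Ne.symm hne')
    have hM : 0 < |L| + k * δ := by positivity
    set ε := min (min δ (‖x - a‖ / 2)) ((f a - t) / (|L| + k * δ)) with hε
    have hε0 : 0 < ε := by
      have : 0 < f a - t := by linarith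
      positivity
    refine hmove ε hε0 ((min_le_left _ _).trans_lt ((min_le_right _ _).trans_lt (by linarith))) ?_
    have hnε : ‖a + ε • e - a‖ = ε := by
      rw [add_sub_cancel_left, norm_smul, hen, mul_one, Real.norm_of_nonneg hε0.le]
    have h1 := (abs_le.1 (hz.abs_sub_le haZ (z := a + ε • e) (by
      rw [hnε]; exact (min_le_left _ _).trans (min_le_left _ _)))).1
    rw [hnε] at h1
    have h2 : ε ≤ (f a - t) / (|L| + k * δ) := min_le_right _ _
    rw [le_div_iff₀ hM] at h2
    linarith
  refine ⟨a, haZ, e, hfat, hen, ?_, ‖x - a‖, hp, by rw [← hxe]; abel, hnear⟩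
  obtain ⟨g, hg, hgg⟩ := exists_unit_smul hen (gradient f a)
  have hn : 0 < ‖gradient f a‖ := hz.m_pos.trans_le (hz.m_le a haZ)
  have hc : 0 ≤ 1 + inner ℝ e g := by
    have := abs_real_inner_le_norm e g
    rw [hen, hg, mul_one] at this
    linarith [(abs_le.1 this).1]
  have heg : ‖e + g‖ ^ 2 = 2 * (1 + inner ℝ e g) := by
    rw [norm_add_sq_real, hen, hg]; ring
  suffices h0 : 1 + inner ℝ e g = 0 by
    rw [h0, mul_zero, sq_eq_zero_iff, norm_eq_zero] at heg
    rw [← smul_neg, show -e = g from (eq_neg_of_add_eq_zero_right heg).symm]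
    exact hgg
  -- If the unit gradient `g` were not `-e`, a small step along `e + g` would both increase `f` and
  -- approach `x`, because `⟨g, e + g⟩ = ⟨e, e + g⟩ = 1 + ⟨e, g⟩ > 0`.
  by_contra hne'
  have hc0 : 0 < 1 + inner ℝ e g := lt_of_le_of_ne hc (Ne.symm hne')
  have hv2 : ‖e + g‖ ≤ 2 := (norm_add_le _ _).trans (by rw [hen, hg]; norm_num)
  set s := min (δ / 2) (min (‖gradient f a‖ / (2 * k)) (‖x - a‖ / 2)) with hs
  have hs0 : 0 < s := by positivity
  have hs1 : s ≤ δ / 2 := min_le_left _ _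
  have hs2 : s * (2 * k) ≤ ‖gradient f a‖ := by
    rw [← le_div_iff₀ (by positivity)]; exact (min_le_right _ _).trans (min_le_left _ _)
  have hs3 : s ≤ ‖x - a‖ / 2 := (min_le_right _ _).trans (min_le_right _ _)
  have hns : ‖s • (e + g)‖ = s * ‖e + g‖ := by rw [norm_smul, Real.norm_of_nonneg hs0.le]
  have hmem : a + s • (e + g) ∈ levelSet f t := by
    have hle : s * ‖e + g‖ ≤ δ := by
      have := mul_le_mul_of_nonneg_left hv2 hs0.le
      linarith
    have hT := (abs_le.1 (hz.taylor a haZ (a + s • (e + g)) (by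
      rwa [add_sub_cancel_left, hns]))).1
    rw [add_sub_cancel_left, hfat, hns, mul_pow, heg] at hT
    have hin : inner ℝ (gradient f a) (s • (e + g)) =
        ‖gradient f a‖ * (s * (1 + inner ℝ e g)) := by
      conv_lhs => rw [hgg]
      rw [real_inner_smul_left, real_inner_smul_right, inner_add_right,
        real_inner_self_eq_norm_sq, hg, real_inner_comm]; ring
    rw [hin] at hT
    have := mul_le_mul_of_nonneg_right hs2 (mul_nonneg hs0.le hc0.le)
    change t ≤ _
    linarith
  have h1 := hnear _ hmem
  have h2 : a + s • (e + g) - x = s • (e + g) - ‖x - a‖ • e := by rw [← hxe]; abel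
  have h3 := pow_le_pow_left₀ (norm_nonneg _) h1 2
  rw [h2, norm_sub_sq_real (s • (e + g)), hns, mul_pow, heg, norm_smul, hen, norm_norm, mul_one,
    real_inner_smul_left, real_inner_smul_right, inner_add_left, real_inner_self_eq_norm_sq, hen,
    real_inner_comm e g] at h3
  have h4 : s * ((1 + inner ℝ e g) * ‖x - a‖) ≤ s * ((1 + inner ℝ e g) * s) := by
    linarith
  have h5 := le_of_mul_le_mul_left (le_of_mul_le_mul_left h4 hs0) hc0
  linarith

/-- The level sets are `γ`-convex for small `γ`. -/
theorem SmoothZone.rConvexHull_levelSet_subset (hz : SmoothZone f l u ζ m k L δ Z) {t : ℝ}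
    (ht : t ∈ Set.Icc l u) (hcomp : IsCompact (levelSet f t)) (hne : (levelSet f t).Nonempty)
    {γ : ℝ} (hγ : 0 < γ) (hγδ : 2 * γ ≤ δ) (hγm : 2 * k * γ ≤ m) :
    rConvexHull γ (levelSet f t) ⊆ levelSet f t := by
  intro x hx
  by_contra hxG
  obtain ⟨a, haZ, η, hfa, hη, hgrad, p, hp, rfl, hnear⟩ := hz.exists_nearest ht hcomp hne hxG
  rw [mem_rConvexHull] at hx
  rcases le_or_gt γ p with h | h
  · obtain ⟨z, hzG, hz'⟩ := hx (a + p • η) (by simpa using hγ)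
    linarith [hnear z hzG]
  -- The ball of radius `γ` that touches the level set at `a` from outside contains `x`, but by the
  -- Taylor bound no point of the level set.
  · obtain ⟨z, hzG, hz'⟩ := hx (a + γ • η) (by
      rw [add_sub_add_left_eq_sub, ← sub_smul, norm_smul, hη, mul_one, Real.norm_eq_abs, abs_lt]
      constructor <;> linarith)
    have e : z - (a + γ • η) = (z - a) - γ • η := by abel
    have hV : ‖z - a‖ ^ 2 < 2 * γ * inner ℝ (z - a) η := by
      have := pow_lt_pow_left₀ hz' (norm_nonneg _) two_ne_zero
      rw [e, norm_sub_sq_real, norm_smul, hη, Real.norm_of_nonneg hγ.le,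
        real_inner_smul_right] at this
      linarith
    have hin : 0 < inner ℝ (z - a) η := by
      have : 0 < 2 * γ * inner ℝ (z - a) η := (sq_nonneg _).trans_lt hV
      exact (mul_pos_iff_of_pos_left (by linarith)).1 this
    have hVδ : ‖z - a‖ ≤ δ := by
      have h1 : ‖z - a‖ ≤ ‖z - (a + γ • η)‖ + ‖γ • η‖ := by
        rw [e]; simpa using norm_add_le ((z - a) - γ • η) (γ • η)
      rw [norm_smul, hη, Real.norm_of_nonneg hγ.le] at h1
      linarith
    have h1 := hz.lt_level haZ hgrad hVδ hin.le
    rw [add_sub_cancel, hfa] at h1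
    have h2 : t ≤ f z := hzG
    have h3 := mul_lt_mul_of_pos_left hV hz.k_pos
    have h4 := mul_le_mul_of_nonneg_right hγm hin.le
    linarith

end LevelSetEstimation

/-! ### From one hull point to a whole box in a hull of larger radius. -/

namespace LevelSetEstimation

variable {d : ℕ} {f : E d → ℝ} {l u ζ m k L δ : ℝ} {Z : Set (E d)}

/-- In `exists_box_subset`, `c σ²` is how far the auxiliary ball protrudes, `q σ` the size of the
resulting lens and `e σ` the width of the boxes. They are fixed in the order `q`, `c`, `e`, each
small in terms of the previous ones. -/
theorem exists_lens_constants {K R r₁ ν ω : ℝ} (hK : 0 < K) (hR : 0 < R) (hr₁ : 0 < r₁)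
    (hν1 : ν < 1) (hω : 0 < ω) (hω1 : ω ≤ 1) :
    ∃ q c e : ℝ, 0 < q ∧ 0 < c ∧ 0 < e ∧ q ≤ ω / 4 ∧ q * K ≤ 1 / 8 ∧ 2 * R / (1 - ν) * c ≤ q ^ 2 ∧
      2 * c ≤ 1 / 8 ∧ e ≤ ω / 4 ∧ e ≤ 1 / 4 ∧ (1 / r₁ + 2 + 2 * K) * e < c := by
  have h1ν : 0 < 1 - ν := by linarith
  set q := min (ω / 4) (1 / (8 * K)) with hq
  have hq0 : 0 < q := by positivity
  have hqω : q ≤ ω / 4 := min_le_left _ _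
  have hqK : q * K ≤ 1 / 8 := by
    have : q ≤ 1 / (8 * K) := min_le_right _ _
    rw [le_div_iff₀ (by positivity)] at this; linarith
  have hΛ : 0 < 2 * R / (1 - ν) := by positivity
  set c := min (1 / 16) (q ^ 2 / (2 * R / (1 - ν))) with hc
  have hc0 : 0 < c := by positivity
  have hcq : 2 * R / (1 - ν) * c ≤ q ^ 2 := by
    have : c ≤ q ^ 2 / (2 * R / (1 - ν)) := min_le_right _ _
    rw [le_div_iff₀ hΛ] at this; linarith
  have hM : 0 < 1 / r₁ + 2 + 2 * K := by positivity
  set e := min (ω / 4) (c / (2 * (1 / r₁ + 2 + 2 * K))) with he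
  have he0 : 0 < e := by positivity
  refine ⟨q, c, e, hq0, hc0, he0, hqω, hqK, hcq, ?_, min_le_left _ _, ?_, ?_⟩
  · have : c ≤ 1 / 16 := min_le_left _ _
    linarith
  · have : e ≤ ω / 4 := min_le_left _ _
    linarith
  · have : e ≤ c / (2 * (1 / r₁ + 2 + 2 * K)) := min_le_right _ _
    rw [le_div_iff₀ (by positivity)] at this; linarith

set_option maxHeartbeats 1000000 in
/-- If a point on the outer normal at `a` belongs to the `r`-convex hull of the sample, then a
whole box near `a` belongs to the hull for the larger radius `r / ν`. -/
theorem SmoothZone.exists_box_subset (hz : SmoothZone f l u ζ m k L δ Z) {r₁ R ν : ℝ}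
    (hr₁ : 0 < r₁) (hR : 0 < R) (hν0 : 0 < ν) (hν1 : ν < 1) :
    ∃ e > 0, e ≤ 1 / 4 ∧ e ≤ m / 4 ∧ k * e ≤ m / 4 ∧ ∃ σ₀ > 0, ∀ σ, 0 < σ → σ < σ₀ → ∀ t, ∀ A : Set (E d),
      A ⊆ levelSet f t →
      (∀ x η, ‖η‖ = 1 → box x η (e ^ 2 * σ ^ 2) ⊆ {z | t + e ^ 2 * σ ^ 2 ≤ f z} →
        (A ∩ box x η (e ^ 2 * σ ^ 2)).Nonempty) →
      ∀ a ∈ Z, f a = t → ∀ η, ‖η‖ = 1 → gradient f a = -(‖gradient f a‖ • η) →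
      ∀ r, r₁ ≤ r → r ≤ R → ∀ p, σ ^ 2 < p → p < r → a + p • η ∈ rConvexHull r A →
      box (a + σ ^ 2 • η) η (e ^ 2 * σ ^ 2) ⊆ rConvexHull (r / ν) A := by
  have hδ := hz.δ_pos
  have hk := hz.k_pos
  have hm := hz.m_pos
  obtain ⟨K, hK, σ₁, hσ₁, htilt⟩ := hz.tilt hr₁
  -- Within `ω σ` of `a`, a height of at least `σ² / 2` along the outer normal forces density below
  -- `t`: the second-order term `k ω² σ²` is at most `m σ² / 4`.
  set ω := min (min 1 m) (m / (4 * k)) with hω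
  have hω0 : 0 < ω := by positivity
  have hω1 : ω ≤ 1 := (min_le_left _ _).trans (min_le_left _ _)
  have hωm : ω ≤ m := (min_le_left _ _).trans (min_le_right _ _)
  have hωk : k * ω ^ 2 ≤ m / 4 := by
    have h1 : ω ≤ m / (4 * k) := min_le_right _ _
    rw [le_div_iff₀ (by positivity)] at h1
    have h2 : ω ^ 2 ≤ ω := by
      have := mul_le_mul_of_nonneg_left hω1 hω0.le
      linarith
    have := mul_le_mul_of_nonneg_left h2 hk.le
    linarith
  have hωk' : k * (ω / 4) ≤ m / 4 := by
    have h1 : ω ≤ m / (4 * k) := min_le_right _ _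
    rw [le_div_iff₀ (by positivity)] at h1
    linarith
  obtain ⟨q, c, e, hq, hc, he, hqω, hqK, hcq, hc8, heω, he4, hec⟩ :=
    exists_lens_constants hK hR hr₁ hν1 hω0 hω1
  set ε := (1 / r₁ + 2 + 2 * K) * e with hε
  have hε0 : 0 < ε := by positivity
  have hε8 : ε ≤ 1 / 8 := by linarith
  refine ⟨e, he, he4, by linarith, ?_, min σ₁ (min (ω / 4) (min δ (min (r₁ / 4) 1))), by positivity, ?_⟩
  · exact (mul_le_mul_of_nonneg_left heω hk.le).trans hωk'
  intro σ hσ hσ₀ t A hAG hA a haZ hat η hη hgrad r hr hrR p hp hpr hmem x' hx'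
  simp only [lt_min_iff] at hσ₀
  obtain ⟨hσσ₁, hσω, hσδ, hσr, hσ1⟩ := hσ₀
  have hh0 : 0 < σ ^ 2 := by positivity
  have hhσ : σ ^ 2 ≤ σ := by
    have := mul_le_mul_of_nonneg_left hσ1.le hσ.le
    linarith
  set h := σ ^ 2 with hh
  set s := e ^ 2 * h with hs
  have hs0 : 0 < s := by positivity
  have he2 : e ^ 2 ≤ e * (1 / 4) := by
    have := mul_le_mul_of_nonneg_left he4 he.le
    linarith
  have hse : s ≤ e * h * (1 / 4) := by
    have := mul_le_mul_of_nonneg_right he2 hh0.le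
    rw [hs]; linarith
  have heh : e * h ≤ h * (1 / 4) := by
    have := mul_le_mul_of_nonneg_right he4 hh0.le
    linarith
  have hsh : s ≤ h / 16 := by linarith
  have hsqs : √s = e * σ := by
    rw [hs, hh, ← mul_pow, Real.sqrt_sq (by positivity)]
  obtain ⟨hw1, hw2⟩ := hx'
  set w := x' - (a + h • η) with hw
  have hx'e : x' = a + h • η + w := by rw [hw]; abel
  have hw2s : ‖w‖ ^ 2 ≤ s := by
    have := pow_le_pow_left₀ (norm_nonneg _) hw2 2
    rwa [Real.sq_sqrt hs0.le] at this
  rw [hsqs] at hw2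
  set γ := r / ν with hγ
  have hr0 : 0 < r := hr₁.trans_le hr
  have hγ0 : 0 < γ := by positivity
  have hrγ : r = ν * γ := by rw [hγ]; field_simp
  have hrγ' : r ≤ γ := by
    rw [hrγ]; exact mul_le_of_le_one_left hγ0.le hν1.le
  rw [mem_rConvexHull]
  intro c' hc'
  -- Now a ball of radius `γ = r / ν` contains `x'` and misses `A`; by `tilt` its axis `e'` is
  -- almost `η`.
  by_contra! hmiss
  obtain ⟨e', he', hce'⟩ := exists_unit_smul hη (c' - x')
  set ρ := ‖c' - x'‖ with hρ
  have hργ : ρ < γ := by rw [hρ, norm_sub_rev]; exact hc'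
  have hρ0 : 0 ≤ ρ := norm_nonneg _
  have hc'e : c' = a + h • η + w + ρ • e' := by rw [← hce', ← hx'e]; abel
  obtain ⟨hρ34, hα34, hKe⟩ := htilt σ hσ hσσ₁ s hs0 (by linarith) t A hA a haZ hat η hη hgrad w
    hw1 (by rw [hsqs]; exact hw2) γ (hr.trans hrγ') ρ hρ0 hργ e' he' (by rw [← hc'e]; exact hmiss)
  clear_value ρ
  -- estimate of the tangential displacement
  have hwe : inner ℝ w e' ≤ (1 + K) * (e * h) := by
    have h1 : inner ℝ w e' = inner ℝ w η + inner ℝ w (e' - η) := by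
      rw [← inner_add_right]; congr 1; abel
    have h2 : inner ℝ w (e' - η) ≤ (e * σ) * (K * σ) :=
      (real_inner_le_norm _ _).trans (mul_le_mul hw2 hKe (norm_nonneg _) (by positivity))
    have h3 : (e * σ) * (K * σ) = K * (e * h) := by rw [hh]; ring
    have := (abs_le.1 hw1).2
    have : 0 < e * h := by positivity
    rw [h1]; linarith
  have heη : inner ℝ η e' = inner ℝ e' η := real_inner_comm _ _
  have hwη := abs_le.1 hw1
  have hηw : inner ℝ η w = inner ℝ w η := real_inner_comm _ _
  -- distance from the point on the normal to a point on the axis of the ball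
  have hdist : ∀ κ, ‖a + p • η - (a + h • η + w + κ • e')‖ ^ 2 =
      κ ^ 2 + ‖w‖ ^ 2 + 2 * κ * inner ℝ w e' +
        (p - h) * ((p - h) - 2 * inner ℝ w η - 2 * κ * inner ℝ e' η) := by
    intro κ
    have e1 : a + p • η - (a + h • η + w + κ • e') = (p - h) • η - (w + κ • e') := by
      rw [sub_smul]; abel
    rw [e1, norm_sub_sq_real, norm_add_sq_real, norm_smul, norm_smul, hη, he', mul_one, mul_one,
      Real.norm_eq_abs, Real.norm_eq_abs, sq_abs, sq_abs, inner_add_right, real_inner_smul_left,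
      real_inner_smul_left, real_inner_smul_right, real_inner_smul_right, heη, hηw]
    ring
  have hph : 0 ≤ p - h := by linarith
  have hbr : ∀ κ, r * (3 / 4) ≤ κ →
      (p - h) * ((p - h) - 2 * inner ℝ w η - 2 * κ * inner ℝ e' η) ≤ 0 := by
    intro κ hκ
    refine mul_nonpos_of_nonneg_of_nonpos hph ?_
    have h1 : r * (3 / 4) * (3 / 4) ≤ κ * inner ℝ e' η :=
      mul_le_mul hκ hα34 (by norm_num) ((by positivity : 0 ≤ r * (3 / 4)).trans hκ)
    linarith
  have hmem' := mem_rConvexHull.1 (rConvexHull_mono_radius hr0 hrγ' hmem)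
  -- The depth of `x'` in the ball of radius `γ`. If it exceeded `ε h`, the ball would also contain
  -- `a + p η`, which lies farther along the axis and belongs to the `γ`-hull; then it would contain
  -- a point of `A`.
  set θ := γ - ρ with hθ
  have hθ0 : 0 < θ := by linarith
  have hMr : e * h + 2 * γ * ((1 + K) * (e * h)) ≤ γ * (ε * h) := by
    have h1 : 1 ≤ γ * (1 / r₁) := by
      rw [mul_one_div, le_div_iff₀ hr₁]; linarith
    have h2 := mul_le_mul_of_nonneg_right h1 (by positivity : 0 ≤ e * h)
    rw [hε]; linarith
  have hθε : θ ≤ ε * h := by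
    by_contra! hcon
    have hx : ‖a + p • η - c'‖ < γ := by
      have h1 := hdist ρ
      have h2 := hbr ρ (by linarith)
      have h3 : 2 * ρ * inner ℝ w e' ≤ 2 * γ * ((1 + K) * (e * h)) := by
        have h4 := mul_le_mul_of_nonneg_left hwe (by linarith : 0 ≤ 2 * ρ)
        have h5 := mul_le_mul_of_nonneg_right hργ.le (by positivity : 0 ≤ (1 + K) * (e * h))
        linarith
      have h6 := mul_lt_mul_of_pos_left hcon hγ0
      have h7 : γ * θ ≤ γ ^ 2 - ρ ^ 2 := by
        have := mul_nonneg hρ0 hθ0.le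
        rw [hθ] at this ⊢; linarith
      rw [hc'e]
      refine lt_of_pow_lt_pow_left₀ 2 hγ0.le ?_
      have : 0 < e * h := by positivity
      linarith
    obtain ⟨z, hzA, hzc⟩ := hmem' c' hx
    linarith [hmiss z hzA]
  set s' := c * h with hs'
  have hs'0 : 0 < s' := by positivity
  have hεh : ε * h < s' := by rw [hs']; exact mul_lt_mul_of_pos_right hec hh0
  have hs'h : s' ≤ h / 16 := by
    have := mul_le_mul_of_nonneg_right hc8 hh0.le
    rw [hs']; linarith
  -- With its centre at this distance from `x'`, the ball of radius `r` protrudes by exactly `s'`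
  -- behind the ball of radius `γ`. As `s' > ε h`, it contains the hull point on the normal, and
  -- therefore some `z ∈ A`.
  set κ := r - s' - θ with hκ
  have hκr : r * (3 / 4) ≤ κ := by rw [hκ]; linarith
  -- a ball of radius `r` that contains the point on the normal
  have hx : ‖a + p • η - (a + h • η + w + κ • e')‖ < r := by
    have h1 := hdist κ
    have h2 := hbr κ hκr
    have hκ0 : 0 ≤ κ := (by positivity : 0 ≤ r * (3 / 4)).trans hκr
    have hκr' : κ ≤ r := by rw [hκ]; linarith
    have h3 : 2 * κ * inner ℝ w e' ≤ 2 * r * ((1 + K) * (e * h)) := by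
      have h4 := mul_le_mul_of_nonneg_left hwe (by linarith : 0 ≤ 2 * κ)
      have h5 := mul_le_mul_of_nonneg_right hκr' (by positivity : 0 ≤ (1 + K) * (e * h))
      linarith
    have h4 : e * h + 2 * r * ((1 + K) * (e * h)) ≤ r * (ε * h) := by
      have h1 : 1 ≤ r * (1 / r₁) := by
        rw [mul_one_div, le_div_iff₀ hr₁]; linarith
      have h2 := mul_le_mul_of_nonneg_right h1 (by positivity : 0 ≤ e * h)
      rw [hε]; linarith
    have h5 := mul_lt_mul_of_pos_left hεh hr0
    have h6 : r * s' ≤ r ^ 2 - κ ^ 2 := by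
      have a1 : r * (s' + θ) ≤ r * (r - κ) := by rw [hκ]; linarith
      have a2 : 0 ≤ κ * (r - κ) := mul_nonneg hκ0 (by linarith)
      have a3 : 0 ≤ r * θ := by positivity
      linarith
    refine lt_of_pow_lt_pow_left₀ 2 hr0.le ?_
    have : 0 < e * h := by positivity
    linarith
  obtain ⟨z, hzA, hzr⟩ := mem_rConvexHull.1 hmem _ hx
  have hzγ := hmiss z hzA
  -- The origin is moved to the rear point of the `γ`-ball on its axis, so that `lens_bounds`
  -- confines `z` to within `q σ` of it. There `f < t`, contrary to `A ⊆ levelSet f t`.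
  set Y := z - (x' - θ • e') with hY
  have hzc' : z - c' = Y - γ • e' := by
    rw [hY, hc'e, hx'e, hθ, sub_smul]; abel
  have hzc : z - (a + h • η + w + κ • e') = Y - (r - s') • e' := by
    rw [hY, ← hx'e, hκ, sub_smul (r - s')]; abel
  rw [hzc'] at hzγ
  rw [hzc] at hzr
  have hY1 := pow_le_pow_left₀ hγ0.le hzγ 2
  have hY2 := pow_lt_pow_left₀ hzr (norm_nonneg _) two_ne_zero
  rw [norm_sub_sq_real, norm_smul, he', mul_one, Real.norm_eq_abs, sq_abs,
    real_inner_smul_right] at hY1 hY2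
  obtain ⟨hYs, hYq⟩ := lens_bounds (y := ‖Y‖ ^ 2) (q := inner ℝ Y e') (c := s') hγ0 hν0 hν1 hrγ hrR
    hs'0 (by linarith) (sq_nonneg _) (by linarith) (by have := sq_nonneg s'; linarith)
  have hYσ : ‖Y‖ ≤ q * σ := by
    refine le_of_sq_le_sq ?_ (by positivity)
    have := mul_le_mul_of_nonneg_right hcq hh0.le
    rw [mul_pow, ← hh]; rw [hs'] at hYs; linarith
  have hza : z = a + (h • η + w - θ • e' + Y) := by rw [hY, hx'e]; abel
  set V := h • η + w - θ • e' + Y with hV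
  have hYη : -(2 * s') - h / 8 ≤ inner ℝ Y η := by
    have h1 : inner ℝ Y η = inner ℝ Y e' - inner ℝ Y (e' - η) := by
      rw [← inner_sub_right]; congr 1; abel
    have h2 : inner ℝ Y (e' - η) ≤ (q * σ) * (K * σ) :=
      (real_inner_le_norm _ _).trans (mul_le_mul hYσ hKe (norm_nonneg _) (by positivity))
    have h3 := mul_le_mul_of_nonneg_right hqK hh0.le
    have h4 : (q * σ) * (K * σ) = q * K * h := by rw [hh]; ring
    linarith
  have hεh8 := mul_le_mul_of_nonneg_right hε8 hh0.le
  have hVη : h / 2 ≤ inner ℝ V η := by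
    rw [hV, inner_add_left, inner_sub_left, inner_add_left, real_inner_smul_left,
      real_inner_smul_left, real_inner_self_eq_norm_sq, hη]
    have h1 : inner ℝ e' η ≤ 1 := by
      have := real_inner_le_norm e' η
      rwa [he', hη, mul_one] at this
    have h2 := mul_le_mul_of_nonneg_left h1 hθ0.le
    linarith
  have hVn : ‖V‖ ≤ ω * σ := by
    have h1 := norm_add_le (h • η + w - θ • e') Y
    have h2 := norm_sub_le (h • η + w) (θ • e')
    have h3 := norm_add_le (h • η) w
    rw [norm_smul, hη, Real.norm_of_nonneg hh0.le, mul_one] at h3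
    rw [norm_smul, he', Real.norm_of_nonneg hθ0.le, mul_one] at h2
    have h4 : h ≤ ω / 4 * σ := by
      have := mul_le_mul_of_nonneg_right hσω.le hσ.le
      rw [hh]; linarith
    have h5 := mul_le_mul_of_nonneg_right heω hσ.le
    have h6 := mul_le_mul_of_nonneg_right hqω hσ.le
    linarith
  have hlev := hz.lt_level haZ hgrad (V := V) (by
    have := mul_le_mul_of_nonneg_right hω1 hσ.le
    linarith) (by linarith)
  rw [← hza, hat] at hlev
  have hzt : t ≤ f z := hAG hzA
  have h1 := mul_le_mul_of_nonneg_left hVη hm.le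
  have h2 := mul_le_mul_of_nonneg_left (pow_le_pow_left₀ (norm_nonneg _) hVn 2) hk.le
  rw [mul_pow, ← hh] at h2
  have h3 := mul_le_mul_of_nonneg_right hωk hh0.le
  have h4 := mul_pos hm hh0
  linarith

end LevelSetEstimation

/-! ### The hull stays close to the level set. -/

namespace LevelSetEstimation

variable {d : ℕ} {f : E d → ℝ} {l u ζ m k L δ : ℝ} {Z : Set (E d)}

/-- The convex hull of the sample stays close to the level set as long as the hull for a slightly
larger radius contains no point of the other sample. -/
theorem SmoothZone.near_levelSet_of_mem_rConvexHull (hz : SmoothZone f l u ζ m k L δ Z)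
    {r₁ R ν : ℝ} (hr₁ : 0 < r₁) (hR : 0 < R) (hν0 : 0 < ν) (hν1 : ν < 1) :
    ∃ C > 0, ∃ s₀ > 0, ∀ s, 0 < s → s < s₀ → ∀ t ∈ Set.Icc l u, IsCompact (levelSet f t) →
      (levelSet f t).Nonempty → ∀ A B : Set (E d), A ⊆ levelSet f t →
      (∀ x η, ‖η‖ = 1 → box x η s ⊆ {z | t + s ≤ f z} → (A ∩ box x η s).Nonempty) →
      (∀ x η, ‖η‖ = 1 → box x η s ⊆ {z | l - ζ ≤ f z ∧ f z ≤ t - s} →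
        (B ∩ box x η s).Nonempty) →
      ∀ r, r₁ ≤ r → r ≤ R → rConvexHull (r / ν) A ∩ B = ∅ → ∀ x ∈ rConvexHull r A,
      t - C * s ≤ f x ∧ ∃ y ∈ levelSet f t, ‖x - y‖ ≤ C * s := by
  have hδ := hz.δ_pos
  have hk := hz.k_pos
  have hm := hz.m_pos
  have hζ := hz.ζ_pos
  obtain ⟨e, he, he4, hem, hke, σ₁, hσ₁, hbox⟩ := hz.exists_box_subset hr₁ hR hν0 hν1
  set M := |L| + k * δ with hM
  have hM0 : 0 < M := by positivity
  set ε := min (min σ₁ (1 / 4)) (min (m / (4 * k)) (min (δ / 2) (ζ / (2 * M)))) with hε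
  have hε0 : 0 < ε := by positivity
  refine ⟨(M + 1) / e ^ 2, by positivity, (e * ε) ^ 2, by positivity, ?_⟩
  intro s hs hsε t ht hcomp hne A B hAG hA hB r hr hrR hAB x hx
  -- Gives `e² σ² = s`; as `e ≤ 1 / 4`, the height `σ²` above the boundary is at least `16` times
  -- the thickness of the boxes.
  set σ := √s / e with hσ
  have hσ0 : 0 < σ := by positivity
  have hσs : e ^ 2 * σ ^ 2 = s := by
    rw [hσ, div_pow, Real.sq_sqrt hs.le]; field_simp
  have hsqs : √s = e * σ := by rw [hσ]; field_simp
  have hσε : σ < ε := by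
    have := (Real.sqrt_lt' (by positivity)).2 hsε
    rw [hsqs] at this
    exact lt_of_mul_lt_mul_left this he.le
  rw [hε] at hσε
  simp only [lt_min_iff] at hσε
  obtain ⟨⟨hσσ₁, hσ4⟩, hσm, hσδ, hσζ⟩ := hσε
  have hσ2 : 0 < σ ^ 2 := by positivity
  have hσσ : σ ^ 2 ≤ σ * (1 / 4) := by
    have := mul_le_mul_of_nonneg_left hσ4.le hσ0.le
    linarith
  have hCs : (M + 1) / e ^ 2 * s = (M + 1) * σ ^ 2 := by rw [← hσs]; field_simp
  rw [hCs]
  by_cases hxG : x ∈ levelSet f t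
  · refine ⟨?_, x, hxG, by rw [sub_self, norm_zero]; positivity⟩
    have : t ≤ f x := hxG
    have : 0 < (M + 1) * σ ^ 2 := by positivity
    linarith
  obtain ⟨a, haZ, η, hfa, hη, hgrad, p, hp, rfl, hnear⟩ := hz.exists_nearest ht hcomp hne hxG
  rcases le_or_gt p (σ ^ 2) with hpσ | hpσ
  · have hn : ‖a + p • η - a‖ = p := by
      rw [add_sub_cancel_left, norm_smul, hη, Real.norm_of_nonneg hp.le, mul_one]
    have hMp : M * p ≤ M * σ ^ 2 := mul_le_mul_of_nonneg_left hpσ hM0.le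
    have h0 : 0 ≤ M * p := by positivity
    refine ⟨?_, a, hfa.ge, by rw [hn]; linarith⟩
    have := (abs_le.1 (hz.abs_sub_le haZ (z := a + p • η) (by rw [hn]; linarith))).1
    rw [hn, hfa] at this
    linarith
  exfalso
  -- Otherwise the ball of radius `r` around the hull point itself misses the level set, and with it
  -- `A`.
  have hpr : p < r := by
    by_contra! hcon
    obtain ⟨z, hzA, hz'⟩ := mem_rConvexHull.1 hx (a + p • η) (by
      rw [sub_self, norm_zero]; linarith)
    linarith [hnear z (hAG hzA)]
  rw [← hσs] at hA
  have hsub := hbox σ hσ0 hσσ₁ t A hAG hA a haZ hfa η hη hgrad r hr hrR p hpσ hpr hx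
  rw [hσs] at hsub
  have he2 : e ^ 2 ≤ e * (1 / 4) := by
    have := mul_le_mul_of_nonneg_left he4 he.le
    linarith
  have hse : s ≤ e * σ ^ 2 * (1 / 4) := by
    have := mul_le_mul_of_nonneg_right he2 hσ2.le
    rw [← hσs]; linarith
  have heσ : e * σ ^ 2 ≤ σ ^ 2 * (1 / 4) := by
    have := mul_le_mul_of_nonneg_right he4 hσ2.le
    linarith
  -- The box at height `σ²` has density at most `t - s` but still at least `l - ζ`, so it contains a
  -- point of `B`, and this point lies in the hull of radius `r / ν`.
  obtain ⟨z, hzB, hzb⟩ := hB (a + σ ^ 2 • η) η hη (by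
    rintro z ⟨h1, h2⟩
    set w := z - (a + σ ^ 2 • η) with hw
    have hza : z = a + (σ ^ 2 • η + w) := by rw [hw]; abel
    have hin : σ ^ 2 / 2 ≤ inner ℝ (σ ^ 2 • η + w) η := by
      rw [inner_add_left, real_inner_smul_left, real_inner_self_eq_norm_sq, hη]
      linarith [(abs_le.1 h1).1]
    have hn : ‖σ ^ 2 • η + w‖ ≤ σ * (σ + e) := by
      refine (norm_add_le _ _).trans ?_
      rw [norm_smul, hη, Real.norm_of_nonneg hσ2.le]
      rw [hsqs] at h2
      linarith
    have hσe : σ * (σ + e) ≤ σ := mul_le_of_le_one_right hσ0.le (by linarith)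
    have hnσ := hn.trans hσe
    have hup := hz.lt_level haZ hgrad (V := σ ^ 2 • η + w) (by linarith)
      ((by positivity : (0 : ℝ) ≤ σ ^ 2 / 2).trans hin)
    have hlo := (abs_le.1 (hz.abs_sub_le haZ (z := z) (by
      rw [hza, add_sub_cancel_left]; linarith))).1
    have hz' : z - a = σ ^ 2 • η + w := by rw [hza, add_sub_cancel_left]
    rw [hz', hfa] at hlo
    rw [← hza, hfa] at hup
    constructor
    · rw [lt_div_iff₀ (by positivity)] at hσζ
      have := mul_le_mul_of_nonneg_left hnσ hM0.le
      linarith [ht.1]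
    · have h3 := mul_le_mul_of_nonneg_left (pow_le_pow_left₀ (norm_nonneg _) hn 2) hk.le
      rw [lt_div_iff₀ (by positivity)] at hσm
      have h4 : k * (σ + e) ^ 2 ≤ m * (5 / 16) := by
        have b1 : k * (σ + e) ≤ m / 2 := by linarith
        have b2 := mul_le_mul b1 (by linarith : σ + e ≤ 1 / 2) (by positivity) (by positivity)
        linarith
      have h5 := mul_le_mul_of_nonneg_right h4 hσ2.le
      have h6 : m * (σ ^ 2 / 2) ≤ m * inner ℝ (σ ^ 2 • η + w) η :=
        mul_le_mul_of_nonneg_left hin hm.le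
      have h7 := mul_le_mul_of_nonneg_right hem hσ2.le
      have h8 : k * (σ * (σ + e)) ^ 2 = k * (σ + e) ^ 2 * σ ^ 2 := by ring
      have h9 := mul_pos hm hσ2
      linarith)
  exact (Set.eq_empty_iff_forall_notMem.1 hAB z) ⟨hsub hzb, hzB⟩

end LevelSetEstimation

/-! ### The smooth zone from the assumptions, and volumes of strips between levels. -/

namespace LevelSetEstimation

variable {d : ℕ} {f : E d → ℝ} {l u ζ m k L δ : ℝ} {Z : Set (E d)}

theorem inner_gradient (f : E d → ℝ) (a v : E d) : inner ℝ (gradient f a) v = fderiv ℝ f a v := by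
  rw [gradient, InnerProductSpace.toDual_symm_apply]

theorem norm_gradient_sub (f : E d → ℝ) (a z : E d) :
    ‖gradient f z - gradient f a‖ = ‖fderiv ℝ f z - fderiv ℝ f a‖ := by
  rw [gradient, gradient, ← map_sub, LinearIsometryEquiv.norm_map]

/-- `Z` is the closed shell between two levels; being compact inside the open set `U`, it has a
bounded gradient and a uniform radius for the Taylor bound. As `f ≥ 0` and the space is unbounded,
boundedness of `G(l - ζ)` forces `l - ζ > 0`, the lower bound on the density that sampling needs. -/
theorem AssumptionA.exists_smoothZone [Nontrivial (E d)] {p : ℕ} (hp : 1 ≤ p)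
    (hf : ∀ x, 0 ≤ f x) (hA : AssumptionA p f l u) :
    ∃ (ζ m k L δ : ℝ) (Z U : Set (E d)), SmoothZone f l u ζ m k L δ Z ∧ IsOpen U ∧ Z ⊆ U ∧
      ContDiffOn ℝ p f U := by
  obtain ⟨hlu, -, -, U, ζ, m, k, hζ, hbdd, hUo, hUb, hsub, hsm, hm, hgm, hgk⟩ := hA
  set Z := closure (levelSet f (l - ζ)) \ interior (levelSet f (u + ζ)) with hZ
  have hZb : Bornology.IsBounded Z := hUb.subset hsub
  have hZc : IsCompact Z := Metric.isCompact_of_isClosed_isBounded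
    (isClosed_closure.sdiff isOpen_interior) hZb
  have hLb : Bornology.IsBounded (levelSet f (l - ζ)) := by
    refine (hZb.union hbdd).subset fun x hx => ?_
    by_cases h : x ∈ interior (levelSet f (u + ζ))
    · exact Or.inr (interior_subset h)
    · exact Or.inl ⟨subset_closure hx, h⟩
  have hlow : 0 < l - ζ := by
    by_contra! hcon
    refine (NormedSpace.unbounded_univ ℝ (E d)) (hLb.subset fun x _ => ?_)
    exact hcon.trans (hf x)
  set k' := max k 1 with hk'
  have hk'0 : 0 < k' := lt_of_lt_of_le one_pos (le_max_right _ _)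
  have hgk' : ∀ x ∈ U, ∀ y ∈ U, ‖gradient f x - gradient f y‖ ≤ k' * ‖x - y‖ := fun x hx y hy =>
    (hgk x hx y hy).trans (mul_le_mul_of_nonneg_right (le_max_left _ _) (norm_nonneg _))
  obtain ⟨L, hL⟩ : ∃ L, ∀ a ∈ Z, ‖gradient f a‖ ≤ L := by
    refine hZc.exists_bound_of_continuousOn (LipschitzOnWith.continuousOn (K := k'.toNNReal) ?_)
    refine LipschitzOnWith.of_dist_le_mul fun x hx y hy => ?_
    rw [dist_eq_norm, dist_eq_norm, Real.coe_toNNReal _ hk'0.le]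
    exact hgk' x (hsub hx) y (hsub hy)
  obtain ⟨δ₀, hδ₀, hδ₀U⟩ := hZc.exists_cthickening_subset_open hUo hsub
  have hdiff : ∀ x ∈ U, DifferentiableAt ℝ f x := fun x hx =>
    ((hsm.contDiffAt (hUo.mem_nhds hx)).differentiableAt (by
      exact_mod_cast (Nat.one_le_iff_ne_zero.1 hp)))
  have htaylor : ∀ a ∈ Z, ∀ z, ‖z - a‖ ≤ δ₀ →
      |f z - f a - inner ℝ (gradient f a) (z - a)| ≤ k' * ‖z - a‖ ^ 2 := by
    intro a ha z hza
    have hball : Metric.closedBall a ‖z - a‖ ⊆ U := by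
      refine (Metric.closedBall_subset_closedBall hza).trans (subset_trans ?_ hδ₀U)
      exact Metric.closedBall_subset_cthickening ha δ₀
    have := (convex_closedBall a ‖z - a‖).norm_image_sub_le_of_norm_fderiv_le'
      (f := f) (φ := fderiv ℝ f a) (C := k' * ‖z - a‖) (x := a) (y := z)
      (fun x hx => hdiff x (hball hx)) (fun x hx => by
        rw [← norm_gradient_sub]
        refine (hgk' x (hball hx) a (hsub ha)).trans (mul_le_mul_of_nonneg_left ?_ hk'0.le)
        rwa [← dist_eq_norm])
      (Metric.mem_closedBall_self (norm_nonneg _)) (by rw [Metric.mem_closedBall, dist_eq_norm])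
    rw [inner_gradient, ← Real.norm_eq_abs]
    refine this.trans (le_of_eq (by ring))
  set M := |L| + k' + 1 with hM
  have hM0 : 0 < M := by positivity
  set δ := min (min (δ₀ / 2) (1 / 2)) (ζ / (4 * M)) with hδ
  have hδ0 : 0 < δ := by positivity
  have hδδ₀ : δ ≤ δ₀ / 2 := (min_le_left _ _).trans (min_le_left _ _)
  have hδ1 : δ ≤ 1 / 2 := (min_le_left _ _).trans (min_le_right _ _)
  have hδζ : δ * (4 * M) ≤ ζ := by
    rw [← le_div_iff₀ (by positivity)]; exact min_le_right _ _
  refine ⟨ζ, m, k', L, δ, Z, U, ⟨hlu, hζ, hm, hk'0, hδ0, hlow, hZc, hLb, ?_, fun a ha =>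
    hgm a (hsub ha), hL, fun a ha z hza => htaylor a ha z (by linarith), fun a ha z hz' =>
    hgk' z (hsub hz') a (hsub ha), ?_⟩, hUo, hsub, hsm⟩
  · intro x h1 h2
    refine ⟨subset_closure h1, fun h => ?_⟩
    have : x ∈ levelSet f (u + ζ) := interior_subset h
    change u + ζ ≤ f x at this
    linarith
  · intro x hxZ hx y hyx
    set O := interior (levelSet f (u + ζ)) with hO
    have hxO : x ∈ O := by
      by_contra h
      exact hxZ ⟨subset_closure hx, h⟩
    by_cases hyO : y ∈ O
    · have : y ∈ levelSet f (u + ζ) := interior_subset hyO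
      change u + ζ ≤ f y at this
      linarith
    -- If `y` has left the interior of `G(u + ζ)`, a frontier point `w` nearby lies in `Z` and has
    -- `f w ≥ u + ζ` by continuity there; the Taylor bound at `w` then controls `f y`.
    obtain ⟨w, hw, hxw⟩ := exists_mem_frontier_infDist_compl_eq_dist hxO
      (fun h => hyO (h ▸ Set.mem_univ y))
    have hxw' : dist x w ≤ dist x y := hxw ▸ Metric.infDist_le_dist_of_mem hyO
    have hyw : ‖y - w‖ ≤ 2 * δ := by
      rw [← dist_eq_norm]
      have h1 := dist_triangle y x w
      have h2 : dist y x ≤ δ := by rwa [dist_eq_norm]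
      rw [dist_comm x y] at hxw'
      linarith
    rw [frontier, isOpen_interior.interior_eq] at hw
    have hwcl : w ∈ closure (levelSet f (u + ζ)) := closure_mono interior_subset hw.1
    have hwZ : w ∈ Z := ⟨closure_mono (fun v (hv : u + ζ ≤ f v) => by
      change l - ζ ≤ f v; linarith) hwcl, hw.2⟩
    have hfw : u + ζ ≤ f w := by
      have hc : ContinuousAt f w := (hdiff w (hsub hwZ)).continuousAt
      exact closure_minimal (s := f '' levelSet f (u + ζ)) (t := Set.Ici (u + ζ))
        (by rintro _ ⟨v, hv, rfl⟩; exact hv) isClosed_Ici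
        (mem_closure_image hc hwcl)
    have hT := (abs_le.1 (htaylor w hwZ y (by linarith))).1
    have h1 : |inner ℝ (gradient f w) (y - w)| ≤ |L| * (2 * δ) :=
      (abs_real_inner_le_norm _ _).trans (mul_le_mul ((hL w hwZ).trans (le_abs_self L)) hyw
        (norm_nonneg _) (abs_nonneg _))
    have h2 : k' * ‖y - w‖ ^ 2 ≤ k' * (2 * δ) := by
      refine mul_le_mul_of_nonneg_left ?_ hk'0.le
      have h3 := mul_le_mul hyw (by linarith : ‖y - w‖ ≤ 1) (norm_nonneg _) (by linarith)
      rw [sq]; linarith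
    have h3 := (abs_le.1 h1).1
    have h4 : δ * (4 * M) = 2 * (|L| * (2 * δ) + k' * (2 * δ)) + 4 * δ := by rw [hM]; ring
    linarith

/-- Within a small ball, a strip between two nearby levels has a volume of the order of the
difference of the levels, as it is disjoint from many of its translates. -/
theorem SmoothZone.volume_strip_inter_ball_le (hz : SmoothZone f l u ζ m k L δ Z)
    (hf : Measurable f) {ρ : ℝ} (hρ : 0 < ρ) (hρδ : 2 * ρ ≤ δ) (hρk : 6 * k * ρ ≤ m) {a : E d}
    (ha : a ∈ Z) {ε : ℝ} (hε : 0 < ε) (hερ : 3 * ε / m ≤ ρ) (s : ℝ) :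
    volume (Z ∩ {x | s ≤ f x ∧ f x ≤ s + ε} ∩ Metric.ball a ρ) ≤
      ENNReal.ofReal ((volume (Metric.ball a (2 * ρ))).toReal * (6 / (m * ρ)) * ε) := by
  have hm := hz.m_pos
  have hk := hz.k_pos
  set S := Z ∩ {x | s ≤ f x ∧ f x ≤ s + ε} ∩ Metric.ball a ρ with hS
  have hSm : MeasurableSet S := by
    refine (hz.isCompact.isClosed.measurableSet.inter ?_).inter Metric.isOpen_ball.measurableSet
    exact (measurableSet_le measurable_const hf).inter (measurableSet_le hf measurable_const)
  have hn : 0 < ‖gradient f a‖ := hm.trans_le (hz.m_le a ha)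
  set e := ‖gradient f a‖⁻¹ • gradient f a with he
  have hen : ‖e‖ = 1 := by rw [he, norm_smul, norm_inv, norm_norm, inv_mul_cancel₀ hn.ne']
  have hae : inner ℝ (gradient f a) e = ‖gradient f a‖ := by
    rw [he, real_inner_smul_right, real_inner_self_eq_norm_sq]; field_simp
  -- points of the strip on a common line are close to each other
  have hsep : ∀ z ∈ S, ∀ τ : ℝ, 0 < τ → z + τ • e ∈ S → τ * m ≤ 2 * ε := by
    rintro z ⟨⟨hzZ, hz1, hz2⟩, hzb⟩ τ hτ ⟨⟨_, hw1, hw2⟩, hwb⟩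
    rw [Metric.mem_ball, dist_eq_norm] at hzb hwb
    have hnτ : ‖z + τ • e - z‖ = τ := by
      rw [add_sub_cancel_left, norm_smul, hen, Real.norm_of_nonneg hτ.le, mul_one]
    have hτρ : τ ≤ 2 * ρ := by
      have h1 := norm_sub_le (z + τ • e - a) (z - a)
      rw [sub_sub_sub_cancel_right, hnτ] at h1
      linarith
    have hT := (abs_le.1 (hz.taylor z hzZ (z + τ • e) (by rw [hnτ]; linarith))).1
    rw [hnτ, add_sub_cancel_left, real_inner_smul_right] at hT
    have h1 : inner ℝ (gradient f z) e =
        ‖gradient f a‖ + inner ℝ (gradient f z - gradient f a) e := by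
      rw [inner_sub_left, hae]; ring
    have h2 : |inner ℝ (gradient f z - gradient f a) e| ≤ k * ρ := by
      refine (abs_real_inner_le_norm _ _).trans ?_
      rw [hen, mul_one]
      exact (hz.gradient_lip a ha z hzZ).trans (mul_le_mul_of_nonneg_left hzb.le hk.le)
    have h3 := (abs_le.1 h2).1
    have h4 := hz.m_le a ha
    have h5 : τ * (m - k * ρ) ≤ τ * inner ℝ (gradient f z) e :=
      mul_le_mul_of_nonneg_left (by linarith) hτ.le
    have h6 : k * τ ^ 2 ≤ τ * (k * (2 * ρ)) := by
      have := mul_le_mul_of_nonneg_left hτρ (mul_nonneg hk.le hτ.le)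
      linarith
    have h7 := mul_le_mul_of_nonneg_left hρk hτ.le
    linarith
  -- Translates of the strip by multiples of `κ > 2 ε / m` are disjoint, and about `ρ / κ` of them
  -- fit into the ball of radius `2 ρ`.
  set κ := 3 * ε / m with hκ
  have hκ0 : 0 < κ := by positivity
  have hκm : κ * m = 3 * ε := by rw [hκ]; field_simp
  set N := ⌊ρ / κ⌋₊ with hN
  have hN1 : 1 ≤ ρ / κ := by rwa [one_le_div hκ0]
  have hNle : (N : ℝ) * κ ≤ ρ := by
    rw [← le_div_iff₀ hκ0]; exact Nat.floor_le (by positivity)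
  have hNge : ρ ≤ 2 * N * κ := by
    have h1 := Nat.lt_floor_add_one (ρ / κ)
    have h2 : (1 : ℝ) ≤ N := by exact_mod_cast Nat.le_floor (by simpa using hN1)
    rw [div_lt_iff₀ hκ0] at h1
    have := mul_le_mul_of_nonneg_right h2 hκ0.le
    rw [← hN] at h1
    linarith
  have hdisj : Set.PairwiseDisjoint (Finset.range N : Set ℕ)
      (fun j => (fun x => x + (-(j * κ)) • e) ⁻¹' S) := by
    have hlt : ∀ i j : ℕ, i < j → ∀ x, x + (-(i * κ)) • e ∈ S → x + (-(j * κ)) • e ∈ S →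
        False := by
      intro i j hij x hi hj
      have hij' : (i : ℝ) + 1 ≤ j := by exact_mod_cast hij
      have h1 := hsep _ hj (((j : ℝ) - i) * κ) (mul_pos (by linarith) hκ0) (by
        have : x + (-(j * κ)) • e + (((j : ℝ) - i) * κ) • e = x + (-(i * κ)) • e := by
          rw [add_assoc, ← add_smul]; congr 2; ring
        rwa [this])
      have h2 : 1 * (κ * m) ≤ ((j : ℝ) - i) * (κ * m) :=
        mul_le_mul_of_nonneg_right (by linarith) (by positivity)
      rw [hκm] at h2
      have h3 : ((j : ℝ) - i) * κ * m = ((j : ℝ) - i) * (3 * ε) := by rw [← hκm]; ring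
      linarith
    intro i _ j _ hij
    rw [Function.onFun, Set.disjoint_left]
    intro x hi hj
    rcases lt_or_gt_of_ne hij with h | h
    · exact hlt i j h x hi hj
    · exact hlt j i h x hj hi
  have hunion : (⋃ j ∈ Finset.range N, (fun x => x + (-(j * κ)) • e) ⁻¹' S) ⊆
      Metric.ball a (2 * ρ) := by
    intro x hx
    simp only [Set.mem_iUnion, Finset.mem_range, Set.mem_preimage] at hx
    obtain ⟨j, hj, hx⟩ := hx
    have h1 := hx.2
    rw [Metric.mem_ball, dist_eq_norm] at h1 ⊢
    have h2 : x - a = (x + (-(j * κ)) • e - a) + ((j : ℝ) * κ) • e := by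
      rw [neg_smul]; abel
    have h3 : ‖((j : ℝ) * κ) • e‖ ≤ ρ := by
      rw [norm_smul, hen, Real.norm_of_nonneg (by positivity), mul_one]
      refine le_trans (mul_le_mul_of_nonneg_right ?_ hκ0.le) hNle
      exact_mod_cast hj.le
    rw [h2]
    exact (norm_add_le _ _).trans_lt (by linarith)
  have hvol := measure_mono (μ := volume) hunion
  rw [measure_biUnion_finset hdisj (fun j _ => (measurable_id.add_const _) hSm)] at hvol
  simp only [measure_preimage_add_right, Finset.sum_const, Finset.card_range, nsmul_eq_mul] at hvol
  have hfin : volume (Metric.ball a (2 * ρ)) ≠ ⊤ := measure_ball_lt_top.ne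
  have hSfin : volume S ≠ ⊤ := ne_top_of_le_ne_top measure_ball_lt_top.ne
    (measure_mono Set.inter_subset_right)
  have hreal := ENNReal.toReal_mono hfin hvol
  rw [ENNReal.toReal_mul, ENNReal.toReal_natCast] at hreal
  rw [← ENNReal.ofReal_toReal hSfin]
  refine ENNReal.ofReal_le_ofReal ?_
  have h1 : (volume S).toReal * ρ ≤ (volume S).toReal * (2 * N * κ) :=
    mul_le_mul_of_nonneg_left hNge ENNReal.toReal_nonneg
  have h2 := mul_le_mul_of_nonneg_right hreal (by positivity : 0 ≤ 2 * κ)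
  have h3 : (volume (Metric.ball a (2 * ρ))).toReal * (6 / (m * ρ)) * ε =
      (volume (Metric.ball a (2 * ρ))).toReal * (2 * κ) / ρ := by
    rw [hκ]; field_simp; ring
  rw [h3, le_div_iff₀ hρ]
  linarith

/-- A strip between two nearby levels has a volume of the order of the difference of the levels. -/
theorem SmoothZone.volume_strip_le (hz : SmoothZone f l u ζ m k L δ Z) (hf : Measurable f) :
    ∃ C > 0, ∃ ε₀ > 0, ∀ ε, 0 < ε → ε < ε₀ → ∀ s, l - ζ ≤ s → s + ε < u + ζ →
      volume {x | s ≤ f x ∧ f x ≤ s + ε} ≤ ENNReal.ofReal (C * ε) := by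
  have hm := hz.m_pos
  have hk := hz.k_pos
  have hδ := hz.δ_pos
  set ρ := min (δ / 2) (m / (6 * k)) with hρ
  have hρ0 : 0 < ρ := by positivity
  have hρk : 6 * k * ρ ≤ m := by
    have : ρ ≤ m / (6 * k) := min_le_right _ _
    rw [le_div_iff₀ (by positivity)] at this; linarith
  have hρδ : 2 * ρ ≤ δ := by
    have : ρ ≤ δ / 2 := min_le_left _ _
    linarith
  obtain ⟨T, hTZ, hT⟩ := hz.isCompact.elim_nhds_subcover (fun a => Metric.ball a ρ)
    (fun a _ => Metric.ball_mem_nhds a hρ0)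
  set c : E d → ℝ := fun a => (volume (Metric.ball a (2 * ρ))).toReal * (6 / (m * ρ)) with hc
  have hc0 : ∀ a, 0 ≤ c a := fun a => by positivity
  refine ⟨∑ a ∈ T, c a + 1, by have := Finset.sum_nonneg fun a (_ : a ∈ T) => hc0 a
                               linarith, ρ * m / 3, by positivity, ?_⟩
  intro ε hε hε₀ s hs hsu
  have hcov : {x | s ≤ f x ∧ f x ≤ s + ε} ⊆
      ⋃ a ∈ T, (Z ∩ {x | s ≤ f x ∧ f x ≤ s + ε} ∩ Metric.ball a ρ) := by
    intro x hx
    have hxZ : x ∈ Z := hz.mem_of_lt x (hs.trans hx.1) (hx.2.trans_lt hsu)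
    obtain ⟨a, haT, hxa⟩ := Set.mem_iUnion₂.1 (hT hxZ)
    exact Set.mem_iUnion₂.2 ⟨a, haT, ⟨hxZ, hx⟩, hxa⟩
  refine (measure_mono hcov).trans ((measure_biUnion_finset_le T _).trans ?_)
  have hερ : 3 * ε / m ≤ ρ := by rw [div_le_iff₀ hm]; linarith
  calc ∑ a ∈ T, volume (Z ∩ {x | s ≤ f x ∧ f x ≤ s + ε} ∩ Metric.ball a ρ)
      ≤ ∑ a ∈ T, ENNReal.ofReal (c a * ε) := Finset.sum_le_sum fun a ha =>
        hz.volume_strip_inter_ball_le hf hρ0 hρδ hρk (hTZ a ha) hε hερ s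
    _ = ENNReal.ofReal (∑ a ∈ T, c a * ε) :=
        (ENNReal.ofReal_sum_of_nonneg fun a _ => mul_nonneg (hc0 a) hε.le).symm
    _ ≤ _ := ENNReal.ofReal_le_ofReal (by rw [← Finset.sum_mul]; linarith)

end LevelSetEstimation

/-! ### Volume of boxes, Borel–Cantelli, and a finite grid. -/

namespace LevelSetEstimation

variable {d : ℕ}

theorem norm_le_sum_abs_repr (b : OrthonormalBasis (Fin d) ℝ (E d)) (v : E d) :
    ‖v‖ ≤ ∑ i, |b.repr v i| := by
  conv_lhs => rw [← b.sum_repr v]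
  refine (norm_sum_le _ _).trans (Finset.sum_le_sum fun i _ => ?_)
  rw [norm_smul, b.norm_eq_one, mul_one, Real.norm_eq_abs]

theorem isClosed_box (x η : E d) (s : ℝ) : IsClosed (box x η s) := by
  have h1 : Continuous fun z : E d => |inner ℝ (z - x) η| := by fun_prop
  have h2 : Continuous fun z : E d => ‖z - x‖ := by fun_prop
  exact (isClosed_le h1 continuous_const).inter (isClosed_le h2 continuous_const)

/-- A change of the normal acts only on vectors of length at most `√s / 2`, so an error `√s / 4` in
`η` costs only a fraction of `s`. This reduces all boxes to those of a finite grid, whose normals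
`η'` need not be unit vectors. -/
theorem box_subset_box {x x' η η' : E d} {s : ℝ} (hs : 0 < s) (hs1 : s ≤ 1) (hη : ‖η‖ = 1)
    (hx : ‖x - x'‖ ≤ s / 4) (hη' : ‖η - η'‖ ≤ √s / 4) : box x' η' (s / 4) ⊆ box x η s := by
  rintro z ⟨h1, h2⟩
  have hsq : √s * √s = s := Real.mul_self_sqrt hs.le
  have hsq1 : √s ≤ 1 := Real.sqrt_le_one.2 hs1
  have hsqs : s ≤ √s := by
    have := mul_le_mul_of_nonneg_left hsq1 (Real.sqrt_nonneg s)
    linarith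
  have h2' : ‖z - x'‖ ≤ √s / 2 := by
    refine h2.trans (le_of_eq ?_)
    rw [Real.sqrt_div' _ (by norm_num), show (4 : ℝ) = 2 ^ 2 by norm_num,
      Real.sqrt_sq (by norm_num)]
  constructor
  · have e : inner ℝ (z - x) η = inner ℝ (z - x') η' + inner ℝ (z - x') (η - η') -
        inner ℝ (x - x') η := by
      rw [← inner_add_right, add_sub_cancel, ← inner_sub_left, sub_sub_sub_cancel_right]
    have a1 := (abs_real_inner_le_norm (z - x') (η - η')).trans
      (mul_le_mul h2' hη' (norm_nonneg _) (by positivity))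
    have a2 := abs_real_inner_le_norm (x - x') η
    rw [hη, mul_one] at a2
    have a3 := abs_le.1 a1
    have a4 := abs_le.1 (a2.trans hx)
    have a5 := abs_le.1 h1
    rw [e, abs_le]
    constructor <;> linarith [a3.1, a3.2, a4.1, a4.2, a5.1, a5.2]
  · have e : z - x = (z - x') - (x - x') := by abel
    rw [e]
    refine (norm_sub_le _ _).trans ?_
    linarith

/-- Boxes of thickness `s` have a volume of order at least `s ^ ((d + 1) / 2)`. -/
theorem exists_le_volume_box [Nontrivial (E d)] :
    ∃ c > 0, ∀ x η : E d, ‖η‖ ≤ 2 → ∀ s, 0 < s → s ≤ 1 →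
      ENNReal.ofReal (c * √s ^ (d + 1)) ≤ volume (box x η s) := by
  have hd : 0 < d := by
    rcases Nat.eq_zero_or_pos d with rfl | h
    · exact absurd (inferInstance : Subsingleton (E 0)) (not_subsingleton _)
    · exact h
  have hd' : (1 : ℝ) ≤ d := by exact_mod_cast hd
  set i₀ : Fin d := ⟨0, hd⟩
  refine ⟨(1 / (d : ℝ)) ^ d, by positivity, fun x η hη s hs hs1 => ?_⟩
  obtain ⟨e₀, he₀⟩ := exists_norm_eq (E d) (zero_le_one (α := ℝ))
  obtain ⟨e, he, hηe⟩ := exists_unit_smul he₀ η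
  obtain ⟨b, hb⟩ := Orthonormal.exists_orthonormalBasis_extension_of_card_eq (𝕜 := ℝ) (E := E d)
    (ι := Fin d) (by simp) (v := fun _ => e) (s := {i₀})
    ⟨fun i => he, fun i j hij => (hij (Subsingleton.elim i j)).elim⟩
  have hb0 : b i₀ = e := hb i₀ rfl
  have hsq0 : 0 ≤ √s := Real.sqrt_nonneg s
  have hsq1 : √s ≤ 1 := Real.sqrt_le_one.2 hs1
  have hsq : √s * √s = s := Real.mul_self_sqrt hs.le
  -- Half-sides of a cuboid inside the box, thinner by the factor `√s` in the direction of `η`; the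
  -- denominator `2 d` absorbs the bound `‖η‖ ≤ 2` and the sum over the coordinates.
  set w : Fin d → ℝ := fun i => √s / (2 * d) * (if i = i₀ then √s else 1) with hw
  have hw0 : ∀ i, 0 ≤ w i := fun i => by
    simp only [hw]; split_ifs <;> positivity
  have hwle : ∀ i, w i ≤ √s / (2 * d) := fun i => by
    refine mul_le_of_le_one_right (by positivity) ?_
    split_ifs
    exacts [hsq1, le_rfl]
  set c : Fin d → ℝ := fun i => b.repr x i with hc
  have hmp : MeasurePreserving (fun z : E d => (WithLp.ofLp (b.repr z) : Fin d → ℝ)) volume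
      volume := (EuclideanSpace.volume_preserving_symm_measurableEquiv_toLp (Fin d)).comp
        b.measurePreserving_repr
  have hvol : volume ((fun z : E d => (WithLp.ofLp (b.repr z) : Fin d → ℝ)) ⁻¹'
      Set.Icc (c - w) (c + w)) = ENNReal.ofReal ((1 / (d : ℝ)) ^ d * √s ^ (d + 1)) := by
    rw [hmp.measure_preimage measurableSet_Icc.nullMeasurableSet, Real.volume_Icc_pi,
      ← ENNReal.ofReal_prod_of_nonneg]
    · congr 1
      have : ∀ i ∈ Finset.univ, (c + w) i - (c - w) i =
          √s / d * (if i = i₀ then √s else 1) := fun i _ => by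
        simp only [Pi.add_apply, Pi.sub_apply, hw]
        field_simp; ring
      rw [Finset.prod_congr rfl this, Finset.prod_mul_distrib, Finset.prod_const,
        Finset.prod_ite_eq' Finset.univ i₀]
      simp only [Finset.card_univ, Fintype.card_fin, Finset.mem_univ, if_true]
      rw [div_pow, div_pow, one_pow, pow_succ]; ring
    · intro i _
      have := hw0 i
      simp only [Pi.add_apply, Pi.sub_apply]; linarith
  rw [← hvol]
  refine measure_mono fun z hz => ?_
  have hz' : ∀ i, |b.repr (z - x) i| ≤ w i := fun i => by
    have h1 := hz.1 i
    have h2 := hz.2 i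
    simp only [Pi.add_apply, Pi.sub_apply, hc] at h1 h2
    rw [map_sub, PiLp.sub_apply, abs_le]
    constructor <;> linarith
  constructor
  · have h1 : inner ℝ (z - x) η = ‖η‖ * b.repr (z - x) i₀ := by
      conv_lhs => rw [hηe]
      rw [real_inner_smul_right, b.repr_apply_apply, hb0, real_inner_comm]
    have h2 : w i₀ = s / (2 * d) := by
      simp only [hw, if_true]; rw [div_mul_eq_mul_div, hsq]
    have h3 := hz' i₀
    rw [h2] at h3
    rw [h1, abs_mul, abs_norm]
    refine (mul_le_mul hη h3 (abs_nonneg _) (by norm_num)).trans ?_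
    rw [show 2 * (s / (2 * (d : ℝ))) = s / d by field_simp]
    exact div_le_self hs.le hd'
  · refine (norm_le_sum_abs_repr b _).trans ?_
    refine (Finset.sum_le_sum fun i _ => (hz' i).trans (hwle i)).trans ?_
    rw [Finset.sum_const, Finset.card_univ, Fintype.card_fin, nsmul_eq_mul]
    rw [show (d : ℝ) * (√s / (2 * d)) = √s / 2 by field_simp]
    linarith

variable {Ω : Type*} [MeasurableSpace Ω] {P : Measure Ω} {X : ℕ → Ω → E d} {f : E d → ℝ}

/-- Borel–Cantelli for a property that fails with probability of order `n ^ (-2)`. -/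
theorem ae_eventually_of_measure_le {p : ℕ → Ω → Prop} {C : ℝ}
    (h : ∀ᶠ n in atTop, P {ω | ¬ p n ω} ≤ ENNReal.ofReal (C * (1 / (n : ℝ) ^ 2))) :
    ∀ᵐ ω ∂P, ∀ᶠ n in atTop, p n ω := by
  obtain ⟨N, hN⟩ := eventually_atTop.1 h
  have hsum : Summable fun n : ℕ => C * (1 / (n : ℝ) ^ 2) :=
    (Real.summable_one_div_nat_pow.2 one_lt_two).mul_left C
  have h1 : ∑' n, P {ω | N ≤ n ∧ ¬ p n ω} ≠ ⊤ := by
    refine ne_top_of_le_ne_top hsum.tsum_ofReal_ne_top (ENNReal.tsum_le_tsum fun n => ?_)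
    by_cases hn : N ≤ n
    · exact (measure_mono fun ω hω => hω.2).trans (hN n hn)
    · have : {ω | N ≤ n ∧ ¬ p n ω} = ∅ := by ext ω; simp [hn]
      rw [this, measure_empty]; exact zero_le
  filter_upwards [ae_eventually_notMem h1] with ω hω
  filter_upwards [hω, eventually_ge_atTop N] with n hn hnN
  by_contra hcon
  exact hn ⟨hnN, hcon⟩

/-- Each observation hits `B` with probability at least `lam * v`; independence and `1 - x ≤ exp
(-x)` do the rest. -/
theorem IsSampleFrom.measure_forall_notMem_le [IsProbabilityMeasure P] (hX : IsSampleFrom P X f)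
    {B : Set (E d)} (hB : MeasurableSet B) {lam v : ℝ} (hlam : 0 ≤ lam)
    (hBf : B ⊆ {z | lam ≤ f z}) (hv : ENNReal.ofReal v ≤ volume B) (n : ℕ) :
    P {ω | ∀ i < n, X i ω ∉ B} ≤ ENNReal.ofReal (Real.exp (-(n * (lam * v)))) := by
  obtain ⟨hmeas, hind, hlaw⟩ := hX
  have hset : {ω | ∀ i < n, X i ω ∉ B} = ⋂ i ∈ Finset.range n, X i ⁻¹' Bᶜ := by
    ext ω; simp
  rw [hset, hind.measure_inter_preimage_eq_mul (Finset.range n) (sets := fun _ => Bᶜ)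
    (fun i _ => hB.compl)]
  have hone : ∀ i, P (X i ⁻¹' Bᶜ) ≤ ENNReal.ofReal (Real.exp (-(lam * v))) := by
    intro i
    have h1 : ENNReal.ofReal (lam * v) ≤ P (X i ⁻¹' B) := by
      rw [← Measure.map_apply (hmeas i) hB, hlaw i, withDensity_apply _ hB,
        ENNReal.ofReal_mul hlam]
      calc ENNReal.ofReal lam * ENNReal.ofReal v ≤ ENNReal.ofReal lam * volume B := by gcongr
        _ = ∫⁻ _ in B, ENNReal.ofReal lam := by rw [setLIntegral_const]
        _ ≤ _ := setLIntegral_mono' hB fun z hz => ENNReal.ofReal_le_ofReal (hBf hz)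
    rw [Set.preimage_compl, prob_compl_eq_one_sub (hmeas i hB)]
    refine (tsub_le_tsub_left h1 1).trans ?_
    rw [← ENNReal.ofReal_one, tsub_le_iff_right]
    rcases le_or_gt 0 (lam * v) with h0 | h0
    · rw [← ENNReal.ofReal_add (Real.exp_pos _).le h0]
      refine ENNReal.ofReal_le_ofReal ?_
      linarith [Real.add_one_le_exp (-(lam * v))]
    · refine le_add_right (ENNReal.ofReal_le_ofReal ?_)
      linarith [Real.add_one_le_exp (-(lam * v))]
  refine (Finset.prod_le_prod' fun i _ => hone i).trans ?_
  rw [Finset.prod_const, Finset.card_range, ← ENNReal.ofReal_pow (Real.exp_pos _).le,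
    ← Real.exp_nat_mul]
  exact ENNReal.ofReal_le_ofReal (by rw [mul_neg])

/-- The points of `(1 / n) ℤ ^ d` in a cube. -/
noncomputable def grid (d N n : ℕ) : Finset (E d) :=
  (Fintype.piFinset fun _ : Fin d => Finset.Icc (-(N * n : ℤ)) (N * n)).image
    fun i => WithLp.toLp 2 fun j => (i j : ℝ) / n

theorem card_grid_le (N : ℕ) {n : ℕ} (hn : 1 ≤ n) :
    ((grid d N n).card : ℝ) ≤ ((2 * N + 1) * n) ^ d := by
  refine (Nat.cast_le.2 Finset.card_image_le).trans ?_
  rw [Fintype.card_piFinset, Finset.prod_const, Finset.card_univ, Fintype.card_fin, Int.card_Icc,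
    Nat.cast_pow]
  refine pow_le_pow_left₀ (Nat.cast_nonneg _) ?_ d
  have h1 : ((N * n : ℤ) + 1 - -(N * n : ℤ)).toNat = 2 * N * n + 1 := by
    have : ((N * n : ℤ) + 1 - -(N * n : ℤ)) = ((2 * N * n + 1 : ℕ) : ℤ) := by push_cast; ring
    rw [this, Int.toNat_natCast]
  rw [h1]
  push_cast
  have : (1 : ℝ) ≤ n := by exact_mod_cast hn
  linarith

theorem exists_mem_grid {N n : ℕ} (hn : 1 ≤ n) {x : E d} (hx : ‖x‖ ≤ N) :
    ∃ x' ∈ grid d N n, ‖x - x'‖ ≤ d / n := by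
  have hn0 : (0 : ℝ) < n := by exact_mod_cast hn
  refine ⟨WithLp.toLp 2 fun j => (⌊x j * n⌋ : ℝ) / n, Finset.mem_image.2
    ⟨fun j => ⌊x j * n⌋, ?_, rfl⟩, ?_⟩
  · rw [Fintype.mem_piFinset]
    intro j
    have h1 : |x j| ≤ N := (PiLp.norm_apply_le x j).trans hx
    have h2 := abs_le.1 h1
    rw [Finset.mem_Icc]
    constructor
    · rw [Int.le_floor]
      push_cast
      have := mul_le_mul_of_nonneg_right h2.1 hn0.le
      linarith
    · have := Int.floor_mono (mul_le_mul_of_nonneg_right h2.2 hn0.le)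
      refine this.trans (le_of_eq ?_)
      have e : ((N : ℝ) * n) = ((N * n : ℤ) : ℝ) := by push_cast; rfl
      rw [e, Int.floor_intCast]
  · refine (norm_le_sum_abs_repr (EuclideanSpace.basisFun (Fin d) ℝ) _).trans ?_
    have : ∀ j ∈ Finset.univ, |(EuclideanSpace.basisFun (Fin d) ℝ).repr
        (x - WithLp.toLp 2 fun j => (⌊x j * n⌋ : ℝ) / n) j| ≤ 1 / n := by
      intro j _
      have e : x j - (⌊x j * n⌋ : ℝ) / n = Int.fract (x j * n) / n := by
        rw [← Int.self_sub_floor]; field_simp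
      simp only [EuclideanSpace.basisFun_repr, PiLp.sub_apply]
      rw [e, abs_of_nonneg (div_nonneg (Int.fract_nonneg _) hn0.le)]
      exact div_le_div_of_nonneg_right (Int.fract_lt_one _).le hn0.le
    refine (Finset.sum_le_sum this).trans (le_of_eq ?_)
    rw [Finset.sum_const, Finset.card_univ, Fintype.card_fin, nsmul_eq_mul, mul_one_div]

end LevelSetEstimation

/-! ### No box of the critical volume stays empty. -/

namespace LevelSetEstimation

variable {d : ℕ} {Ω : Type*} [MeasurableSpace Ω] {P : Measure Ω} {X : ℕ → Ω → E d} {f : E d → ℝ}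

theorem pos_of_nontrivial (d : ℕ) [Nontrivial (E d)] : 0 < d := by
  rcases Nat.eq_zero_or_pos d with rfl | h
  · exact absurd (inferInstance : Subsingleton (E 0)) (not_subsingleton _)
  · exact h

theorem tendsto_log_div : Tendsto (fun n : ℕ => Real.log n / n) atTop (nhds 0) := by
  have := (Real.tendsto_pow_log_div_mul_add_atTop 1 0 1 one_ne_zero).comp
    tendsto_natCast_atTop_atTop
  simpa [Function.comp_def] using this

theorem tendsto_log_natCast : Tendsto (fun n : ℕ => Real.log n) atTop atTop :=
  Real.tendsto_log_atTop.comp tendsto_natCast_atTop_atTop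

/-- Every empty box contains an empty box of thickness `s / 4` with centre and normal on the grid of
mesh `1 / n`. The union bound runs over pairs of grid points, whose number is polynomial in `n`. -/
theorem IsSampleFrom.measure_exists_box_le [IsProbabilityMeasure P] [Nontrivial (E d)]
    (hX : IsSampleFrom P X f) {lam : ℝ} (hlam : 0 < lam) {N : ℕ} (hN1 : 1 ≤ N)
    (hN : ∀ x, lam ≤ f x → ‖x‖ ≤ N) {c : ℝ}
    (hc : ∀ x η : E d, ‖η‖ ≤ 2 → ∀ s, 0 < s → s ≤ 1 →
      ENNReal.ofReal (c * √s ^ (d + 1)) ≤ volume (box x η s)) {n : ℕ} (hn : 1 ≤ n) {s : ℝ}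
    (hs : 0 < s) (hs1 : s ≤ 1) (hdn : d / n ≤ s / 4) :
    P {ω | ∃ x η : E d, ‖η‖ = 1 ∧ box x η s ⊆ {z | lam ≤ f z} ∧ ∀ i < n, X i ω ∉ box x η s} ≤
      ENNReal.ofReal (((2 * N + 1) * n) ^ (2 * d) *
        Real.exp (-(n * (lam * (c * √(s / 4) ^ (d + 1)))))) := by
  classical
  set G := ((grid d N n) ×ˢ (grid d N n)).filter fun q =>
    ‖q.2‖ ≤ 2 ∧ box q.1 q.2 (s / 4) ⊆ {z | lam ≤ f z} with hG
  have hsub : {ω | ∃ x η : E d, ‖η‖ = 1 ∧ box x η s ⊆ {z | lam ≤ f z} ∧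
      ∀ i < n, X i ω ∉ box x η s} ⊆
      ⋃ q ∈ G, {ω | ∀ i < n, X i ω ∉ box q.1 q.2 (s / 4)} := by
    rintro ω ⟨x, η, hη, hbox, hω⟩
    have hxb : x ∈ box x η s := by
      simp only [box, Set.mem_ofPred_eq, sub_self, inner_zero_left, abs_zero, norm_zero]
      exact ⟨hs.le, Real.sqrt_nonneg s⟩
    obtain ⟨x', hx', hxx'⟩ := exists_mem_grid hn (hN x (hbox hxb))
    obtain ⟨η', hη', hηη'⟩ := exists_mem_grid (N := N) hn (x := η) (by
      rw [hη]; exact_mod_cast hN1)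
    have hsq1 : √s ≤ 1 := Real.sqrt_le_one.2 hs1
    have hsq : √s * √s = s := Real.mul_self_sqrt hs.le
    have hsqs : s ≤ √s := by
      have := mul_le_mul_of_nonneg_left hsq1 (Real.sqrt_nonneg s)
      linarith
    have hss := box_subset_box (x := x) (x' := x') (η := η) (η' := η') hs hs1 hη
      (hxx'.trans hdn) (by linarith)
    refine Set.mem_iUnion₂.2 ⟨(x', η'), ?_, fun i hi h => hω i hi (hss h)⟩
    rw [hG, Finset.mem_filter, Finset.mem_product]
    refine ⟨⟨hx', hη'⟩, ?_, hss.trans hbox⟩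
    have := norm_sub_norm_le η' η
    rw [norm_sub_rev, hη] at this
    change ‖η'‖ ≤ 2
    linarith
  refine (measure_mono hsub).trans ((measure_biUnion_finset_le G _).trans ?_)
  have hone : ∀ q ∈ G, P {ω | ∀ i < n, X i ω ∉ box q.1 q.2 (s / 4)} ≤
      ENNReal.ofReal (Real.exp (-(n * (lam * (c * √(s / 4) ^ (d + 1)))))) := by
    intro q hq
    obtain ⟨-, hq2, hqf⟩ := Finset.mem_filter.1 hq
    exact hX.measure_forall_notMem_le (isClosed_box _ _ _).measurableSet hlam.le hqf
      (hc _ _ hq2 _ (by positivity) (by linarith)) n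
  refine (Finset.sum_le_sum hone).trans ?_
  rw [Finset.sum_const, nsmul_eq_mul, ENNReal.ofReal_mul (by positivity)]
  gcongr
  rw [← ENNReal.ofReal_natCast]
  refine ENNReal.ofReal_le_ofReal ?_
  have h1 : (G.card : ℝ) ≤ (grid d N n).card * (grid d N n).card := by
    exact_mod_cast (Finset.card_filter_le _ _).trans (Finset.card_product _ _).le
  have h2 := card_grid_le (d := d) N hn
  refine h1.trans ((mul_le_mul h2 h2 (by positivity) (by positivity)).trans (le_of_eq ?_))
  rw [two_mul d, pow_add]

/-- Almost surely, eventually every box of volume of order `log n / n` inside a region where the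
density is bounded below contains a sample point. -/
theorem IsSampleFrom.eventually_exists_mem_box [IsProbabilityMeasure P] [Nontrivial (E d)]
    (hX : IsSampleFrom P X f) {lam : ℝ} (hlam : 0 < lam)
    (hb : Bornology.IsBounded (levelSet f lam)) :
    ∃ C > 0, ∀ᵐ ω ∂P, ∀ᶠ n : ℕ in atTop, ∀ x η : E d, ‖η‖ = 1 →
      box x η (C * (Real.log n / n) ^ ((2 : ℝ) / (d + 1))) ⊆ {z | lam ≤ f z} →
      ∃ i < n, X i ω ∈ box x η (C * (Real.log n / n) ^ ((2 : ℝ) / (d + 1))) := by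
  obtain ⟨c, hc, hvol⟩ := exists_le_volume_box (d := d)
  obtain ⟨R, hR⟩ := hb.exists_norm_le
  obtain ⟨N, hN⟩ := exists_nat_ge (max R 1)
  have hN1 : 1 ≤ N := by exact_mod_cast (le_max_right R 1).trans hN
  have hNf : ∀ x, lam ≤ f x → ‖x‖ ≤ N := fun x hx =>
    (hR x hx).trans ((le_max_left R 1).trans hN)
  have hd : 0 < d := pos_of_nontrivial d
  -- Makes the failure probability of one box `n ^ (-(2 d + 2))`; against order `n ^ (2 d)` grid
  -- pairs this leaves the summable `n ^ (-2)`.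
  set D : ℝ := 2 ^ (d + 1) * (2 * d + 2) / (lam * c) with hD
  have hD0 : 0 < D := by positivity
  -- The exponent for which `s = (D log n / n) ^ a` gives `√s ^ (d + 1) = D log n / n`.
  set a : ℝ := 2 / (d + 1) with ha
  have hd1 : (1 : ℝ) ≤ d := by exact_mod_cast hd
  have ha0 : 0 < a := by positivity
  have ha1 : a ≤ 1 := by rw [ha, div_le_one (by positivity)]; linarith
  refine ⟨D ^ a, by positivity, ?_⟩
  have key : ∀ᵐ ω ∂P, ∀ᶠ n : ℕ in atTop, ¬ ∃ x η : E d, ‖η‖ = 1 ∧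
      box x η (D ^ a * (Real.log n / n) ^ a) ⊆ {z | lam ≤ f z} ∧
      ∀ i < n, X i ω ∉ box x η (D ^ a * (Real.log n / n) ^ a) := by
    refine ae_eventually_of_measure_le (C := (2 * N + 1) ^ (2 * d)) ?_
    have h1 : ∀ᶠ n : ℕ in atTop, D * (Real.log n / n) < 1 := by
      have := (tendsto_log_div.const_mul D)
      rw [mul_zero] at this
      exact this.eventually_lt_const one_pos
    filter_upwards [h1, eventually_ge_atTop 2,
      tendsto_log_natCast.eventually_ge_atTop (4 * d / D)] with n hn1 hn2 hn3
    simp only [not_not]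
    have hn0 : (0 : ℝ) < n := by positivity
    have hlog : 0 < Real.log n := Real.log_pos (by exact_mod_cast hn2)
    have hr0 : 0 < D * (Real.log n / n) := by positivity
    rw [← Real.mul_rpow hD0.le (by positivity)]
    set s := (D * (Real.log n / n)) ^ a with hs
    have hs0 : 0 < s := Real.rpow_pos_of_pos hr0 a
    have hs1 : s ≤ 1 := Real.rpow_le_one hr0.le hn1.le ha0.le
    have hsr : D * (Real.log n / n) ≤ s := by
      have := Real.rpow_le_rpow_of_exponent_ge hr0 hn1.le ha1
      rwa [Real.rpow_one] at this
    have hdn : d / n ≤ s / 4 := by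
      rw [div_le_iff₀ hD0] at hn3
      have : 4 * (d : ℝ) / n ≤ D * (Real.log n / n) := by
        rw [mul_div_assoc']
        exact div_le_div_of_nonneg_right (by linarith) hn0.le
      rw [mul_div_assoc] at this
      linarith
    refine (hX.measure_exists_box_le hlam hN1 hNf hvol (by omega) hs0 hs1 hdn).trans
      (ENNReal.ofReal_le_ofReal ?_)
    have hpow : √(s / 4) ^ (d + 1) = D * (Real.log n / n) / 2 ^ (d + 1) := by
      rw [Real.sqrt_div hs0.le, show (4 : ℝ) = 2 ^ 2 by norm_num, Real.sqrt_sq (by norm_num),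
        div_pow, Real.sqrt_eq_rpow, hs, ← Real.rpow_natCast, ← Real.rpow_mul hr0.le,
        ← Real.rpow_mul hr0.le]
      have : a * (1 / 2) * ((d + 1 : ℕ) : ℝ) = 1 := by
        rw [ha]; push_cast; field_simp
      rw [this, Real.rpow_one]
    have hexp : n * (lam * (c * √(s / 4) ^ (d + 1))) = ((2 * d + 2 : ℕ) : ℝ) * Real.log n := by
      rw [hpow, hD]; push_cast; field_simp
    rw [hexp, Real.exp_neg, Real.exp_nat_mul, Real.exp_log hn0, mul_pow, mul_assoc]
    refine mul_le_mul_of_nonneg_left (le_of_eq ?_) (by positivity)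
    rw [pow_add]; field_simp
  filter_upwards [key] with ω hω
  filter_upwards [hω] with n hn x η hη hbox
  by_contra! hcon
  exact hn ⟨x, η, hη, hbox, hcon⟩

end LevelSetEstimation

/-! ### Exponential inequalities and conditioning on one observation. -/

namespace LevelSetEstimation

variable {d : ℕ} {Ω : Type*} [MeasurableSpace Ω] {P : Measure Ω} {X : ℕ → Ω → E d} {f : E d → ℝ}

/-- The moment generating function of a centred bounded random variable is at most
`exp (lam ^ 2 * v)` for small `lam`, where `v` bounds the second moment. -/
theorem mgf_sub_const_le [IsProbabilityMeasure P] {Y : Ω → ℝ} (hY : Measurable Y)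
    {κ v e lam : ℝ} (hκ : ∀ ω, |Y ω| ≤ κ) (he : ∫ ω, Y ω ∂P = e) (hv : ∫ ω, Y ω ^ 2 ∂P ≤ v)
    (hlam : 0 ≤ lam) (hlamκ : lam * (2 * κ) ≤ 1) :
    mgf (fun ω => Y ω - e) P lam ≤ Real.exp (lam ^ 2 * v) := by
  have hYi : Integrable Y P := Integrable.of_bound hY.aestronglyMeasurable κ (ae_of_all _ hκ)
  have hY2i : Integrable (fun ω => Y ω ^ 2) P :=
    Integrable.of_bound (hY.pow_const 2).aestronglyMeasurable (κ ^ 2) (ae_of_all _ fun ω => by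
      rw [Real.norm_eq_abs, abs_pow]
      exact pow_le_pow_left₀ (abs_nonneg _) (hκ ω) 2)
  have heκ : |e| ≤ κ := by
    rw [← he, ← Real.norm_eq_abs]
    refine (norm_integral_le_of_norm_le_const (ae_of_all P hκ)).trans ?_
    simp
  -- `exp x ≤ 1 + x + x²` for `|x| ≤ 1`; the linear term integrates to zero.
  have hexp : ∀ ω, Real.exp (lam * (Y ω - e)) ≤
      1 + lam * (Y ω - e) + lam ^ 2 * (Y ω ^ 2 - 2 * e * Y ω + e ^ 2) := by
    intro ω
    have h1 : |Y ω - e| ≤ 2 * κ := (abs_sub _ _).trans (by linarith [hκ ω])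
    have h2 : |lam * (Y ω - e)| ≤ 1 := by
      rw [abs_mul, abs_of_nonneg hlam]
      exact (mul_le_mul_of_nonneg_left h1 hlam).trans hlamκ
    have h3 := (abs_le.1 (Real.abs_exp_sub_one_sub_id_le h2)).2
    have h4 : (lam * (Y ω - e)) ^ 2 = lam ^ 2 * (Y ω ^ 2 - 2 * e * Y ω + e ^ 2) := by ring
    linarith
  have hi1 : Integrable (fun ω => lam * (Y ω - e)) P :=
    (hYi.sub (integrable_const e)).const_mul lam
  have hi2 : Integrable (fun ω => lam ^ 2 * (Y ω ^ 2 - 2 * e * Y ω + e ^ 2)) P :=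
    ((hY2i.sub (hYi.const_mul (2 * e))).add (integrable_const (e ^ 2))).const_mul _
  have hi3 : Integrable (fun ω => 1 + lam * (Y ω - e)) P := (integrable_const 1).add hi1
  have hle : mgf (fun ω => Y ω - e) P lam ≤
      ∫ ω, (1 + lam * (Y ω - e) + lam ^ 2 * (Y ω ^ 2 - 2 * e * Y ω + e ^ 2)) ∂P :=
    integral_mono_of_nonneg (ae_of_all _ fun ω => (Real.exp_pos _).le) (hi3.add hi2)
      (ae_of_all _ hexp)
  have hi4 : Integrable (fun ω => Y ω ^ 2 - 2 * e * Y ω) P := hY2i.sub (hYi.const_mul (2 * e))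
  have hval : ∫ ω, (1 + lam * (Y ω - e) + lam ^ 2 * (Y ω ^ 2 - 2 * e * Y ω + e ^ 2)) ∂P =
      1 + lam ^ 2 * (∫ ω, Y ω ^ 2 ∂P - e ^ 2) := by
    rw [integral_add hi3 hi2, integral_add (integrable_const 1) hi1, integral_const_mul,
      integral_sub hYi (integrable_const e), integral_const_mul,
      integral_add hi4 (integrable_const (e ^ 2)),
      integral_sub hY2i (hYi.const_mul (2 * e)), integral_const_mul, he]
    simp only [integral_const, probReal_univ, one_smul]
    ring
  rw [hval] at hle
  have h1 : lam ^ 2 * (∫ ω, Y ω ^ 2 ∂P - e ^ 2) ≤ lam ^ 2 * v :=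
    mul_le_mul_of_nonneg_left (by linarith [sq_nonneg e]) (sq_nonneg _)
  linarith [Real.add_one_le_exp (lam ^ 2 * v)]

/-- Chernoff's bound with free parameter `lam`. Under `lam * (2 * κ) ≤ 1` the exponent involves the
second moment `v` instead of the range `κ`, which matters because `v` will be of order `h ^ d`. -/
theorem IsSampleFrom.measureReal_le_sum_le [IsProbabilityMeasure P] (hX : IsSampleFrom P X f)
    {ψ : E d → ℝ} (hψ : Measurable ψ) {κ v e lam : ℝ} (hκ : ∀ x, |ψ x| ≤ κ)
    (he : ∀ i, ∫ ω, ψ (X i ω) ∂P = e) (hv : ∀ i, ∫ ω, ψ (X i ω) ^ 2 ∂P ≤ v)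
    (hlam : 0 ≤ lam) (hlamκ : lam * (2 * κ) ≤ 1) (S : Finset ℕ) (s : ℝ) :
    P.real {ω | s ≤ ∑ j ∈ S, (ψ (X j ω) - e)} ≤
      Real.exp (-lam * s + S.card * (lam ^ 2 * v)) := by
  obtain ⟨hmeas, hind, -⟩ := hX
  set Y : ℕ → Ω → ℝ := fun j ω => ψ (X j ω) - e with hY
  have hYm : ∀ j, Measurable (Y j) := fun j => (hψ.comp (hmeas j)).sub_const e
  have hYind : iIndepFun Y P := hind.comp (fun _ x => ψ x - e) (fun _ => hψ.sub_const e)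
  have heκ : |e| ≤ κ := by
    rw [← he 0, ← Real.norm_eq_abs]
    refine (norm_integral_le_of_norm_le_const (ae_of_all P fun ω => hκ (X 0 ω))).trans ?_
    simp
  have hsum : (fun ω => ∑ j ∈ S, (ψ (X j ω) - e)) = ∑ j ∈ S, Y j := by
    ext ω; simp [hY]
  have hint : Integrable (fun ω => Real.exp (lam * (∑ j ∈ S, Y j) ω)) P := by
    refine Integrable.of_bound (C := Real.exp (lam * (S.card * (2 * κ)))) ?_ (ae_of_all _ ?_)
    · simp only [Finset.sum_apply]
      exact ((Finset.measurable_sum S fun j _ => hYm j).const_mul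
        lam).exp.aestronglyMeasurable
    · intro ω
      rw [Real.norm_of_nonneg (Real.exp_pos _).le]
      refine Real.exp_le_exp.2 (mul_le_mul_of_nonneg_left ?_ hlam)
      rw [Finset.sum_apply]
      refine (Finset.sum_le_card_nsmul S _ (2 * κ) fun j _ => ?_).trans (by rw [nsmul_eq_mul])
      have h1 := (abs_le.1 (hκ (X j ω))).2
      have h2 := (abs_le.1 heκ).1
      simp only [hY]; linarith
  have h1 := measure_ge_le_exp_mul_mgf s hlam hint
  have h2 : {ω | s ≤ ∑ j ∈ S, (ψ (X j ω) - e)} = {ω | s ≤ (∑ j ∈ S, Y j) ω} := by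
    rw [← hsum]
  rw [h2]
  refine h1.trans ?_
  rw [hYind.mgf_sum hYm, Real.exp_add]
  refine mul_le_mul_of_nonneg_left ?_ (Real.exp_pos _).le
  refine (Finset.prod_le_prod (fun j _ => mgf_nonneg) fun j _ =>
    mgf_sub_const_le (hψ.comp (hmeas j)) (fun ω => hκ (X j ω)) (he j) (hv j) hlam hlamκ).trans ?_
  rw [Finset.prod_const, ← Real.exp_nat_mul]

theorem IsSampleFrom.measure_le_abs_sum_le [IsProbabilityMeasure P] (hX : IsSampleFrom P X f)
    {ψ : E d → ℝ} (hψ : Measurable ψ) {κ v e lam : ℝ} (hκ : ∀ x, |ψ x| ≤ κ)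
    (he : ∀ i, ∫ ω, ψ (X i ω) ∂P = e) (hv : ∀ i, ∫ ω, ψ (X i ω) ^ 2 ∂P ≤ v)
    (hlam : 0 ≤ lam) (hlamκ : lam * (2 * κ) ≤ 1) (S : Finset ℕ) (s : ℝ) :
    P {ω | s ≤ |∑ j ∈ S, (ψ (X j ω) - e)|} ≤
      ENNReal.ofReal (2 * Real.exp (-lam * s + S.card * (lam ^ 2 * v))) := by
  have h1 := hX.measureReal_le_sum_le hψ hκ he hv hlam hlamκ S s
  have h2 := hX.measureReal_le_sum_le (ψ := fun x => -ψ x) (e := -e) (v := v) hψ.neg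
    (fun x => by rw [abs_neg]; exact hκ x) (fun i => by rw [integral_neg, he i])
    (fun i => by simpa using hv i) hlam hlamκ S s
  have hsub : {ω | s ≤ |∑ j ∈ S, (ψ (X j ω) - e)|} ⊆
      {ω | s ≤ ∑ j ∈ S, (ψ (X j ω) - e)} ∪ {ω | s ≤ ∑ j ∈ S, (-ψ (X j ω) - -e)} := by
    intro ω hω
    rcases le_abs.1 (show s ≤ |∑ j ∈ S, (ψ (X j ω) - e)| from hω) with h | h
    · exact Or.inl h
    · refine Or.inr ?_
      rw [← Finset.sum_neg_distrib] at h
      refine h.trans (le_of_eq (Finset.sum_congr rfl fun j _ => ?_))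
      ring
  rw [← ENNReal.ofReal_toReal (measure_ne_top P _)]
  refine ENNReal.ofReal_le_ofReal ?_
  have := (measureReal_mono (μ := P) hsub).trans (measureReal_union_le _ _)
  rw [two_mul]
  exact this.trans (add_le_add h1 h2)

/-- Conditioning on one observation: an event that involves `X i` and the other observations has
small probability if it does for every fixed value of `X i`. -/
theorem IsSampleFrom.measure_le_of_forall_section [IsProbabilityMeasure P]
    (hX : IsSampleFrom P X f) {i : ℕ} {S : Finset ℕ} (hi : i ∉ S) {A : Set (E d × (S → E d))}
    (hA : MeasurableSet A) {b : ENNReal}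
    (hb : ∀ x, P {ω | (x, fun j : S => X j ω) ∈ A} ≤ b) :
    P {ω | (X i ω, fun j : S => X j ω) ∈ A} ≤ b := by
  obtain ⟨hmeas, hind, -⟩ := hX
  have hW : Measurable fun ω => fun j : S => X j ω := measurable_pi_lambda _ fun j => hmeas j
  have h1 := hind.indepFun_finset {i} S (by simpa using hi) hmeas
  have h2 : IndepFun (X i) (fun ω => fun j : S => X j ω) P :=
    h1.comp (φ := fun g : ({i} : Finset ℕ) → E d => g ⟨i, Finset.mem_singleton_self i⟩)
      (ψ := id) (measurable_pi_apply _) measurable_id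
  have h3 := h2.map_prod_eq_prod_map_map (hmeas i).aemeasurable hW.aemeasurable
  have h4 : {ω | (X i ω, fun j : S => X j ω) ∈ A} =
      (fun ω => (X i ω, fun j : S => X j ω)) ⁻¹' A := rfl
  rw [h4, ← Measure.map_apply ((hmeas i).prodMk hW) hA, h3]
  have : IsProbabilityMeasure (P.map (X i)) := Measure.isProbabilityMeasure_map (hmeas i).aemeasurable
  have : IsProbabilityMeasure (P.map fun ω => fun j : S => X j ω) :=
    Measure.isProbabilityMeasure_map hW.aemeasurable
  rw [Measure.prod_apply hA]
  calc ∫⁻ x, P.map (fun ω => fun j : S => X j ω) (Prod.mk x ⁻¹' A) ∂(P.map (X i))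
      ≤ ∫⁻ _, b ∂(P.map (X i)) := lintegral_mono fun x => by
        rw [Measure.map_apply hW (measurable_prodMk_left hA)]
        exact hb x
    _ = b := by simp

/-- The expectation of the kernel density estimator at a fixed point. -/
noncomputable def kdeMean (K f : E d → ℝ) (h : ℝ) (x : E d) : ℝ := ∫ z, K z * f (x - h • z)

theorem integral_comp_smul_sub (g : E d → ℝ) {h : ℝ} (hh : 0 < h) (x : E d) (f : E d → ℝ) :
    ∫ y, g (h⁻¹ • (x - y)) * f y = h ^ d * ∫ z, g z * f (x - h • z) := by
  have h1 : ∫ y, g (h⁻¹ • (x - y)) * f y = ∫ y, g (h⁻¹ • y) * f (x - y) := by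
    rw [← integral_sub_left_eq_self (fun y => g (h⁻¹ • y) * f (x - y)) volume x]
    simp only [sub_sub_cancel]
  have h2 := Measure.integral_comp_smul (volume : Measure (E d))
    (fun z => g z * f (x - h • z)) h⁻¹
  simp only [smul_smul, mul_inv_cancel₀ hh.ne', one_smul] at h2
  rw [h1, h2]
  simp [abs_of_pos (pow_pos hh d)]

theorem IsSampleFrom.integral_comp (hX : IsSampleFrom P X f)
    (hf : Measurable f) (hf0 : ∀ x, 0 ≤ f x) {g : E d → ℝ} (hg : Measurable g) (i : ℕ) :
    ∫ ω, g (X i ω) ∂P = ∫ y, g y * f y := by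
  obtain ⟨hmeas, -, hlaw⟩ := hX
  rw [← integral_map (hmeas i).aemeasurable hg.aestronglyMeasurable, hlaw i,
    integral_withDensity_eq_integral_toReal_smul hf.ennreal_ofReal
      (ae_of_all _ fun x => ENNReal.ofReal_lt_top)]
  refine integral_congr_ae (ae_of_all _ fun y => ?_)
  simp only [ENNReal.toReal_ofReal (hf0 y), smul_eq_mul, mul_comm]

end LevelSetEstimation

/-! ### Stochastic error of the density estimator at the sample points. -/

namespace LevelSetEstimation

variable {d : ℕ} {Ω : Type*} [MeasurableSpace Ω] {P : Measure Ω} {X : ℕ → Ω → E d} {f : E d → ℝ}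

theorem log_div_pos {n : ℕ} (hn : 2 ≤ n) : 0 < Real.log n / n := by
  have : 0 < Real.log n := Real.log_pos (by exact_mod_cast hn)
  positivity

theorem kdeRate_pos (d p : ℕ) {n : ℕ} (hn : 2 ≤ n) : 0 < kdeRate d p n :=
  Real.rpow_pos_of_pos (log_div_pos hn) _

theorem tendsto_kdeRate (d : ℕ) {p : ℕ} (hp : 1 ≤ p) :
    Tendsto (kdeRate d p) atTop (nhds 0) := by
  have ha : 0 < (p : ℝ) / (d + 2 * p) := by
    have : (1 : ℝ) ≤ p := by exact_mod_cast hp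
    positivity
  have := tendsto_log_div.rpow_const (p := (p : ℝ) / (d + 2 * p)) (Or.inr ha.le)
  rwa [Real.zero_rpow ha.ne'] at this

/-- The two sides of the trade-off that determines the order of the bandwidth. -/
theorem AssumptionK.bandwidth {p : ℕ} (hp : 1 ≤ p) {K : E d → ℝ} {h : ℕ → ℝ}
    (hK : AssumptionK p K h) :
    ∃ a > 0, ∃ C > 0, ∀ᶠ n in atTop, 0 < h n ∧
      a * Real.log n ≤ n * h n ^ d * kdeRate d p n ^ 2 ∧ h n ^ p ≤ C * kdeRate d p n := by
  obtain ⟨-, -, -, -, hpos, hθ⟩ := hK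
  obtain ⟨C, hC, hO⟩ := hθ.1.exists_pos
  obtain ⟨c, hc, hO'⟩ := hθ.2.exists_pos
  have hp1 : (1 : ℝ) ≤ p := by exact_mod_cast hp
  have hD : 0 < (d : ℝ) + 2 * p := by positivity
  refine ⟨(1 / c) ^ d, by positivity, C ^ p, by positivity, ?_⟩
  filter_upwards [hpos, hO.bound, hO'.bound, eventually_ge_atTop 2] with n hn h1 h2 hn2
  have hr : 0 < Real.log n / n := log_div_pos hn2
  have hn0 : (0 : ℝ) < n := by positivity
  set r := Real.log n / n with hrdef
  -- The rate is `b ^ p`, and `b ^ d * (b ^ p) ^ 2 = log n / n`: at this order of the bandwidth,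
  -- bias and deviation balance.
  set b := r ^ (1 / ((d : ℝ) + 2 * p)) with hb
  have hb0 : 0 < b := Real.rpow_pos_of_pos hr _
  rw [Real.norm_of_nonneg hn.le, Real.norm_of_nonneg hb0.le] at h1 h2
  have hrate : kdeRate d p n = b ^ p := by
    rw [kdeRate, hb, ← Real.rpow_natCast, ← Real.rpow_mul hr.le, one_div_mul_eq_div]
  have hbr : b ^ d * (b ^ p) ^ 2 = r := by
    rw [← pow_mul, ← pow_add, hb, ← Real.rpow_natCast, ← Real.rpow_mul hr.le]
    have : 1 / ((d : ℝ) + 2 * p) * ((d + p * 2 : ℕ) : ℝ) = 1 := by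
      push_cast; field_simp
    rw [this, Real.rpow_one]
  refine ⟨hn, ?_, ?_⟩
  · have h3 : 1 / c * b ≤ h n := by
      rw [one_div, inv_mul_le_iff₀ hc]; exact h2
    have h4 := pow_le_pow_left₀ (by positivity) h3 d
    rw [mul_pow] at h4
    have h5 := mul_le_mul_of_nonneg_right h4 (by positivity : 0 ≤ n * (b ^ p) ^ 2)
    have h6 : Real.log n = n * r := by rw [hrdef]; field_simp
    rw [hrate, h6]
    nth_rewrite 1 [← hbr]
    linarith
  · rw [hrate, ← mul_pow]
    exact pow_le_pow_left₀ hn.le h1 p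

theorem AssumptionK.tendsto_bandwidth {p : ℕ} (hp : 1 ≤ p) {K : E d → ℝ} {h : ℕ → ℝ}
    (hK : AssumptionK p K h) : Tendsto h atTop (nhds 0) := by
  obtain ⟨-, -, -, -, -, hθ⟩ := hK
  have hp1 : (1 : ℝ) ≤ p := by exact_mod_cast hp
  have ha : 0 < 1 / ((d : ℝ) + 2 * p) := by positivity
  refine hθ.1.trans_tendsto ?_
  have := tendsto_log_div.rpow_const (p := 1 / ((d : ℝ) + 2 * p)) (Or.inr ha.le)
  rwa [Real.zero_rpow ha.ne'] at this

theorem abs_kdeMean_le {K : E d → ℝ} {F : ℝ} (hK : Integrable K) (hF : ∀ x, |f x| ≤ F) (h : ℝ)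
    (x : E d) : |kdeMean K f h x| ≤ F * ∫ z, |K z| := by
  rw [kdeMean, ← Real.norm_eq_abs, ← integral_const_mul]
  refine norm_integral_le_of_norm_le (hK.abs.const_mul F) (ae_of_all _ fun z => ?_)
  rw [norm_mul, Real.norm_eq_abs, Real.norm_eq_abs, mul_comm]
  exact mul_le_mul_of_nonneg_right (hF _) (abs_nonneg _)

theorem measurable_kdeMean {K : E d → ℝ} (hK : Measurable K) (hf : Measurable f) (h : ℝ) :
    Measurable (kdeMean K f h) := by
  have : StronglyMeasurable (fun q : E d × E d => K q.2 * f (q.1 - h • q.2)) := by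
    apply Measurable.stronglyMeasurable
    fun_prop
  exact this.integral_prod_right.measurable

/-- Conditionally on `X i` the evaluation point is fixed and the summands are independent and
centred; the substitution `y = x - h z` bounds their second moment by a multiple of `h ^ d`. -/
theorem IsSampleFrom.measure_le_abs_sum_kernel_le [IsProbabilityMeasure P]
    (hX : IsSampleFrom P X f) (hf : Measurable f) (hf0 : ∀ x, 0 ≤ f x) {F : ℝ}
    (hF : ∀ x, f x ≤ F) {K : E d → ℝ} (hKc : Continuous K) (hKs : HasCompactSupport K) {κ : ℝ}
    (hκ : ∀ x, |K x| ≤ κ) {h : ℝ} (hh : 0 < h) {lam : ℝ} (hlam : 0 ≤ lam)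
    (hlamκ : lam * (2 * κ) ≤ 1) {i : ℕ} {S : Finset ℕ} (hi : i ∉ S) (s : ℝ) :
    P {ω | s ≤ |∑ j ∈ S, (K (h⁻¹ • (X i ω - X j ω)) - h ^ d * kdeMean K f h (X i ω))|} ≤
      ENNReal.ofReal
        (2 * Real.exp (-lam * s + S.card * (lam ^ 2 * (h ^ d * (F * ∫ z, K z ^ 2))))) := by
  have hKm := hKc.measurable
  set A : Set (E d × (S → E d)) :=
    {q | s ≤ |∑ j : S, (K (h⁻¹ • (q.1 - q.2 j)) - h ^ d * kdeMean K f h q.1)|} with hA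
  have hmean := measurable_kdeMean hKm hf h
  have hAm : MeasurableSet A := by
    refine measurableSet_le measurable_const ?_
    refine (Finset.measurable_sum _ fun j _ => ?_).abs
    refine Measurable.sub (hKm.comp ?_) ((hmean.comp measurable_fst).const_mul _)
    have hj : Measurable fun q : E d × (S → E d) => q.2 j :=
      (measurable_pi_apply j).comp measurable_snd
    exact (measurable_fst.sub hj).const_smul h⁻¹
  have hset : {ω | s ≤ |∑ j ∈ S, (K (h⁻¹ • (X i ω - X j ω)) - h ^ d * kdeMean K f h (X i ω))|} =
      {ω | (X i ω, fun j : S => X j ω) ∈ A} := by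
    ext ω
    simp only [hA, Set.mem_ofPred_eq]
    rw [← Finset.sum_coe_sort S]
  rw [hset]
  refine hX.measure_le_of_forall_section hi hAm fun x => ?_
  have hψ : Measurable fun y => K (h⁻¹ • (x - y)) := by fun_prop
  have hset' : {ω | (x, fun j : S => X j ω) ∈ A} =
      {ω | s ≤ |∑ j ∈ S, (K (h⁻¹ • (x - X j ω)) - h ^ d * kdeMean K f h x)|} := by
    ext ω
    simp only [hA, Set.mem_ofPred_eq]
    rw [← Finset.sum_coe_sort S]
  rw [hset']
  refine hX.measure_le_abs_sum_le hψ (fun y => hκ _) (fun j => ?_) (fun j => ?_) hlam hlamκ S s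
  · rw [hX.integral_comp hf hf0 hψ, integral_comp_smul_sub K hh, kdeMean]
  · rw [hX.integral_comp (g := fun y => K (h⁻¹ • (x - y)) ^ 2) hf hf0 (hψ.pow_const 2),
      integral_comp_smul_sub (fun z => K z ^ 2) hh]
    refine mul_le_mul_of_nonneg_left ?_ (pow_pos hh d).le
    rw [← integral_const_mul]
    have hK2s : HasCompactSupport fun z => K z ^ 2 :=
      hKs.comp_left (g := fun y : ℝ => y ^ 2) (by norm_num)
    have hK2 : Integrable fun z => K z ^ 2 :=
      Continuous.integrable_of_hasCompactSupport (hKc.pow 2) hK2s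
    refine integral_mono_of_nonneg (ae_of_all _ fun z => mul_nonneg (sq_nonneg _) (hf0 _))
      (hK2.const_mul F) (ae_of_all _ fun z => ?_)
    exact (mul_comm _ _).le.trans (mul_le_mul_of_nonneg_right (hF _) (sq_nonneg _))

/-- At a sample point the sum contains its own term `K 0`, which is not centred. Once it is split
off, `n - 1` centred terms and the corrections `K 0 / (n h ^ d)` and `kdeMean / n` remain; the
corrections are of order at most `kdeRate`. -/
theorem kde_sub_kdeMean {K : E d → ℝ} {h : ℝ} (hh : 0 < h) {n i : ℕ} (hi : i < n)
    (x : ℕ → E d) :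
    kde K h n x (x i) - kdeMean K f h (x i) = 1 / (n * h ^ d) *
      (K 0 + ∑ j ∈ (Finset.range n).erase i,
        (K (h⁻¹ • (x i - x j)) - h ^ d * kdeMean K f h (x i))) - kdeMean K f h (x i) / n := by
  have hn : (n : ℝ) ≠ 0 := by
    have : 0 < n := by omega
    positivity
  have hhd : h ^ d ≠ 0 := (pow_pos hh d).ne'
  rw [kde, ← Finset.add_sum_erase _ _ (Finset.mem_range.2 hi), sub_self, smul_zero,
    Finset.sum_sub_distrib, Finset.sum_const, Finset.card_erase_of_mem (Finset.mem_range.2 hi),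
    Finset.card_range, nsmul_eq_mul, Nat.cast_sub (by omega : 1 ≤ n), Nat.cast_one]
  field_simp
  ring

/-- Almost surely, eventually the kernel density estimator is close to its mean at all sample
points. -/
theorem IsSampleFrom.eventually_abs_kde_sub_kdeMean_le [IsProbabilityMeasure P]
    (hX : IsSampleFrom P X f) (hf : Measurable f) (hf0 : ∀ x, 0 ≤ f x) {F : ℝ}
    (hF : ∀ x, f x ≤ F) {p : ℕ} (hp : 1 ≤ p) {K : E d → ℝ} {h : ℕ → ℝ}
    (hK : AssumptionK p K h) :
    ∃ c > 0, ∀ᵐ ω ∂P, ∀ᶠ n in atTop, ∀ i < n,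
      |kde K (h n) n (fun i => X i ω) (X i ω) - kdeMean K f (h n) (X i ω)| ≤
        c * kdeRate d p n := by
  have hKc := hK.1
  have hKs := hK.2.1
  obtain ⟨a, ha, C, hC, hbw⟩ := hK.bandwidth hp
  obtain ⟨κ₀, hκ₀⟩ := hKc.bounded_above_of_compact_support hKs
  set κ := max κ₀ 1 with hκdef
  have hκ : ∀ x, |K x| ≤ κ := fun x => (hκ₀ x).trans (le_max_left _ _)
  have hκ0 : 0 < κ := lt_of_lt_of_le one_pos (le_max_right _ _)
  have hF0 : 0 ≤ F := (hf0 0).trans (hF 0)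
  set v := F * ∫ z, K z ^ 2 with hv
  have hv0 : 0 ≤ v := mul_nonneg hF0 (integral_nonneg fun z => sq_nonneg _)
  set m := F * ∫ z, |K z| with hm
  have hm0 : 0 ≤ m := mul_nonneg hF0 (integral_nonneg fun z => abs_nonneg _)
  -- With `lam = kdeRate` the exponent is at most `-(c - v) n h ^ d kdeRate² ≤ -3 log n`. Only the
  -- `n` sample points matter, so the union bound costs one power of `n` and leaves `n ^ (-2)`.
  set c := v + 3 / a with hc
  have hc0 : 0 < c := by positivity
  have hrate := tendsto_kdeRate d hp
  have key : ∀ᵐ ω ∂P, ∀ᶠ n in atTop, ∀ i < n,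
      ¬ (c * (n * h n ^ d * kdeRate d p n) ≤ |∑ j ∈ (Finset.range n).erase i,
        (K ((h n)⁻¹ • (X i ω - X j ω)) - h n ^ d * kdeMean K f (h n) (X i ω))|) := by
    refine ae_eventually_of_measure_le (C := 2) ?_
    filter_upwards [hbw, eventually_ge_atTop 2,
      hrate.eventually_lt_const (show 0 < 1 / (2 * κ) by positivity)] with n hn hn2 hr
    obtain ⟨hh, hal, -⟩ := hn
    have hn0 : (0 : ℝ) < n := by positivity
    have hρ := kdeRate_pos d p hn2
    set ρ := kdeRate d p n with hρdef
    have hlamκ : ρ * (2 * κ) ≤ 1 := by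
      rw [lt_div_iff₀ (by positivity)] at hr; exact hr.le
    have hsub : {ω | ¬ ∀ i < n, ¬ (c * (n * h n ^ d * ρ) ≤ |∑ j ∈ (Finset.range n).erase i,
        (K ((h n)⁻¹ • (X i ω - X j ω)) - h n ^ d * kdeMean K f (h n) (X i ω))|)} ⊆
        ⋃ i ∈ Finset.range n, {ω | c * (n * h n ^ d * ρ) ≤ |∑ j ∈ (Finset.range n).erase i,
        (K ((h n)⁻¹ • (X i ω - X j ω)) - h n ^ d * kdeMean K f (h n) (X i ω))|} := by
      intro ω hω
      simp only [Set.mem_ofPred_eq, not_forall, not_not] at hω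
      obtain ⟨i, hi, hω⟩ := hω
      exact Set.mem_iUnion₂.2 ⟨i, Finset.mem_range.2 hi, hω⟩
    refine (measure_mono hsub).trans ((measure_biUnion_finset_le _ _).trans ?_)
    have hone : ∀ i ∈ Finset.range n, P {ω | c * (n * h n ^ d * ρ) ≤
        |∑ j ∈ (Finset.range n).erase i,
        (K ((h n)⁻¹ • (X i ω - X j ω)) - h n ^ d * kdeMean K f (h n) (X i ω))|} ≤
        ENNReal.ofReal (2 * (1 / (n : ℝ) ^ 3)) := by
      intro i hi
      refine (hX.measure_le_abs_sum_kernel_le hf hf0 hF hKc hKs hκ hh hρ.le hlamκ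
        (Finset.notMem_erase i _) _).trans (ENNReal.ofReal_le_ofReal ?_)
      refine mul_le_mul_of_nonneg_left ?_ (by norm_num)
      have hcard : (((Finset.range n).erase i).card : ℝ) ≤ n := by
        exact_mod_cast (Finset.card_erase_le.trans (Finset.card_range n).le)
      have h1 : -ρ * (c * (n * h n ^ d * ρ)) +
          ((Finset.range n).erase i).card * (ρ ^ 2 * (h n ^ d * v)) ≤ -(3 * Real.log n) := by
        have h2 := mul_le_mul_of_nonneg_right hcard
          (by positivity : 0 ≤ ρ ^ 2 * (h n ^ d * v))
        have h3 := mul_le_mul_of_nonneg_left hal (by positivity : 0 ≤ 3 / a)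
        have h4 : 3 / a * (a * Real.log n) = 3 * Real.log n := by field_simp
        have h5 : -ρ * (c * (n * h n ^ d * ρ)) + n * (ρ ^ 2 * (h n ^ d * v)) =
            -(3 / a * (n * h n ^ d * ρ ^ 2)) := by rw [hc]; ring
        linarith
      refine (Real.exp_le_exp.2 h1).trans (le_of_eq ?_)
      rw [Real.exp_neg, show (3 : ℝ) = ((3 : ℕ) : ℝ) by norm_num, Real.exp_nat_mul,
        Real.exp_log hn0, one_div]
    refine (Finset.sum_le_sum hone).trans ?_
    rw [Finset.sum_const, Finset.card_range, nsmul_eq_mul, ← ENNReal.ofReal_natCast,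
      ← ENNReal.ofReal_mul hn0.le]
    refine ENNReal.ofReal_le_ofReal (le_of_eq ?_)
    field_simp
  refine ⟨κ + c + m, by positivity, ?_⟩
  have hd0 : (0 : ℝ) ≤ d := Nat.cast_nonneg d
  have hp1 : (1 : ℝ) ≤ p := by exact_mod_cast hp
  filter_upwards [key] with ω hω
  filter_upwards [hω, hbw, eventually_ge_atTop 2, hrate.eventually_lt_const one_pos,
    tendsto_log_div.eventually_lt_const one_pos,
    tendsto_log_natCast.eventually_ge_atTop (max 1 (1 / a))] with n hn hbn hn2 hr1 hlr1 hlog i hi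
  obtain ⟨hh, hal, -⟩ := hbn
  have hn0 : (0 : ℝ) < n := by positivity
  have hρ := kdeRate_pos d p hn2
  set ρ := kdeRate d p n with hρdef
  have hq : 0 < n * h n ^ d := by positivity
  have hlog1 : 1 ≤ Real.log n := (le_max_left _ _).trans hlog
  have h1 : 1 / (n * h n ^ d) ≤ ρ := by
    rw [div_le_iff₀ hq]
    have h2 : 1 ≤ a * Real.log n := by
      have := (le_max_right _ _).trans hlog
      rw [div_le_iff₀ ha] at this; linarith
    have h3 : n * h n ^ d * ρ ^ 2 ≤ ρ * (n * h n ^ d) := by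
      have : n * h n ^ d * ρ ^ 2 = (ρ * (n * h n ^ d)) * ρ := by ring
      rw [this]
      exact mul_le_of_le_one_right (by positivity) hr1.le
    linarith
  have h2 : 1 / (n : ℝ) ≤ ρ := by
    have hr : 0 < Real.log n / n := log_div_pos hn2
    have h3 : Real.log n / n ≤ ρ := by
      have := Real.rpow_le_rpow_of_exponent_ge hr hlr1.le
        (show (p : ℝ) / (d + 2 * p) ≤ 1 by rw [div_le_one (by positivity)]; linarith)
      rwa [Real.rpow_one] at this
    exact (div_le_div_of_nonneg_right hlog1 hn0.le).trans h3
  have h3 := (not_le.1 (hn i hi)).le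
  have h4 := abs_kdeMean_le (hKc.integrable_of_hasCompactSupport hKs) (F := F) (f := f)
    (fun x => by rw [abs_of_nonneg (hf0 x)]; exact hF x) (h n) (X i ω)
  rw [← hm] at h4
  rw [kde_sub_kdeMean hh hi (fun i => X i ω)]
  set T := ∑ j ∈ (Finset.range n).erase i,
        (K ((h n)⁻¹ • (X i ω - X j ω)) - h n ^ d * kdeMean K f (h n) (X i ω)) with hT
  set μ := kdeMean K f (h n) (X i ω)
  have h5 : |1 / (n * h n ^ d) * (K 0 + T)| ≤ κ * ρ + c * ρ := by
    rw [abs_mul, abs_of_pos (by positivity : 0 < 1 / (n * h n ^ d))]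
    have h6 : |K 0 + T| ≤ κ + c * (n * h n ^ d * ρ) :=
      (abs_add_le _ _).trans (add_le_add (hκ 0) h3)
    refine (mul_le_mul_of_nonneg_left h6 (by positivity)).trans ?_
    have h7 := mul_le_mul_of_nonneg_right h1 hκ0.le
    have h8 : 1 / (n * h n ^ d) * (κ + c * (n * h n ^ d * ρ)) =
        1 / (n * h n ^ d) * κ + c * ρ := by field_simp
    linarith
  have h6 : |μ / n| ≤ m * ρ := by
    rw [abs_div, abs_of_pos hn0, div_eq_mul_one_div]
    exact mul_le_mul h4 h2 (by positivity) hm0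
  refine (abs_sub _ _).trans ?_
  linarith

end LevelSetEstimation

/-! ### Bias of the density estimator. -/

namespace LevelSetEstimation

variable {d : ℕ} {f : E d → ℝ}

/-- `r` lists the factors of a monomial with repetition; the sizes of its fibres form the
multi-index. -/
theorem prod_comp_eq_prod_pow {j : ℕ} (r : Fin j → Fin d) (z : Fin d → ℝ) :
    ∏ k, z (r k) = ∏ i, z i ^ Fintype.card {k // r k = i} := by
  rw [← Fintype.prod_fiberwise' r z]
  simp

theorem sum_card_fiber {j : ℕ} (r : Fin j → Fin d) :
    ∑ i, Fintype.card {k // r k = i} = j := by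
  have := Fintype.sum_fiberwise' r (fun _ => 1)
  simpa using this

/-- A kernel of high order annihilates the homogeneous polynomials of low positive degree. -/
theorem IsKernelOfOrderAtLeast.integral_mul_multilinear {p : ℕ} {K : E d → ℝ}
    (hK : IsKernelOfOrderAtLeast p K) (hKc : Continuous K) (hKs : HasCompactSupport K) {j : ℕ}
    (hj : 0 < j) (hjp : j < p) (A : ContinuousMultilinearMap ℝ (fun _ : Fin j => E d) ℝ) :
    ∫ z, K z * A (fun _ => z) = 0 := by
  classical
  have hA : ∀ z : E d, A (fun _ => z) = ∑ r : Fin j → Fin d,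
      (∏ i, z i ^ Fintype.card {k // r k = i}) *
        A (fun k => EuclideanSpace.single (r k) 1) := by
    intro z
    have hz : z = ∑ i, z i • EuclideanSpace.single i (1 : ℝ) := by
      have := (EuclideanSpace.basisFun (Fin d) ℝ).sum_repr z
      simpa using this.symm
    conv_lhs => rw [hz]
    rw [A.map_sum]
    refine Finset.sum_congr rfl fun r _ => ?_
    rw [A.map_smul_univ (fun k => z (r k)), smul_eq_mul, prod_comp_eq_prod_pow r]
  have hint : ∀ r : Fin j → Fin d, Integrable fun z : E d =>
      (∏ i, z i ^ Fintype.card {k // r k = i}) * K z := fun r => by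
    have hc : Continuous fun z : E d => ∏ i, z i ^ Fintype.card {k // r k = i} := by fun_prop
    exact (hc.mul hKc).integrable_of_hasCompactSupport hKs.mul_left
  have hfun : (fun z => K z * A (fun _ => z)) = fun z => ∑ r : Fin j → Fin d,
      ((∏ i, z i ^ Fintype.card {k // r k = i}) * K z) *
        A (fun k => EuclideanSpace.single (r k) 1) := by
    ext z
    rw [hA, Finset.mul_sum]
    exact Finset.sum_congr rfl fun r _ => by ring
  rw [hfun, integral_finsetSum _ fun r _ => (hint r).mul_const _]
  refine Finset.sum_eq_zero fun r _ => ?_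
  rw [integral_mul_const, hK.2 (fun i => Fintype.card {k // r k = i})
    (by rw [sum_card_fiber]; exact hj) (by rw [sum_card_fiber]; exact hjp), zero_mul]

theorem integrable_kernel_mul {K : E d → ℝ} (hKi : Integrable K) (hf : Measurable f) {F : ℝ}
    (hF : ∀ x, |f x| ≤ F) (h : ℝ) (x : E d) : Integrable fun z => K z * f (x - h • z) := by
  refine hKi.mul_bdd (c := F) ?_ (ae_of_all _ fun z => hF _)
  have : Measurable fun z : E d => f (x - h • z) := by fun_prop
  exact this.aestronglyMeasurable

/-- Taylor's inequality. -/
theorem abs_sub_taylor_le {n : ℕ} {x y : E d} {C : ℝ}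
    (hf : ∀ t ∈ Set.Icc (0 : ℝ) 1, ContDiffAt ℝ (n + 1) f (x + t • y))
    (hC : ∀ t ∈ Set.Icc (0 : ℝ) 1, ‖iteratedFDeriv ℝ (n + 1) f (x + t • y)‖ ≤ C) :
    |f (x + y) - ∑ k ∈ Finset.range (n + 1),
      (k.factorial : ℝ)⁻¹ * iteratedFDeriv ℝ k f x (fun _ => y)| ≤ C * ‖y‖ ^ (n + 1) := by
  rw [map_add_eq_sum_add_integral_iteratedFDeriv hf]
  simp only [smul_eq_mul, add_sub_cancel_left]
  have hC0 : 0 ≤ C := (norm_nonneg _).trans (hC 0 (by simp))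
  have h1 : ‖∫ t in (0 : ℝ)..1, (1 - t) ^ n * iteratedFDeriv ℝ (n + 1) f (x + t • y) fun _ => y‖ ≤
      C * ‖y‖ ^ (n + 1) * |1 - 0| := by
    refine intervalIntegral.norm_integral_le_of_norm_le_const fun t ht => ?_
    rw [Set.uIoc_of_le zero_le_one] at ht
    rw [norm_mul]
    have h2 : ‖(1 - t) ^ n‖ ≤ 1 := by
      rw [norm_pow, Real.norm_eq_abs, abs_of_nonneg (by linarith [ht.2])]
      exact pow_le_one₀ (by linarith [ht.2]) (by linarith [ht.1])
    have h3 : ‖iteratedFDeriv ℝ (n + 1) f (x + t • y) fun _ => y‖ ≤ C * ‖y‖ ^ (n + 1) := by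
      refine ((iteratedFDeriv ℝ (n + 1) f (x + t • y)).le_opNorm _).trans ?_
      rw [Finset.prod_const, Finset.card_univ, Fintype.card_fin]
      exact mul_le_mul_of_nonneg_right (hC t ⟨ht.1.le, ht.2⟩) (by positivity)
    calc _ ≤ 1 * (C * ‖y‖ ^ (n + 1)) := mul_le_mul h2 h3 (norm_nonneg _) zero_le_one
      _ = _ := one_mul _
  rw [sub_zero, abs_one, mul_one, Real.norm_eq_abs] at h1
  rw [abs_mul, abs_of_nonneg (by positivity : 0 ≤ ((n.factorial : ℝ))⁻¹)]
  have h2 : ((n.factorial : ℝ))⁻¹ ≤ 1 := inv_le_one_of_one_le₀ (by exact_mod_cast n.factorial_pos)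
  calc _ ≤ 1 * (C * ‖y‖ ^ (n + 1)) := mul_le_mul h2 h1 (abs_nonneg _) zero_le_one
    _ = _ := one_mul _

/-- The bias of the kernel density estimator is of order `h ^ p` where the density is `C ^ p`. -/
theorem exists_bias_le {p : ℕ} (hp : 1 ≤ p) {K : E d → ℝ} (hKc : Continuous K)
    (hKs : HasCompactSupport K) (hK : IsKernelOfOrderAtLeast p K) (hf : Measurable f) {F : ℝ}
    (hF : ∀ x, |f x| ≤ F) {Z U : Set (E d)} (hZ : IsCompact Z) (hU : IsOpen U) (hZU : Z ⊆ U)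
    (hfU : ContDiffOn ℝ p f U) :
    ∃ c > 0, ∃ ε > 0, ∀ h, 0 < h → h < ε → ∀ x ∈ Z, |kdeMean K f h x - f x| ≤ c * h ^ p := by
  obtain ⟨n, rfl⟩ : ∃ n, p = n + 1 := ⟨p - 1, by omega⟩
  obtain ⟨δ, hδ, hδU⟩ := hZ.exists_cthickening_subset_open hU hZU
  have hdiff : ∀ x ∈ U, ContDiffAt ℝ (n + 1) f x := fun x hx => by
    have := hfU.contDiffAt (hU.mem_nhds hx)
    exact_mod_cast this
  obtain ⟨C, hC⟩ := (hZ.cthickening (r := δ)).exists_bound_of_continuousOn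
    (f := iteratedFDeriv ℝ (n + 1) f) (fun x hx => by
      refine ContinuousAt.continuousWithinAt ?_
      exact ((hdiff x (hδU hx)).iteratedFDeriv_right (m := 0) (i := n + 1)
        (by push_cast; simp)).continuousAt)
  obtain ⟨R, hR⟩ := hKs.isCompact.isBounded.exists_norm_le
  set R' := max R 1 with hR'
  have hR'0 : 0 < R' := lt_of_lt_of_le one_pos (le_max_right _ _)
  have hKR : ∀ z, K z ≠ 0 → ‖z‖ ≤ R' := fun z hz =>
    (hR z (subset_tsupport K hz)).trans (le_max_left _ _)
  have hKi : Integrable K := hKc.integrable_of_hasCompactSupport hKs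
  set I := ∫ z, |K z| with hI
  have hI0 : 0 ≤ I := integral_nonneg fun z => abs_nonneg _
  refine ⟨|C| * R' ^ (n + 1) * I + 1, by positivity, δ / R', by positivity, ?_⟩
  intro h hh hhε x hx
  have hhR : h * R' ≤ δ := by rw [lt_div_iff₀ hR'0] at hhε; exact hhε.le
  -- The Taylor polynomial of degree `n = p - 1`: the moment conditions remove all of its terms but
  -- the constant `f x`, and the remainder is of order `h ^ p` on the support of `K`.
  set Q : E d → ℝ := fun z => ∑ k ∈ Finset.range (n + 1),
      (k.factorial : ℝ)⁻¹ * iteratedFDeriv ℝ k f x (fun _ => -(h • z)) with hQ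
  have hmem : ∀ z, K z ≠ 0 → ∀ t ∈ Set.Icc (0 : ℝ) 1,
      x + t • -(h • z) ∈ Metric.cthickening δ Z := by
    intro z hz t ht
    refine Metric.closedBall_subset_cthickening hx δ ?_
    rw [Metric.mem_closedBall, dist_eq_norm, add_sub_cancel_left, norm_smul, norm_neg, norm_smul,
      Real.norm_of_nonneg ht.1, Real.norm_of_nonneg hh.le]
    have h1 := mul_le_mul_of_nonneg_left (hKR z hz) hh.le
    have h2 : t * (h * ‖z‖) ≤ 1 * (h * ‖z‖) := mul_le_mul_of_nonneg_right ht.2 (by positivity)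
    linarith
  have hrem : ∀ z, |K z * f (x - h • z) - K z * Q z| ≤
      |C| * R' ^ (n + 1) * h ^ (n + 1) * |K z| := by
    intro z
    by_cases hz : K z = 0
    · simp [hz]
    have h1 := abs_sub_taylor_le (n := n) (x := x) (y := -(h • z)) (C := |C|) (f := f)
      (fun t ht => hdiff _ (hδU (hmem z hz t ht)))
      (fun t ht => (hC _ (hmem z hz t ht)).trans (le_abs_self C))
    rw [← sub_eq_add_neg, norm_neg, norm_smul, Real.norm_of_nonneg hh.le] at h1
    rw [← mul_sub, abs_mul, mul_comm]
    refine mul_le_mul_of_nonneg_right (h1.trans ?_) (abs_nonneg _)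
    rw [mul_assoc, ← mul_pow, mul_comm R']
    have := mul_le_mul_of_nonneg_left (hKR z hz) hh.le
    exact mul_le_mul_of_nonneg_left (pow_le_pow_left₀ (by positivity) this _) (abs_nonneg _)
  have hQi : ∀ k, Integrable fun z =>
      K z * ((k.factorial : ℝ)⁻¹ * iteratedFDeriv ℝ k f x (fun _ => -(h • z))) := by
    intro k
    have hc : Continuous fun z : E d =>
        (k.factorial : ℝ)⁻¹ * iteratedFDeriv ℝ k f x (fun _ => -(h • z)) := by
      refine continuous_const.mul ((iteratedFDeriv ℝ k f x).cont.comp ?_)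
      fun_prop
    exact (hKc.mul hc).integrable_of_hasCompactSupport hKs.mul_right
  have hKQ : ∀ z, K z * Q z = ∑ k ∈ Finset.range (n + 1),
      K z * ((k.factorial : ℝ)⁻¹ * iteratedFDeriv ℝ k f x (fun _ => -(h • z))) := fun z => by
    rw [hQ, Finset.mul_sum]
  have hKQi : Integrable fun z => K z * Q z := by
    simp only [hKQ]
    exact integrable_finsetSum _ fun k _ => hQi k
  have hQval : ∫ z, K z * Q z = f x := by
    simp only [hKQ]
    rw [integral_finsetSum _ fun k _ => hQi k, Finset.sum_eq_single 0]
    · simp [integral_mul_const, hK.1]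
    · intro k hk hk0
      have h1 : ∀ z : E d, K z * ((k.factorial : ℝ)⁻¹ *
          iteratedFDeriv ℝ k f x (fun _ => -(h • z))) =
          ((k.factorial : ℝ)⁻¹ * (-h) ^ k) * (K z * iteratedFDeriv ℝ k f x (fun _ => z)) := by
        intro z
        have : (iteratedFDeriv ℝ k f x fun _ => -(h • z)) =
            (-h) ^ k * iteratedFDeriv ℝ k f x fun _ => z := by
          have := (iteratedFDeriv ℝ k f x).map_smul_univ (fun _ => -h) (fun _ => z)
          simpa using this
        rw [this]; ring
      simp only [h1]
      rw [integral_const_mul, hK.integral_mul_multilinear hKc hKs (Nat.pos_of_ne_zero hk0)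
        (Finset.mem_range.1 hk), mul_zero]
    · intro h0; simp at h0
  rw [← hQval, kdeMean, ← integral_sub (integrable_kernel_mul hKi hf hF h x) hKQi,
    ← Real.norm_eq_abs]
  refine (norm_integral_le_of_norm_le (hKi.abs.const_mul
    (|C| * R' ^ (n + 1) * h ^ (n + 1))) (ae_of_all _ hrem)).trans ?_
  rw [integral_const_mul, ← hI]
  have : 0 < h ^ (n + 1) := by positivity
  linarith

variable {l u ζ m k L δ : ℝ} {Z : Set (E d)}

/-- As `f` may be irregular at `x`, the case split is at `y`: if `f y` were large, then either `y ∈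
Z`, where `f` is Lipschitz around `y`, or `y` is deep, and both make `f x` too large. -/
theorem SmoothZone.low_of_near (hz : SmoothZone f l u ζ m k L δ Z) {x y : E d}
    (hxy : ‖y - x‖ ≤ min δ (ζ / (4 * (|L| + k * δ)))) (hx : f x ≤ l - ζ / 2) :
    f y ≤ l - ζ / 4 := by
  have hM : 0 < |L| + k * δ := by have := hz.k_pos; have := hz.δ_pos; positivity
  have hζ := hz.ζ_pos
  have hlu := hz.le_u
  have h1 : ‖x - y‖ ≤ δ := by rw [norm_sub_rev]; exact hxy.trans (min_le_left _ _)
  have h2 : (|L| + k * δ) * ‖x - y‖ ≤ ζ / 4 := by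
    have := hxy.trans (min_le_right _ _)
    rw [le_div_iff₀ (by positivity)] at this
    rw [norm_sub_rev]; linarith
  by_contra! hcon
  by_cases hyZ : y ∈ Z
  · have := (abs_le.1 (hz.abs_sub_le hyZ h1)).1
    linarith
  · have := hz.deep y hyZ (by linarith) x h1
    linarith

theorem SmoothZone.high_of_near (hz : SmoothZone f l u ζ m k L δ Z) {x y : E d}
    (hxy : ‖y - x‖ ≤ min δ (ζ / (4 * (|L| + k * δ)))) (hx : u + ζ / 2 ≤ f x) :
    u + ζ / 4 ≤ f y := by
  have hM : 0 < |L| + k * δ := by have := hz.k_pos; have := hz.δ_pos; positivity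
  have hζ := hz.ζ_pos
  have hlu := hz.le_u
  have h1 : ‖y - x‖ ≤ δ := hxy.trans (min_le_left _ _)
  have h2 : (|L| + k * δ) * ‖y - x‖ ≤ ζ / 4 := by
    have := hxy.trans (min_le_right _ _)
    rw [le_div_iff₀ (by positivity)] at this
    linarith
  by_cases hxZ : x ∈ Z
  · have := (abs_le.1 (hz.abs_sub_le hxZ h1)).1
    linarith
  · have := hz.deep x hxZ (by linarith) y h1
    linarith

/-- Away from the levels of interest, the mean of the kernel density estimator stays on the same
side as the density. -/
theorem SmoothZone.exists_kdeMean_separated (hz : SmoothZone f l u ζ m k L δ Z)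
    (hf : Measurable f) {F : ℝ} (hF : ∀ x, |f x| ≤ F) {K : E d → ℝ} (hKc : Continuous K)
    (hKs : HasCompactSupport K) (hK1 : ∫ z, K z = 1)
    (hKf : (∀ x, 0 ≤ K x) ∨ UniformContinuous f) :
    ∃ ε > 0, ∀ h, 0 < h → h < ε → ∀ x, (f x ≤ l - ζ / 2 → kdeMean K f h x ≤ l - ζ / 4) ∧
      (u + ζ / 2 ≤ f x → u + ζ / 4 ≤ kdeMean K f h x) := by
  have hM : 0 < |L| + k * δ := by have := hz.k_pos; have := hz.δ_pos; positivity
  have hζ := hz.ζ_pos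
  have hδ := hz.δ_pos
  obtain ⟨R, hR⟩ := hKs.isCompact.isBounded.exists_norm_le
  set R' := max R 1 with hR'
  have hR'0 : 0 < R' := lt_of_lt_of_le one_pos (le_max_right _ _)
  have hKi : Integrable K := hKc.integrable_of_hasCompactSupport hKs
  have hnear : ∀ η, 0 < η → ∀ h, 0 < h → h < η / R' → ∀ x z, K z ≠ 0 →
      ‖(x - h • z) - x‖ ≤ η := by
    intro η hη h hh hhη x z hz
    have hzR : ‖z‖ ≤ R' := (hR z (subset_tsupport K hz)).trans (le_max_left _ _)
    rw [sub_sub_cancel_left, norm_neg, norm_smul, Real.norm_of_nonneg hh.le]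
    rw [lt_div_iff₀ hR'0] at hhη
    exact (mul_le_mul_of_nonneg_left hzR hh.le).trans hhη.le
  rcases hKf with hK0 | huc
  -- For `K ≥ 0` the mean is an average of values of `f` that all lie on one side.
  · set η := min δ (ζ / (4 * (|L| + k * δ))) with hη
    have hη0 : 0 < η := by positivity
    refine ⟨η / R', by positivity, fun h hh hhη x => ⟨fun hx => ?_, fun hx => ?_⟩⟩
    · have h1 : kdeMean K f h x ≤ ∫ z, K z * (l - ζ / 4) := by
        refine integral_mono (integrable_kernel_mul hKi hf hF h x) (hKi.mul_const _) fun z => ?_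
        by_cases hzK : K z = 0
        · simp [hzK]
        · exact mul_le_mul_of_nonneg_left (hz.low_of_near (hnear η hη0 h hh hhη x z hzK) hx)
            (hK0 z)
      rwa [integral_mul_const, hK1, one_mul] at h1
    · have h1 : ∫ z, K z * (u + ζ / 4) ≤ kdeMean K f h x := by
        refine integral_mono (hKi.mul_const _) (integrable_kernel_mul hKi hf hF h x) fun z => ?_
        by_cases hzK : K z = 0
        · simp [hzK]
        · exact mul_le_mul_of_nonneg_left (hz.high_of_near (hnear η hη0 h hh hhη x z hzK) hx)
            (hK0 z)
      rwa [integral_mul_const, hK1, one_mul] at h1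
  -- A kernel with negative values can leave the range of the averaged values, so uniform continuity
  -- is used to bound the difference itself.
  · set I := ∫ z, |K z| with hI
    have hI0 : 0 ≤ I := integral_nonneg fun z => abs_nonneg _
    obtain ⟨η, hη0, hη⟩ := Metric.uniformContinuous_iff.1 huc (ζ / (4 * (I + 1))) (by positivity)
    refine ⟨(η / 2) / R', by positivity, fun h hh hhη x => ?_⟩
    have hclose : |kdeMean K f h x - f x| ≤ ζ / 4 := by
      have h1 : f x = ∫ z, K z * f x := by rw [integral_mul_const, hK1, one_mul]
      conv_lhs => rw [h1]
      rw [kdeMean, ← integral_sub (integrable_kernel_mul hKi hf hF h x) (hKi.mul_const _),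
        ← Real.norm_eq_abs]
      refine (norm_integral_le_of_norm_le (hKi.abs.const_mul (ζ / (4 * (I + 1))))
        (ae_of_all _ fun z => ?_)).trans ?_
      · by_cases hzK : K z = 0
        · simp [hzK]
        · have h2 : dist (x - h • z) x < η := by
            rw [dist_eq_norm]
            exact (hnear (η / 2) (by positivity) h hh hhη x z hzK).trans_lt (by linarith)
          have h3 := (hη h2).le
          rw [Real.dist_eq] at h3
          rw [← mul_sub, Real.norm_eq_abs, abs_mul, mul_comm]
          exact mul_le_mul_of_nonneg_right h3 (abs_nonneg _)
      · rw [integral_const_mul, ← hI, div_mul_eq_mul_div, div_le_iff₀ (by positivity)]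
        linarith
    have h1 := abs_le.1 hclose
    exact ⟨fun hx => by linarith [h1.2], fun hx => by linarith [h1.1]⟩

end LevelSetEstimation

/-! ### From the random sample to a deterministic resolution. -/

namespace LevelSetEstimation

variable {d : ℕ} {f : E d → ℝ} {l u ζ m k L δ : ℝ} {Z : Set (E d)}

/-- `A` lies inside and `B` outside of the level set with level `t`, and, up to the resolution `s`,
both are dense, as far as the density is at least `lam`. -/
structure Resolves (f : E d → ℝ) (lam t s : ℝ) (A B : Set (E d)) : Prop where
  inner_subset : A ⊆ levelSet f t
  outer_lt : ∀ x ∈ B, f x < t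
  inner_dense : ∀ x η, ‖η‖ = 1 → box x η s ⊆ {z | t + s ≤ f z} → (A ∩ box x η s).Nonempty
  outer_dense : ∀ x η, ‖η‖ = 1 → box x η s ⊆ {z | lam ≤ f z ∧ f z ≤ t - s} →
    (B ∩ box x η s).Nonempty

/-- Here `g` is the estimator at `x`. Near the levels the gap `M ρ` with `M ≥ c` outweighs the error
`c ρ`, and a density margin `(M + c + 1) ρ` ensures selection, the extra `ρ` giving the strict
inequality for the minus sample. Away from the levels the right side suffices, as `(M + c) ρ < ζ /
8`. -/
theorem SmoothZone.classify {g ρ c M t : ℝ} {x : E d} (hz : SmoothZone f l u ζ m k L δ Z)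
    (ht : t ∈ Set.Icc l u) (hρ : 0 ≤ ρ) (hc : 0 ≤ c) (hM : c ≤ M) (hsmall : (M + c) * ρ < ζ / 8)
    (hlow : f x ≤ l - ζ / 2 → g ≤ l - ζ / 8) (hhigh : u + ζ / 2 ≤ f x → u + ζ / 8 ≤ g)
    (hmid : x ∈ Z → |g - f x| ≤ c * ρ) :
    (t + M * ρ ≤ g → t ≤ f x) ∧ (g < t - M * ρ → f x < t) ∧
      (t + (M + c + 1) * ρ ≤ f x → t + M * ρ ≤ g) ∧
      (0 < ρ → f x ≤ t - (M + c + 1) * ρ → g < t - M * ρ) := by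
  have hζ := hz.ζ_pos
  have hcM := mul_le_mul_of_nonneg_right hM hρ
  have hc0 : 0 ≤ c * ρ := by positivity
  obtain ⟨ht1, ht2⟩ := ht
  have e1 : (M + c) * ρ = M * ρ + c * ρ := by ring
  have e2 : (M + c + 1) * ρ = M * ρ + c * ρ + ρ := by ring
  rw [e1] at hsmall
  rw [e2]
  rcases le_or_gt (f x) (l - ζ / 2) with h1 | h1
  · have := hlow h1
    refine ⟨fun h => ?_, fun h => ?_, fun h => ?_, fun h0 h => ?_⟩ <;> linarith
  · rcases le_or_gt (u + ζ / 2) (f x) with h2 | h2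
    · have := hhigh h2
      refine ⟨fun h => ?_, fun h => ?_, fun h => ?_, fun h0 h => ?_⟩ <;> linarith
    · have := abs_le.1 (hmid (hz.mem_of_lt x (by linarith) (by linarith)))
      refine ⟨fun h => ?_, fun h => ?_, fun h => ?_, fun h0 h => ?_⟩ <;> linarith [this.1, this.2]

theorem levelSetRate_pos (d p : ℕ) {n : ℕ} (hn : 2 ≤ n) : 0 < levelSetRate d p n :=
  lt_max_of_lt_left (kdeRate_pos d p hn)

theorem tendsto_levelSetRate (d : ℕ) {p : ℕ} (hp : 1 ≤ p) :
    Tendsto (levelSetRate d p) atTop (nhds 0) := by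
  have ha : 0 < (2 : ℝ) / (d + 1) := by positivity
  have h2 := tendsto_log_div.rpow_const (p := (2 : ℝ) / (d + 1)) (Or.inr ha.le)
  rw [Real.zero_rpow ha.ne'] at h2
  have := (tendsto_kdeRate d hp).max h2
  rwa [max_self] at this

variable {Ω : Type*} [MeasurableSpace Ω] {P : Measure Ω} {X : ℕ → Ω → E d}

/-- `M₀` is the constant `c` that bounds deviation plus bias; `b` is the larger of the constant for
hitting boxes and that of the classification margin. One almost sure event serves all levels `t` at
once. -/
theorem SmoothZone.eventually_resolves [IsProbabilityMeasure P] [Nontrivial (E d)]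
    (hz : SmoothZone f l u ζ m k L δ Z) {U : Set (E d)} (hU : IsOpen U) (hZU : Z ⊆ U) {p : ℕ}
    (hp : 1 ≤ p) (hfU : ContDiffOn ℝ p f U) (hX : IsSampleFrom P X f) (hf : Measurable f)
    (hf0 : ∀ x, 0 ≤ f x) {F : ℝ} (hF : ∀ x, f x ≤ F) {K : E d → ℝ} {h : ℕ → ℝ}
    (hK : AssumptionK p K h) (hKf : (∀ x, 0 ≤ K x) ∨ UniformContinuous f) :
    ∃ M₀ > 0, ∀ M ≥ M₀, ∃ b > 0, ∀ᵐ ω ∂P, ∀ᶠ n in atTop, ∀ t ∈ Set.Icc l u,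
      Resolves f (l - ζ) t (b * levelSetRate d p n)
        (samplePlus K (h n) (M * kdeRate d p n) n (fun i => X i ω) t)
        (sampleMinus K (h n) (M * kdeRate d p n) n (fun i => X i ω) t) := by
  have hζ := hz.ζ_pos
  have hFa : ∀ x, |f x| ≤ F := fun x => by rw [abs_of_nonneg (hf0 x)]; exact hF x
  obtain ⟨c₀, hc₀, hdev⟩ := hX.eventually_abs_kde_sub_kdeMean_le hf hf0 hF hp hK
  obtain ⟨a, -, c₂, hc₂, hbw⟩ := hK.bandwidth hp
  have hh0 := hK.tendsto_bandwidth hp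
  obtain ⟨c₁, hc₁, ε₁, hε₁, hbias⟩ :=
    exists_bias_le hp hK.1 hK.2.1 hK.2.2.1 hf hFa hz.isCompact hU hZU hfU
  obtain ⟨ε₂, hε₂, hsep⟩ := hz.exists_kdeMean_separated hf hFa hK.1 hK.2.1 hK.2.2.1.1 hKf
  obtain ⟨C, hC, hbox⟩ := hX.eventually_exists_mem_box hz.low_pos hz.isBounded
  set c := c₀ + c₁ * c₂ with hcdef
  have hc : 0 < c := by positivity
  refine ⟨c, hc, fun M hM => ⟨max C (M + c + 1), lt_max_of_lt_left hC, ?_⟩⟩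
  have hMc : 0 < M + c := by linarith
  have hsm : ∀ᶠ n in atTop, (M + c) * kdeRate d p n < ζ / 8 := by
    have := (tendsto_kdeRate d hp).const_mul (M + c)
    rw [mul_zero] at this
    exact this.eventually (gt_mem_nhds (by positivity))
  filter_upwards [hdev, hbox] with ω hdev hbox
  filter_upwards [hdev, hbox, hbw, hsm, eventually_ge_atTop 2,
    hh0.eventually (gt_mem_nhds (lt_min hε₁ hε₂))] with n hdev hbox hbw hsm hn hhn t ht
  obtain ⟨hh, -, hhp⟩ := hbw
  have hρ := kdeRate_pos d p hn
  have hcl := fun i (hi : i < n) => hz.classify (x := X i ω)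
    (g := kde K (h n) n (fun i => X i ω) (X i ω)) ht hρ.le hc.le hM hsm
    (fun hx => by
      have h1 := (hsep (h n) hh (hhn.trans_le (min_le_right _ _)) (X i ω)).1 hx
      have h2 := (abs_le.1 (hdev i hi)).2
      have h3 : c₀ * kdeRate d p n ≤ (M + c) * kdeRate d p n :=
        mul_le_mul_of_nonneg_right (by nlinarith) hρ.le
      linarith)
    (fun hx => by
      have h1 := (hsep (h n) hh (hhn.trans_le (min_le_right _ _)) (X i ω)).2 hx
      have h2 := (abs_le.1 (hdev i hi)).1
      have h3 : c₀ * kdeRate d p n ≤ (M + c) * kdeRate d p n :=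
        mul_le_mul_of_nonneg_right (by nlinarith) hρ.le
      linarith)
    (fun hx => by
      have h1 := abs_le.1 (hbias (h n) hh (hhn.trans_le (min_le_left _ _)) _ hx)
      have h2 := abs_le.1 (hdev i hi)
      have h3 : c₁ * h n ^ p ≤ c₁ * (c₂ * kdeRate d p n) := mul_le_mul_of_nonneg_left hhp hc₁.le
      have e : c * kdeRate d p n = c₀ * kdeRate d p n + c₁ * (c₂ * kdeRate d p n) := by
        rw [hcdef]; ring
      rw [e, abs_le]
      constructor <;> linarith [h1.1, h1.2, h2.1, h2.2])
  set s := max C (M + c + 1) * levelSetRate d p n with hs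
  have hs0 : 0 < s := mul_pos (lt_max_of_lt_left hC) (levelSetRate_pos d p hn)
  have hτ : 0 ≤ (Real.log n / n) ^ ((2 : ℝ) / (d + 1)) :=
    (Real.rpow_pos_of_pos (log_div_pos hn) _).le
  have hs1 : C * (Real.log n / n) ^ ((2 : ℝ) / (d + 1)) ≤ s :=
    mul_le_mul (le_max_left _ _) (le_max_right _ _) hτ (lt_max_of_lt_left hC).le
  have hs2 : (M + c + 1) * kdeRate d p n ≤ s :=
    mul_le_mul (le_max_right _ _) (le_max_left _ _) hρ.le (lt_max_of_lt_left hC).le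
  have hmono : ∀ x η : E d, box x η (C * (Real.log n / n) ^ ((2 : ℝ) / (d + 1))) ⊆ box x η s :=
    fun x η z hzb => ⟨hzb.1.trans hs1, hzb.2.trans (Real.sqrt_le_sqrt hs1)⟩
  have hlt : l ≤ t := ht.1
  refine ⟨?_, ?_, fun x η hη hsub => ?_, fun x η hη hsub => ?_⟩
  · rintro x ⟨i, hi, rfl, hx⟩
    exact (hcl i hi).1 hx
  · rintro x ⟨i, hi, rfl, hx⟩
    exact (hcl i hi).2.1 hx
  · obtain ⟨i, hi, hxi⟩ := hbox x η hη fun z hzb => by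
      have : t + s ≤ f z := hsub (hmono x η hzb)
      change l - ζ ≤ f z
      linarith
    have : t + s ≤ f (X i ω) := hsub (hmono x η hxi)
    exact ⟨X i ω, ⟨i, hi, rfl, (hcl i hi).2.2.1 (by linarith)⟩, hmono x η hxi⟩
  · obtain ⟨i, hi, hxi⟩ := hbox x η hη fun z hzb => (hsub (hmono x η hzb)).1
    have : f (X i ω) ≤ t - s := (hsub (hmono x η hxi)).2
    exact ⟨X i ω, ⟨i, hi, rfl, (hcl i hi).2.2.2 hρ (by linarith)⟩, hmono x η hxi⟩

end LevelSetEstimation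

/-! ### Upper and lower bounds on the separating radii. -/

namespace LevelSetEstimation

variable {d : ℕ} {f : E d → ℝ} {l u ζ m k L δ : ℝ} {Z : Set (E d)}

/-- Moving uphill by `τ` gains at least a multiple of `τ`, even on a ball. -/
theorem SmoothZone.climb (hz : SmoothZone f l u ζ m k L δ Z) {a : E d} (ha : a ∈ Z) {τ : ℝ}
    (hτ : 0 ≤ τ) (hτδ : 2 * τ ≤ δ) (hτk : 9 * k * τ ≤ m) :
    ∃ p, ‖p - a‖ = τ ∧ ∀ z, ‖z - p‖ ≤ τ / 2 → f a + m / 4 * τ ≤ f z := by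
  have hk := hz.k_pos
  have hg0 : 0 < ‖gradient f a‖ := hz.m_pos.trans_le (hz.m_le a ha)
  set g := gradient f a with hg
  refine ⟨a + (τ / ‖g‖) • g, ?_, fun z hzp => ?_⟩
  · rw [add_sub_cancel_left, norm_smul, Real.norm_of_nonneg (by positivity)]
    field_simp
  · set v := z - (a + (τ / ‖g‖) • g) with hv
    have e : z - a = (τ / ‖g‖) • g + v := by rw [hv]; module
    have hn : ‖z - a‖ ≤ 3 / 2 * τ := by
      rw [e]
      refine (norm_add_le _ _).trans ?_
      rw [norm_smul, Real.norm_of_nonneg (by positivity)]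
      have : τ / ‖g‖ * ‖g‖ = τ := by field_simp
      linarith
    have hT := (abs_le.1 (hz.taylor a ha z (by linarith))).1
    have hi : inner ℝ g (z - a) = τ * ‖g‖ + inner ℝ g v := by
      rw [e, inner_add_right, real_inner_smul_right, real_inner_self_eq_norm_sq]
      field_simp
    have hv' : -(‖g‖ * (τ / 2)) ≤ inner ℝ g v :=
      (abs_le.1 ((abs_real_inner_le_norm g v).trans
        (mul_le_mul_of_nonneg_left hzp hg0.le))).1
    have h1 := mul_le_mul_of_nonneg_right (hz.m_le a ha) hτ
    have h2 : k * ‖z - a‖ ^ 2 ≤ k * (3 / 2 * τ) ^ 2 := by gcongr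
    have h3 := mul_le_mul_of_nonneg_right hτk hτ
    rw [hi] at hT
    nlinarith

/-- A point on a segment belongs to the `γ`-convex hull of a set that is dense around the
end points, if `γ` is large. -/
theorem mem_rConvexHull_of_mem_segment {p q z z' : E d} (hzpq : z ∈ segment ℝ p q) {ε γ : ℝ}
    (hε : 0 < ε) (hγ : 2 * ‖p - q‖ ^ 2 / ε + ‖p - q‖ + ε ≤ γ) {A : Set (E d)}
    (hp : ∀ x, ‖x - p‖ ≤ ε → ∃ a ∈ A, ‖a - x‖ < ε / 4)
    (hq : ∀ x, ‖x - q‖ ≤ ε → ∃ a ∈ A, ‖a - x‖ < ε / 4) (hz' : ‖z' - z‖ ≤ ε / 4) :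
    z' ∈ rConvexHull γ A := by
  rw [mem_rConvexHull]
  intro c hc
  set D := ‖p - q‖ with hD
  have hD0 : 0 ≤ D := norm_nonneg _
  -- Large balls are nearly half-spaces: if `w` points from `z'` to the centre and `⟨y - z, w⟩ ≥ 0`,
  -- then shifting `y` by `z' - z` and by `ε / 2` along `w` brings it inside the ball with a margin
  -- `ε / 4`, once `γ` exceeds the order `D² / ε`. One of the two end points satisfies this sign
  -- condition.
  have hkey : ∀ y w : E d, ‖w‖ = 1 → c - z' = ‖c - z'‖ • w → ‖y - z‖ ≤ D →
      0 ≤ inner ℝ (y - z) w → (∀ x, ‖x - y‖ ≤ ε → ∃ a ∈ A, ‖a - x‖ < ε / 4) →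
      ∃ a ∈ A, ‖a - c‖ < γ := by
    intro y w hw hcw hy hyw hA
    obtain ⟨a, haA, ha⟩ := hA (y + (z' - z) + (ε / 2) • w) (by
      have e : y + (z' - z) + (ε / 2) • w - y = (z' - z) + (ε / 2) • w := by abel
      rw [e]
      refine (norm_add_le _ _).trans ?_
      rw [norm_smul, hw, Real.norm_of_nonneg (by positivity)]
      linarith)
    refine ⟨a, haA, ?_⟩
    set ρ := ‖c - z'‖ with hρ
    have hργ : ρ < γ := by rwa [hρ, norm_sub_rev]
    have hρ0 : 0 ≤ ρ := norm_nonneg _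
    set x := y + (z' - z) + (ε / 2) • w with hx
    have e : x - c = (y - z) + (ε / 2 - ρ) • w := by
      have : c = z' + ρ • w := by rw [← hcw]; abel
      rw [hx, this]
      module
    have hsq : 2 * D ^ 2 / ε * ε = 2 * D ^ 2 := by field_simp
    have hDε : 0 ≤ 2 * D ^ 2 / ε := by positivity
    have hγε : 2 * D ^ 2 + D * ε + ε * ε ≤ γ * ε := by
      have := mul_le_mul_of_nonneg_right hγ hε.le
      linarith
    have hxc : ‖x - c‖ ≤ γ - ε / 4 := by
      rcases le_or_gt (ε / 2) ρ with h | h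
      · refine abs_le_of_sq_le_sq' ?_ (by linarith) |>.2
        rw [e, norm_add_sq_real, real_inner_smul_right, norm_smul, hw, mul_one, Real.norm_eq_abs,
          sq_abs]
        have h1 : (ε / 2 - ρ) * inner ℝ (y - z) w ≤ 0 :=
          mul_nonpos_of_nonpos_of_nonneg (by linarith) hyw
        have h2 : ‖y - z‖ ^ 2 ≤ D ^ 2 := by gcongr
        have h3 : (ε / 2 - ρ) ^ 2 ≤ (γ - ε / 2) ^ 2 := by
          rw [sq_le_sq, abs_sub_comm, abs_of_nonneg (by linarith), abs_of_nonneg (by linarith)]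
          linarith
        nlinarith [mul_nonneg hD0 hε.le]
      · rw [e]
        refine (norm_add_le _ _).trans ?_
        rw [norm_smul, hw, mul_one, Real.norm_of_nonneg (by linarith)]
        linarith
    calc ‖a - c‖ = ‖(a - x) + (x - c)‖ := by rw [sub_add_sub_cancel]
      _ ≤ ‖a - x‖ + ‖x - c‖ := norm_add_le _ _
      _ < γ := by linarith
  -- For a ball centred at `z'` any unit vector serves as `w`; `p - q` supplies one unless `p = q`,
  -- the case treated last.
  have hpq : ∃ w : E d, ‖w‖ = 1 ∧ c - z' = ‖c - z'‖ • w ∨ p = q ∧ c = z' := by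
    by_cases h : c = z'
    · by_cases h2 : p = q
      · exact ⟨0, Or.inr ⟨h2, h⟩⟩
      · have : p - q ≠ 0 := sub_ne_zero.2 h2
        refine ⟨(‖p - q‖⁻¹ : ℝ) • (p - q), Or.inl ⟨norm_smul_inv_norm (𝕜 := ℝ) this, ?_⟩⟩
        simp [h]
    · have : c - z' ≠ 0 := sub_ne_zero.2 h
      refine ⟨(‖c - z'‖⁻¹ : ℝ) • (c - z'), Or.inl ⟨norm_smul_inv_norm (𝕜 := ℝ) this, ?_⟩⟩
      rw [smul_inv_smul₀ (norm_ne_zero_iff.2 this)]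
  have hsum := dist_add_dist_of_mem_segment hzpq
  rw [dist_eq_norm, dist_eq_norm, dist_eq_norm, norm_sub_rev z q] at hsum
  have hzp : ‖p - z‖ ≤ D := by linarith [norm_nonneg (q - z)]
  have hzq : ‖q - z‖ ≤ D := by linarith [norm_nonneg (p - z)]
  obtain ⟨w, ⟨hw, hcw⟩ | ⟨rfl, rfl⟩⟩ := hpq
  · obtain ⟨α, β, hα, hβ, hαβ, rfl⟩ := hzpq
    rcases le_or_gt 0 (inner ℝ (p - q) w) with h | h
    · refine hkey p w hw hcw hzp ?_ hp
      have : p - (α • p + β • q) = β • (p - q) := by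
        rw [← eq_sub_iff_add_eq] at hαβ
        rw [hαβ]; module
      rw [this, real_inner_smul_left]
      positivity
    · refine hkey q w hw hcw hzq ?_ hq
      have : q - (α • p + β • q) = -(α • (p - q)) := by
        rw [← eq_sub_iff_add_eq'] at hαβ
        rw [hαβ]; module
      rw [this, inner_neg_left, real_inner_smul_left]
      nlinarith
  · rw [segment_same, Set.mem_singleton_iff] at hzpq
    obtain ⟨a, haA, ha⟩ := hp c (by subst hzpq; linarith)
    refine ⟨a, haA, ha.trans_le ?_⟩
    have : 0 ≤ 2 * D ^ 2 / ε := by positivity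
    linarith

/-- Nonconvexity of a level set is witnessed by a segment on which the density is below the level
at one point, and above at the end points, with room to spare. -/
theorem SmoothZone.exists_nonconvex_witness (hz : SmoothZone f l u ζ m k L δ Z) {t : ℝ}
    (ht : t ∈ Set.Icc l u) (hcl : IsClosed (levelSet f t)) (hnc : ¬ Convex ℝ (levelSet f t)) :
    ∃ p q : E d, ∃ z ∈ segment ℝ p q, ∃ ε > 0, ∃ κ > 0,
      (∀ x, ‖x - p‖ ≤ ε → t + κ ≤ f x) ∧ (∀ x, ‖x - q‖ ≤ ε → t + κ ≤ f x) ∧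
      ∀ x, ‖x - z‖ ≤ ε → l - ζ ≤ f x ∧ f x ≤ t - κ := by
  have hδ := hz.δ_pos
  have hk := hz.k_pos
  have hm := hz.m_pos
  have hζ := hz.ζ_pos
  obtain ⟨ht1, ht2⟩ := ht
  have hnear : ∀ y ∈ levelSet f t, ∀ r > 0, ∃ p, ‖p - y‖ ≤ r ∧ ∃ ε > 0, ∃ κ > 0,
      ∀ x, ‖x - p‖ ≤ ε → t + κ ≤ f x := by
    intro y hy r hr
    change t ≤ f y at hy
    by_cases hyZ : y ∈ Z
    · set τ := min r (min (δ / 2) (m / (9 * k))) with hτ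
      have hτ0 : 0 < τ := by positivity
      have h1 : τ ≤ r := min_le_left _ _
      have h2 : τ ≤ δ / 2 := (min_le_right _ _).trans (min_le_left _ _)
      have h3 : τ ≤ m / (9 * k) := (min_le_right _ _).trans (min_le_right _ _)
      rw [le_div_iff₀ (by positivity)] at h3
      obtain ⟨p, hp, hpf⟩ := hz.climb hyZ hτ0.le (by linarith) (by linarith)
      exact ⟨p, hp.le.trans h1, τ / 2, by positivity, m / 4 * τ, by positivity, fun x hx =>
        (by linarith [hpf x hx])⟩
    · exact ⟨y, by simpa using hr.le, δ, hδ, ζ / 2, by positivity, fun x hx => by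
        linarith [hz.deep y hyZ (by linarith) x hx]⟩
  simp only [Convex, StarConvex, not_forall] at hnc
  obtain ⟨p₀, hp₀, q₀, hq₀, α, β, hα, hβ, hαβ, hw₀⟩ := hnc
  obtain ⟨r, hr, hball⟩ := Metric.isOpen_iff.1 hcl.isOpen_compl _ hw₀
  obtain ⟨p, hpp, ε₁, hε₁, κ₁, hκ₁, hp⟩ := hnear p₀ hp₀ (r / 2) (by positivity)
  obtain ⟨q, hqq, ε₂, hε₂, κ₂, hκ₂, hq⟩ := hnear q₀ hq₀ (r / 2) (by positivity)
  set w := α • p + β • q with hw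
  have hwG : w ∉ levelSet f t := by
    refine hball ?_
    rw [Metric.mem_ball, dist_eq_norm]
    have e : w - (α • p₀ + β • q₀) = α • (p - p₀) + β • (q - q₀) := by rw [hw]; module
    rw [e]
    refine (norm_add_le _ _).trans_lt ?_
    rw [norm_smul, norm_smul, Real.norm_of_nonneg hα, Real.norm_of_nonneg hβ]
    have h1 := mul_le_mul_of_nonneg_left hpp hα
    have h2 := mul_le_mul_of_nonneg_left hqq hβ
    have h3 : α * (r / 2) + β * (r / 2) = r / 2 := by rw [← add_mul, hαβ, one_mul]
    linarith
  have hpG : p ∈ levelSet f t := by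
    change t ≤ f p
    linarith [hp p (by simpa using hε₁.le)]
  set φ : ℝ → E d := fun s => w + s • (p - w) with hφ
  have hφc : Continuous φ := by fun_prop
  -- A walk from the point `w` outside the level set towards `p`, up to the first entry. Just before
  -- it `f < t`, but by continuity around the entry point `f` is still above `l - ζ`, as needed for
  -- outer sample points.
  set T := Set.Icc (0 : ℝ) 1 ∩ φ ⁻¹' levelSet f t with hT
  have hTc : IsCompact T := isCompact_Icc.inter_right (hcl.preimage hφc)
  have hTne : T.Nonempty := ⟨1, by simp, by simpa [hφ] using hpG⟩
  obtain ⟨σ, ⟨hσI, hσG⟩, hσmin⟩ := hTc.exists_isLeast hTne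
  have hσ0 : 0 < σ := by
    refine hσI.1.lt_of_ne fun h0 => hwG ?_
    have := hσG
    rw [← h0] at this
    simpa [hφ] using this
  have hbefore : ∀ s, 0 ≤ s → s < σ → f (φ s) < t := fun s h0 h1 => by
    by_contra! hcon
    exact absurd (hσmin ⟨⟨h0, h1.le.trans hσI.2⟩, hcon⟩) (not_le.2 h1)
  have hsmall : ∀ r > 0, ∃ s, 0 ≤ s ∧ s < σ ∧ ‖φ s - φ σ‖ ≤ r := by
    intro r hr
    obtain ⟨η, hη, hηφ⟩ := Metric.continuous_iff.1 hφc σ r hr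
    refine ⟨max 0 (σ - η / 2), le_max_left _ _, max_lt hσ0 (by linarith), ?_⟩
    rw [← dist_eq_norm]
    refine (hηφ _ ?_).le
    rw [Real.dist_eq, abs_lt]
    constructor
    · linarith [le_max_right 0 (σ - η / 2)]
    · linarith [max_lt hσ0 (by linarith : σ - η / 2 < σ)]
  have hσZ : φ σ ∈ Z := by
    by_contra hcon
    obtain ⟨s, hs0, hs1, hs⟩ := hsmall δ hδ
    change t ≤ f (φ σ) at hσG
    linarith [hbefore s hs0 hs1, hz.deep _ hcon (by linarith) _ hs]
  set M := |L| + k * δ with hM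
  have hM0 : 0 < M := by positivity
  obtain ⟨s, hs0, hs1, hs⟩ := hsmall (min δ (ζ / (2 * M))) (by positivity)
  have hft := hbefore s hs0 hs1
  have hfl : l - ζ / 2 ≤ f (φ s) := by
    have h1 := (abs_le.1 (hz.abs_sub_le hσZ (hs.trans (min_le_left _ _)))).1
    have h2 := hs.trans (min_le_right _ _)
    rw [le_div_iff₀ (by positivity)] at h2
    change t ≤ f (φ σ) at hσG
    linarith
  have hsZ : φ s ∈ Z := hz.mem_of_lt _ (by linarith) (by linarith)
  set κ₃ := (t - f (φ s)) / 2 with hκ₃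
  have hκ₃0 : 0 < κ₃ := by rw [hκ₃]; linarith
  set ε₃ := min δ (min κ₃ (ζ / 2) / M) with hε₃
  have hε₃0 : 0 < ε₃ := by positivity
  refine ⟨p, q, φ s, ?_, min ε₁ (min ε₂ ε₃), by positivity, min κ₁ (min κ₂ κ₃), by positivity,
    fun x hx => ?_, fun x hx => ?_, fun x hx => ?_⟩
  · have hwseg : w ∈ segment ℝ p q := ⟨α, β, hα, hβ, hαβ, rfl⟩
    refine (convex_segment p q).segment_subset hwseg (left_mem_segment ℝ p q)
      ⟨1 - s, s, by linarith [hσI.2], hs0, by ring, ?_⟩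
    rw [hφ]; module
  · linarith [hp x (hx.trans (min_le_left _ _)), min_le_left κ₁ (min κ₂ κ₃)]
  · linarith [hq x (hx.trans ((min_le_right _ _).trans (min_le_left _ _))),
      (min_le_right κ₁ (min κ₂ κ₃)).trans (min_le_left _ _)]
  · have hx3 : ‖x - φ s‖ ≤ ε₃ := hx.trans ((min_le_right _ _).trans (min_le_right _ _))
    have h1 := abs_le.1 (hz.abs_sub_le hsZ (hx3.trans (min_le_left _ _)))
    have h2 := hx3.trans (min_le_right _ _)
    rw [le_div_iff₀ hM0] at h2
    have h3 := min_le_left κ₃ (ζ / 2)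
    have h4 := min_le_right κ₃ (ζ / 2)
    have h5 := (min_le_right κ₁ (min κ₂ κ₃)).trans (min_le_right _ _)
    have h6 : f (φ s) = t - 2 * κ₃ := by rw [hκ₃]; ring
    constructor <;> linarith [h1.1, h1.2]

/-- If all level sets are nonconvex, then the radii for which the hull of the inner points avoids
the outer points are bounded. -/
theorem SmoothZone.exists_radius_le [Nontrivial (E d)] (hz : SmoothZone f l u ζ m k L δ Z)
    (hG : ∀ t ∈ Set.Icc l u, IsCompact (levelSet f t) ∧ ¬ Convex ℝ (levelSet f t)) :
    ∃ R > 0, ∃ s₀ > 0, ∀ t ∈ Set.Icc l u, ∀ s, 0 < s → s < s₀ → ∀ A B : Set (E d),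
      Resolves f (l - ζ) t s A B → ∀ γ, rConvexHull γ A ∩ B = ∅ → γ ≤ R := by
  obtain ⟨e, he⟩ := exists_norm_eq (E d) (zero_le_one' ℝ)
  -- The nonconvexity witness of a level `t` serves all nearby levels, so compactness of `[l, u]`
  -- makes the bound uniform.
  refine isCompact_Icc.induction_on (p := fun S : Set ℝ => ∃ R > 0, ∃ s₀ > 0, ∀ t ∈ S,
    ∀ s, 0 < s → s < s₀ → ∀ A B : Set (E d), Resolves f (l - ζ) t s A B →
      ∀ γ, rConvexHull γ A ∩ B = ∅ → γ ≤ R) ?_ ?_ ?_ ?_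
  · exact ⟨1, one_pos, 1, one_pos, fun t ht => ht.elim⟩
  · rintro S T hST ⟨R, hR, s₀, hs₀, H⟩
    exact ⟨R, hR, s₀, hs₀, fun t ht => H t (hST ht)⟩
  · rintro S T ⟨R, hR, s₀, hs₀, H⟩ ⟨R', hR', s₀', hs₀', H'⟩
    refine ⟨max R R', by positivity, min s₀ s₀', by positivity, ?_⟩
    rintro t (ht | ht) s hs hss A B hAB γ hγ
    · exact (H t ht s hs (hss.trans_le (min_le_left _ _)) A B hAB γ hγ).trans (le_max_left _ _)
    · exact (H' t ht s hs (hss.trans_le (min_le_right _ _)) A B hAB γ hγ).trans (le_max_right _ _)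
  · intro t ht
    obtain ⟨p, q, z, hzpq, ε, hε, κ, hκ, hp, hq, hzf⟩ :=
      hz.exists_nonconvex_witness ht (hG t ht).1.isClosed (hG t ht).2
    set e' := ε / 2 with he'
    have he0 : 0 < e' := by positivity
    refine ⟨Set.Ioo (t - κ / 2) (t + κ / 2), mem_nhdsWithin_of_mem_nhds
      (Ioo_mem_nhds (by linarith) (by linarith)),
      2 * ‖p - q‖ ^ 2 / e' + ‖p - q‖ + e', by positivity, min (κ / 2) ((e' / 8) ^ 2),
      by positivity, ?_⟩
    intro t' ⟨ht1, ht2⟩ s hs hss A B hAB γ hγ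
    by_contra! hcon
    have hs1 : s < κ / 2 := hss.trans_le (min_le_left _ _)
    have hs2 : √s < e' / 4 := by
      have h2 : s < (e' / 8) ^ 2 := hss.trans_le (min_le_right _ _)
      have := (Real.sqrt_lt_sqrt hs.le h2)
      rw [Real.sqrt_sq (by positivity)] at this
      linarith
    have hA : ∀ y, (∀ x, ‖x - y‖ ≤ ε → t + κ ≤ f x) → ∀ x, ‖x - y‖ ≤ e' →
        ∃ a ∈ A, ‖a - x‖ < e' / 4 := by
      intro y hy x hx
      obtain ⟨a, haA, hax⟩ := hAB.inner_dense x e he fun v hv => by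
        have h1 : ‖v - y‖ ≤ ε := by
          rw [← sub_add_sub_cancel v x y]
          refine (norm_add_le _ _).trans ?_
          linarith [hv.2]
        change t' + s ≤ f v
        linarith [hy v h1]
      exact ⟨a, haA, hax.2.trans_lt hs2⟩
    obtain ⟨b, hbB, hb⟩ := hAB.outer_dense z e he fun v hv => by
      have h1 := hzf v (by linarith [hv.2])
      exact ⟨h1.1, by linarith [h1.2]⟩
    have := mem_rConvexHull_of_mem_segment hzpq he0 hcon.le (hA p hp) (hA q hq)
      (hb.2.trans hs2.le)
    exact Set.notMem_empty b (hγ ▸ ⟨this, hbB⟩)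

/-- The radii for which the hull of the inner points avoids the outer points include all
small ones. -/
theorem SmoothZone.rConvexHull_inter_eq_empty (hz : SmoothZone f l u ζ m k L δ Z) {t s : ℝ}
    (ht : t ∈ Set.Icc l u) (hcomp : IsCompact (levelSet f t)) (hne : (levelSet f t).Nonempty)
    {A B : Set (E d)} (hAB : Resolves f (l - ζ) t s A B) {γ : ℝ} (hγ : 0 < γ) (hγδ : 2 * γ ≤ δ)
    (hγk : 2 * k * γ ≤ m) : rConvexHull γ A ∩ B = ∅ := by
  rw [Set.eq_empty_iff_forall_notMem]
  rintro x ⟨hxA, hxB⟩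
  have : t ≤ f x := hz.rConvexHull_levelSet_subset ht hcomp hne hγ hγδ hγk
    (rConvexHull_mono_set hAB.inner_subset hxA)
  linarith [hAB.outer_lt x hxB]

end LevelSetEstimation

/-! ### Combination: Hausdorff distance and volume. -/

namespace LevelSetEstimation

variable {d : ℕ} {f : E d → ℝ} {l u ζ m k L δ : ℝ} {Z : Set (E d)}

/-- The error of the hull of the inner points, with a fixed fraction of the largest radius that
separates them from the outer points, is at most of the order of the resolution. -/
theorem SmoothZone.hausdorffEDist_and_volume_le [Nontrivial (E d)]
    (hz : SmoothZone f l u ζ m k L δ Z) (hf : Measurable f)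
    (hG : ∀ t ∈ Set.Icc l u, IsCompact (levelSet f t) ∧ (levelSet f t).Nonempty ∧
      ¬ Convex ℝ (levelSet f t)) {ν : ℝ} (hν0 : 0 < ν) (hν1 : ν < 1) :
    ∃ C > 0, ∃ s₀ > 0, ∀ s, 0 < s → s < s₀ → ∀ t ∈ Set.Icc l u, ∀ A B : Set (E d),
      Resolves f (l - ζ) t s A B → ∀ r, r = ν * sSup {γ : ℝ | 0 < γ ∧ rConvexHull γ A ∩ B = ∅} →
      Metric.hausdorffEDist (rConvexHull r A) (levelSet f t) ≤ ENNReal.ofReal (C * s) ∧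
      volume (symmDiff (rConvexHull r A) (levelSet f t)) ≤ ENNReal.ofReal (C * s) := by
  have hδ := hz.δ_pos
  have hk := hz.k_pos
  have hm := hz.m_pos
  have hζ := hz.ζ_pos
  obtain ⟨R, hR, s₁, hs₁, hrad⟩ :=
    hz.exists_radius_le fun t ht => ⟨(hG t ht).1, (hG t ht).2.2⟩
  set r₀ := min (δ / 2) (m / (2 * k)) with hr₀
  have hr₀0 : 0 < r₀ := by positivity
  have hr₀δ : 2 * r₀ ≤ δ := by linarith [min_le_left (δ / 2) (m / (2 * k))]
  have hr₀k : 2 * k * r₀ ≤ m := by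
    have := min_le_right (δ / 2) (m / (2 * k))
    rw [← hr₀, le_div_iff₀ (by positivity)] at this
    linarith
  have hνr : 0 < ν * r₀ := by positivity
  -- Strictly between `ν` and `1`, so that `r / ν'` is below the supremum and the hull of that
  -- radius still avoids `B`.
  set ν' := (1 + ν) / 2 with hν'
  have hν'0 : 0 < ν' := by positivity
  obtain ⟨C₁, hC₁, s₂, hs₂, hnear⟩ :=
    hz.near_levelSet_of_mem_rConvexHull hνr hR hν'0 (by rw [hν']; linarith)
  obtain ⟨C₂, hC₂, s₃, hs₃, hmem⟩ := hz.mem_rConvexHull_of_le hνr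
  obtain ⟨C₃, hC₃, ε₀, hε₀, hvol⟩ := hz.volume_strip_le hf
  set κ := min (min (ζ / 2) (ε₀ / 2)) (min (m * δ / 8) (m ^ 2 / (36 * k))) with hκ
  have hκ0 : 0 < κ := by positivity
  refine ⟨C₁ + 4 * C₂ / m + C₃ * (C₁ + C₂), by positivity,
    min (min s₁ (κ / (C₁ + C₂))) (min s₂ s₃), by positivity, ?_⟩
  intro s hs hss t ht A B hAB r hr
  obtain ⟨hcomp, hne, -⟩ := hG t ht
  have hss1 : s < s₁ := hss.trans_le ((min_le_left _ _).trans (min_le_left _ _))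
  have hssκ : s < κ / (C₁ + C₂) := hss.trans_le ((min_le_left _ _).trans (min_le_right _ _))
  have hss2 : s < s₂ := hss.trans_le ((min_le_right _ _).trans (min_le_left _ _))
  have hss3 : s < s₃ := hss.trans_le ((min_le_right _ _).trans (min_le_right _ _))
  rw [lt_div_iff₀ (by positivity)] at hssκ
  have hC₁s : 0 < C₁ * s := by positivity
  have hC₂s : 0 < C₂ * s := by positivity
  have hκ1 : κ ≤ ζ / 2 := (min_le_left _ _).trans (min_le_left _ _)
  have hκ2 : κ ≤ ε₀ / 2 := (min_le_left _ _).trans (min_le_right _ _)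
  have hκ3 : κ ≤ m * δ / 8 := (min_le_right _ _).trans (min_le_left _ _)
  have hκ4 : κ ≤ m ^ 2 / (36 * k) := (min_le_right _ _).trans (min_le_right _ _)
  set S := {γ : ℝ | 0 < γ ∧ rConvexHull γ A ∩ B = ∅} with hS
  have hSr : r₀ ∈ S :=
    ⟨hr₀0, hz.rConvexHull_inter_eq_empty ht hcomp hne hAB hr₀0 hr₀δ hr₀k⟩
  have hSR : ∀ γ ∈ S, γ ≤ R := fun γ hγ => hrad t ht s hs hss1 A B hAB γ hγ.2
  -- `S` is nonempty and bounded above, so `sSup S` is a genuine supremum and not the default value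
  -- `0`.
  have hle : r₀ ≤ sSup S := le_csSup ⟨R, hSR⟩ hSr
  have hSpos : 0 < sSup S := hr₀0.trans_le hle
  have hsR : sSup S ≤ R := csSup_le ⟨r₀, hSr⟩ hSR
  have hr1 : ν * r₀ ≤ r := by rw [hr]; gcongr
  have hr2 : r ≤ R := by
    rw [hr]
    exact (mul_le_of_le_one_left hSpos.le hν1.le).trans hsR
  have hr0 : 0 < r := hνr.trans_le hr1
  have hlt : r / ν' < sSup S := by
    rw [div_lt_iff₀ hν'0, hr, mul_comm]
    exact mul_lt_mul_of_pos_left (by rw [hν']; linarith) hSpos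
  obtain ⟨γ, hγS, hγ⟩ := exists_lt_of_lt_csSup ⟨r₀, hSr⟩ hlt
  have hempty : rConvexHull (r / ν') A ∩ B = ∅ :=
    Set.subset_empty_iff.1 ((Set.inter_subset_inter_left B
      (rConvexHull_mono_radius (by positivity) hγ.le)).trans hγS.2.subset)
  have hout := hnear s hs hss2 t ht hcomp hne A B hAB.inner_subset hAB.inner_dense
    hAB.outer_dense r hr1 hr2 hempty
  have hin := hmem s hs hss3 t ht A hAB.inner_dense r hr1
  obtain ⟨ht1, ht2⟩ := ht
  constructor
  · refine Metric.hausdorffEDist_le_of_mem_edist (fun x hx => ?_) (fun y hy => ?_)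
    · obtain ⟨y, hy, hxy⟩ := (hout x hx).2
      refine ⟨y, hy, ?_⟩
      rw [edist_dist, dist_eq_norm]
      refine ENNReal.ofReal_le_ofReal (hxy.trans (mul_le_mul_of_nonneg_right ?_ hs.le))
      have : 0 < 4 * C₂ / m := by positivity
      have : 0 < C₃ * (C₁ + C₂) := by positivity
      linarith
    · rcases le_or_gt (t + C₂ * s) (f y) with h | h
      · exact ⟨y, hin y h, by simp⟩
      · change t ≤ f y at hy
        have hyZ : y ∈ Z := hz.mem_of_lt y (by linarith) (by linarith)
        -- A point barely above the level may be missing from the hull; climbing by `τ` gains `m τ /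
        -- 4 = C₂ s` and reaches a point of the hull.
        set τ := 4 * C₂ / m * s with hτ
        have hτ0 : 0 < τ := by positivity
        have hτm : m * τ = 4 * (C₂ * s) := by rw [hτ]; field_simp
        obtain ⟨y', hy', hfy'⟩ := hz.climb hyZ hτ0.le
          (by
            refine le_of_mul_le_mul_left ?_ hm
            linarith)
          (by
            rw [le_div_iff₀ (by positivity)] at hκ4
            refine le_of_mul_le_mul_left ?_ hm
            have h1 : κ * (36 * k) ≤ m * m := by rw [← sq]; exact hκ4
            have h2 : C₂ * s * (36 * k) ≤ κ * (36 * k) :=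
              mul_le_mul_of_nonneg_right (by linarith) (by positivity)
            calc m * (9 * k * τ) = 9 * k * (m * τ) := by ring
              _ = C₂ * s * (36 * k) := by rw [hτm]; ring
              _ ≤ m * m := h2.trans h1)
        have h3 := hfy' y' (by simpa using (half_pos hτ0).le)
        refine ⟨y', hin y' (by linarith), ?_⟩
        rw [edist_dist, dist_comm, dist_eq_norm, hy']
        refine ENNReal.ofReal_le_ofReal (mul_le_mul_of_nonneg_right ?_ hs.le)
        have : 0 < C₃ * (C₁ + C₂) := by positivity
        linarith
  · have hsub : symmDiff (rConvexHull r A) (levelSet f t) ⊆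
        {x | t - C₁ * s ≤ f x ∧ f x ≤ (t - C₁ * s) + (C₁ + C₂) * s} := by
      rintro x (⟨hx, hxG⟩ | ⟨hxG, hx⟩)
      · have h1 := (hout x hx).1
        have h2 : f x < t := not_le.1 hxG
        exact ⟨h1, by linarith⟩
      · have h1 : t ≤ f x := hxG
        have h2 : f x < t + C₂ * s := not_le.1 fun h => hx (hin x h)
        exact ⟨by linarith, by linarith⟩
    refine (measure_mono hsub).trans ((hvol _ (by positivity) (by linarith) _ (by linarith)
      (by linarith)).trans (ENNReal.ofReal_le_ofReal ?_))
    rw [← mul_assoc]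
    refine mul_le_mul_of_nonneg_right ?_ hs.le
    have : 0 < 4 * C₂ / m := by positivity
    linarith

end LevelSetEstimation

theorem theorem3p2 {d p : ℕ} (hp : 1 ≤ p)
    (f : LevelSetEstimation.E d → ℝ) (hf_meas : Measurable f) (hf_nonneg : ∀ x, 0 ≤ f x)
    (l u : ℝ)
    (hG : ∀ t ∈ Set.Icc l u,
      IsCompact (LevelSetEstimation.levelSet f t) ∧ (LevelSetEstimation.levelSet f t).Nonempty ∧
        ¬ Convex ℝ (LevelSetEstimation.levelSet f t))
    (hA : LevelSetEstimation.AssumptionA p f l u)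
    (K : LevelSetEstimation.E d → ℝ) (h : ℕ → ℝ)
    (hK : LevelSetEstimation.AssumptionK p K h)
    (hKf : (∀ x, 0 ≤ K x) ∨ UniformContinuous f)
    {Ω : Type*} [MeasurableSpace Ω] (P : Measure Ω) [IsProbabilityMeasure P]
    (X : ℕ → Ω → LevelSetEstimation.E d) (hX : LevelSetEstimation.IsSampleFrom P X f) :
    ∃ M₀ > (0 : ℝ), ∀ M ≥ M₀, ∀ ν ∈ Set.Ioo (0 : ℝ) 1, ∃ C : ℝ, ∀ᵐ ω ∂P, ∀ᶠ n : ℕ in atTop,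
      (⨆ t ∈ Set.Icc l u, Metric.hausdorffEDist
          (LevelSetEstimation.levelSetEstimator K (h n) (M * LevelSetEstimation.kdeRate d p n) ν n
            (fun i => X i ω) t)
          (LevelSetEstimation.levelSet f t)) ≤
        ENNReal.ofReal (C * LevelSetEstimation.levelSetRate d p n) ∧
      (⨆ t ∈ Set.Icc l u, volume (symmDiff
          (LevelSetEstimation.levelSetEstimator K (h n) (M * LevelSetEstimation.kdeRate d p n) ν n
            (fun i => X i ω) t)
          (LevelSetEstimation.levelSet f t))) ≤
        ENNReal.ofReal (C * LevelSetEstimation.levelSetRate d p n) := by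
  have hlu : l ≤ u := hA.1
  -- In dimension `0` every set is convex, so the nonconvexity of `G(l)` gives `d > 0`.
  have : Nontrivial (LevelSetEstimation.E d) := by
    by_contra hcon
    rw [not_nontrivial_iff_subsingleton] at hcon
    exact (hG l ⟨le_rfl, hlu⟩).2.2 (Set.subsingleton_of_subsingleton.convex)
  obtain ⟨ζ, m, k, L, δ, Z, U, hz, hU, hZU, hfU⟩ := hA.exists_smoothZone hp hf_nonneg
  obtain ⟨F, hF⟩ := hA.2.1
  obtain ⟨M₀, hM₀, H⟩ := hz.eventually_resolves hU hZU hp hfU hX hf_meas hf_nonneg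
    (fun x => hF ⟨x, rfl⟩) hK hKf
  refine ⟨M₀, hM₀, fun M hM ν hν => ?_⟩
  obtain ⟨b, hb, hres⟩ := H M hM
  obtain ⟨C, hC, s₀, hs₀, hbound⟩ := hz.hausdorffEDist_and_volume_le hf_meas hG hν.1 hν.2
  refine ⟨C * b, ?_⟩
  have hsmall : ∀ᶠ n in atTop, b * LevelSetEstimation.levelSetRate d p n < s₀ := by
    have := (LevelSetEstimation.tendsto_levelSetRate d hp).const_mul b
    rw [mul_zero] at this
    exact this.eventually (gt_mem_nhds hs₀)
  filter_upwards [hres] with ω hω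
  filter_upwards [hω, hsmall, eventually_ge_atTop 2] with n hn hns hn2
  have hpos := mul_pos hb (LevelSetEstimation.levelSetRate_pos d p hn2)
  rw [mul_assoc]
  exact ⟨iSup₂_le fun t ht => (hbound _ hpos hns t ht _ _ (hn t ht) _ rfl).1,
    iSup₂_le fun t ht => (hbound _ hpos hns t ht _ _ (hn t ht) _ rfl).2⟩
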